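/- Let $0\le p\le n$. There are a constant $C>0$ and thresholds $\varepsilon_0(k)>0$ $(k\ge 1)$, depending only on $n,p$ (and $k$ for $\varepsilon_0(k)$), with the following property. Let $\mathcal U(t)$, $t\in[0,1]$, be a trajectory in the Grassmann manifold $\mathrm{Gr}(n,p)$ of $p$-dimensional subspaces of $\mathbb R^n$, given by representatives $U(t)\in\mathbb R^{n\times p}$ with $U(t)^TU(t)=I_p$, and let $P(t)=U(t)U(t)^T$ be its orthogonal projector. Let $\mathcal Q\in O(n)$ be a fixed orthogonal frame, write $\mathcal Q^TU(t)=\begin{bmatrix}\widetilde U_1(t)\\ \widetilde U_2(t)\end{bmatrix}$ with $\widetilde U_1(t)\in\mathbb R^{p\times p}$, assume that $\widetilde U_1(t)$ is invertible for all $t\in[0,1]$, and let $\Xi(t)=\widetilde U_2(t)\widetilde U_1(t)^{-1}\in\mathbb R^{(n-p)\times p}$ be the maximum-volume (MV) coordinates of $\mathcal U(t)$ in this frame. Then there is a constant $K\ge 0$, depending on the trajectory and on $\mathcal Q$ but not on $k$, $\varepsilon_{\mathrm{mach}}$ or $t$, such that for every $k\ge 1$ for which $\Xi$ is of class $C^{2k+2}$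 on $[0,1]$, every $0\le\varepsilon_{\mathrm{mach}}\le\varepsilon_0(k)$ and every $t\in[0,1]$, $$\|\hat P(t)-P(t)\|_F\le C\left(\frac{1}{2^{4k+2}(2k+2)!}\,\|\Xi^{(2k+2)}\|_\infty+K\,k^{3/2}\,\varepsilon_{\mathrm{mach}}\right).$$ Here $\|\Xi^{(2k+2)}\|_\infty$ is the supremum over $[0,1]$ of the largest absolute value of an entry, and $\hat P(t)=\hat U(t)\hat U(t)^T$ is the projector reconstructed from the degree-$(2k+1)$ confluent Vandermonde-with-Arnoldi (CV+A) Hermite interpolant over $m=k+1$ Chebyshev nodes, as follows. 1. The nodes are $t_i=\tfrac12\bigl(1+\cos\tfrac{(2i+1)\pi}{2(k+1)}\bigr)$, $0\le i\le k$. The data are $\Xi_i=\Xi(t_i)$ and $\dot\Xi_i=(\widetilde T_{i,2}-\Xi_i\widetilde T_{i,1})\widetilde U_1(t_i)^{-1}$, where $T_i$ is the horizontal lift of the velocity at $t_i$ (that is, $U(t_i)^TT_i=0$ and $\dot P(t_i)=T_iU(t_i)^T+U(t_i)T_i^T$) and $\mathcal Q^TT_i=\begin{bmatrix}\widetilde T_{i,1}\\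 \widetilde T_{i,2}\end{bmatrix}$. 2. $2k+1$ steps of the Arnoldi process for $\mathbf C=\begin{bmatrix}D&0\\ I&D\end{bmatrix}$, $D=\mathrm{diag}(t_0,\dots,t_k)$, with starting vector $(\mathbf e,\mathbf 0)/\sqrt m$, orthogonalized by Gram–Schmidt with a full second pass, give basis vectors $q_0,\dots,q_{2k+1}\in\mathbb R^{2m}$ and a Hessenberg matrix $H$. The coefficients are $A_j=q_j^T\mathbf Y$, where $\mathbf Y$ stacks the $\Xi_i$ and the $\dot\Xi_i$. The interpolant is $\hat\Xi(t)=\sum_{j=0}^{2k+1}w_jA_j$, where $w_0=1/\sqrt m$ and $w_{j+1}=\bigl(t\,w_j-\sum_{l\le j}H_{l,j}w_l\bigr)/H_{j+1,j}$. 3. All operations of step 2 are carried out in floating-point arithmetic according to the standard model: each elementary operation $+,-,\times,/,\sqrt{\ }$ returns its exact result times $1+\delta$ with an arbitrary $|\delta|\le\varepsilon_{\mathrm{mach}}$; inner products and sums are accumulated by pairwise summation. The bound holds for every admissible choice of the rounding errors. 4. $\hat U(t)=\mathcal Q\begin{bmatrix}I_p\\ \hat\Xi(t)\end{bmatrix}L^{-T}$,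 where $LL^T=I_p+\hat\Xi(t)^T\hat\Xi(t)$ is the Cholesky factorization. -/

import Mathlib

open Matrix

namespace GrassmannCVA

noncomputable section

/-! ### Grassmann trajectories and MV coordinates

A point of `Gr(n, p)` is given by a Stiefel representative `U` (an `n × p` matrix with
`Uᵀ * U = 1`); the subspace itself is encoded by the projector `U * Uᵀ`. The orthogonal frame
`𝒬` has its `n` columns indexed by `Fin p ⊕ Fin (n - p)`, which gives the block partition
of `𝒬ᵀ * U`. -/

/-- The upper `p × p` block of `𝒬ᵀ * U`. -/
def upperBlock {n p : ℕ} (𝒬 : Matrix (Fin n) (Fin p ⊕ Fin (n - p)) ℝ)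
    (U : Matrix (Fin n) (Fin p) ℝ) : Matrix (Fin p) (Fin p) ℝ :=
  (𝒬ᵀ * U).toRows₁

/-- The lower `(n - p) × p` block of `𝒬ᵀ * U`. -/
def lowerBlock {n p : ℕ} (𝒬 : Matrix (Fin n) (Fin p ⊕ Fin (n - p)) ℝ)
    (U : Matrix (Fin n) (Fin p) ℝ) : Matrix (Fin (n - p)) (Fin p) ℝ :=
  (𝒬ᵀ * U).toRows₂

/-- The MV coordinates `Ξ = Ũ₂ Ũ₁⁻¹` of the subspace spanned by the columns of `U`. -/
def mvCoord {n p : ℕ} (𝒬 : Matrix (Fin n) (Fin p ⊕ Fin (n - p)) ℝ)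
    (U : Matrix (Fin n) (Fin p) ℝ) : Matrix (Fin (n - p)) (Fin p) ℝ :=
  lowerBlock 𝒬 U * (upperBlock 𝒬 U)⁻¹

/-- The coordinate velocity `(T̃₂ - Ξ T̃₁) Ũ₁⁻¹` belonging to the tangent lift `T` at `U`. -/
def mvVelocity {n p : ℕ} (𝒬 : Matrix (Fin n) (Fin p ⊕ Fin (n - p)) ℝ)
    (U T : Matrix (Fin n) (Fin p) ℝ) : Matrix (Fin (n - p)) (Fin p) ℝ :=
  (lowerBlock 𝒬 T - mvCoord 𝒬 U * upperBlock 𝒬 T) * (upperBlock 𝒬 U)⁻¹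

/-- `T` is the horizontal lift at `U t` of the velocity of the subspace trajectory at time `t`:
`Uᵀ T = 0`, and the projector has derivative `T Uᵀ + U Tᵀ`. -/
def IsHorizontalLift {n p : ℕ} (U : ℝ → Matrix (Fin n) (Fin p) ℝ) (t : ℝ)
    (T : Matrix (Fin n) (Fin p) ℝ) : Prop :=
  (U t)ᵀ * T = 0 ∧
    ∀ i j, HasDerivAt (fun τ => (U τ * (U τ)ᵀ) i j) ((T * (U t)ᵀ + U t * Tᵀ) i j) t

/-- `V` is the Stiefel representative reconstructed from the coordinates `Ξ`:
`V = 𝒬 [I; Ξ] L⁻ᵀ`, with the Cholesky factorization `L Lᵀ = I + Ξᵀ Ξ`. -/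
def IsReconstruction {n p : ℕ} (𝒬 : Matrix (Fin n) (Fin p ⊕ Fin (n - p)) ℝ)
    (Ξ : Matrix (Fin (n - p)) (Fin p) ℝ) (V : Matrix (Fin n) (Fin p) ℝ) : Prop :=
  ∃ L : Matrix (Fin p) (Fin p) ℝ,
    (∀ i j, i < j → L i j = 0) ∧ (∀ i, 0 < L i i) ∧ L * Lᵀ = 1 + Ξᵀ * Ξ ∧
      V = 𝒬 * (Matrix.fromRows 1 Ξ * (L⁻¹)ᵀ)

/-- The Frobenius norm. -/
def frobNorm {α β : Type*} [Fintype α] [Fintype β] (A : Matrix α β ℝ) : ℝ :=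
  √(∑ i, ∑ j, A i j ^ 2)

/-- `‖F⁽ʳ⁾‖_∞` on `[0, 1]`: the supremum over time of the largest entry in absolute value. -/
def derivSupNorm {d p : ℕ} (F : ℝ → Matrix (Fin d) (Fin p) ℝ) (r : ℕ) : ℝ :=
  ⨆ x : Set.Icc (0 : ℝ) 1 × Fin d × Fin p,
    |iteratedDerivWithin r (fun τ => F τ x.2.1 x.2.2) (Set.Icc (0 : ℝ) 1) x.1|

/-- The `k + 1` Chebyshev nodes of the first kind, mapped affinely to `[0, 1]`. -/
def chebNode (k : ℕ) (i : Fin (k + 1)) : ℝ :=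
  (1 + Real.cos ((2 * (i : ℝ) + 1) * Real.pi / (2 * ((k : ℝ) + 1)))) / 2

/-! ### Floating-point arithmetic (standard model)

Every elementary operation returns its exact result up to a relative error of at most `ε`. The
relations below say that a number is a possible computed result; all rounding errors are
arbitrary subject to this bound. -/

/-- `y` is a possible rounded value of `x`, i.e. `y = x (1 + δ)` with `|δ| ≤ ε`. -/
def FlRound (ε x y : ℝ) : Prop := |y - x| ≤ ε * |x|

/-- `FlSum ε l r`: `r` is a possible result of summing the list `l` by pairwise summation. -/
inductive FlSum (ε : ℝ) : List ℝ → ℝ → Prop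
  | nil : FlSum ε [] 0
  | single (x : ℝ) : FlSum ε [x] x
  | split (l₁ l₂ : List ℝ) (r₁ r₂ r : ℝ) (hpos : 0 < l₂.length)
      (hle : l₂.length ≤ l₁.length) (hle' : l₁.length ≤ l₂.length + 1)
      (h₁ : FlSum ε l₁ r₁) (h₂ : FlSum ε l₂ r₂) (hr : FlRound ε (r₁ + r₂) r) :
      FlSum ε (l₁ ++ l₂) r

/-- `r` is a possible computed value of the inner product `∑ a i * b i` over the list `l`. -/
def FlDot {ι : Type*} (ε : ℝ) (l : List ι) (a b : ι → ℝ) (r : ℝ) : Prop :=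
  ∃ z : ι → ℝ, (∀ i, FlRound ε (a i * b i) (z i)) ∧ FlSum ε (l.map z) r

/-! ### The confluent Vandermonde-with-Arnoldi method in floating-point arithmetic

Augmented vectors in `ℝ^(2m)` are indexed by `Fin m ⊕ Fin m` (function part, derivative part). -/

/-- The indices of an augmented vector, in order. -/
def augIndex (m : ℕ) : List (Fin m ⊕ Fin m) :=
  (List.finRange m).map Sum.inl ++ (List.finRange m).map Sum.inr

/-- `v` is a possible computed value of `C q`, where `C = [D, 0; I, D]` and `D = diag t`. -/
def FlConfluentMul {m : ℕ} (ε : ℝ) (t : Fin m → ℝ) (q v : Fin m ⊕ Fin m → ℝ) : Prop :=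
  (∀ i, FlRound ε (t i * q (Sum.inl i)) (v (Sum.inl i))) ∧
    ∀ i, ∃ z, FlRound ε (t i * q (Sum.inr i)) z ∧
      FlRound ε (q (Sum.inl i) + z) (v (Sum.inr i))

/-- One Gram-Schmidt pass of `v` against `Q 0, …, Q j`: the coefficients are `x l = Q l ⬝ v`,
and the result is `v' = v - ∑ l ≤ j, x l • Q l`. -/
def FlGramSchmidtPass {m : ℕ} (ε : ℝ) (Q : ℕ → Fin m ⊕ Fin m → ℝ) (j : ℕ)
    (v : Fin m ⊕ Fin m → ℝ) (x : ℕ → ℝ) (v' : Fin m ⊕ Fin m → ℝ) : Prop :=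
  (∀ l ≤ j, FlDot ε (augIndex m) (Q l) v (x l)) ∧
    ∀ i, ∃ d, FlDot ε (List.range (j + 1)) x (fun l => Q l i) d ∧ FlRound ε (v i - d) (v' i)

/-- `c` is a possible computed value of `1 / √m`. -/
def FlStart (ε : ℝ) (m : ℕ) (c : ℝ) : Prop :=
  ∃ β, FlRound ε (√(m : ℝ)) β ∧ FlRound ε (1 / β) c

/-- `N` steps of the Arnoldi process for `C = [D, 0; I, D]` with the starting vector
`(e, 0) / √m`, orthogonalized by Gram-Schmidt with a second pass (reorthogonalization):
`Q 0, …, Q N` are the computed basis vectors and `H` the computed Hessenberg matrix. -/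
structure FlArnoldi {m : ℕ} (ε : ℝ) (t : Fin m → ℝ) (N : ℕ) (c : ℝ)
    (Q : ℕ → Fin m ⊕ Fin m → ℝ) (H : ℕ → ℕ → ℝ) : Prop where
  start : Q 0 = Sum.elim (fun _ => c) (fun _ => 0)
  step : ∀ j < N, ∃ (v v' v'' : Fin m ⊕ Fin m → ℝ) (x y : ℕ → ℝ) (r : ℝ),
    FlConfluentMul ε t (Q j) v ∧
    FlGramSchmidtPass ε Q j v x v' ∧
    FlGramSchmidtPass ε Q j v' y v'' ∧
    (∀ l ≤ j, FlRound ε (x l + y l) (H l j)) ∧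
    FlDot ε (augIndex m) v'' v'' r ∧
    FlRound ε (√r) (H (j + 1) j) ∧
    ∀ i, FlRound ε (v'' i / H (j + 1) j) (Q (j + 1) i)

/-- `w 0, …, w N` are the basis functions at the point `s`, computed from the recurrence
`w (j + 1) = (s * w j - ∑ l ≤ j, H l j * w l) / H (j + 1) j`. -/
structure FlEval (ε : ℝ) (N : ℕ) (c : ℝ) (H : ℕ → ℕ → ℝ) (s : ℝ) (w : ℕ → ℝ) : Prop where
  start : w 0 = c
  step : ∀ j < N, ∃ a d z, FlRound ε (s * w j) a ∧
    FlDot ε (List.range (j + 1)) (fun l => H l j) w d ∧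
    FlRound ε (a - d) z ∧ FlRound ε (z / H (j + 1) j) (w (j + 1))

/-- `Ξhat` is a possible computed value at `s` of the degree `2k + 1` Hermite interpolant of the
values `X i` and derivatives `X' i` at the `k + 1` Chebyshev nodes: Arnoldi process, coefficients
`A j = Q jᵀ Y` for the stacked data `Y = [X; X']`, and evaluation `∑ j, w j * A j`. -/
def FlCVAHermite {d p : ℕ} (ε : ℝ) (k : ℕ) (X X' : Fin (k + 1) → Matrix (Fin d) (Fin p) ℝ)
    (s : ℝ) (Ξhat : Matrix (Fin d) (Fin p) ℝ) : Prop :=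
  ∃ (c : ℝ) (Q : ℕ → Fin (k + 1) ⊕ Fin (k + 1) → ℝ) (H : ℕ → ℕ → ℝ) (w : ℕ → ℝ)
    (A : ℕ → Matrix (Fin d) (Fin p) ℝ),
    FlStart ε (k + 1) c ∧
    FlArnoldi ε (chebNode k) (2 * k + 1) c Q H ∧
    (∀ j ≤ 2 * k + 1, ∀ a b, FlDot ε (augIndex (k + 1)) (Q j)
      (Sum.elim (fun i => X i a b) (fun i => X' i a b)) (A j a b)) ∧
    FlEval ε (2 * k + 1) c H s w ∧
    ∀ a b, FlDot ε (List.range (2 * k + 2)) w (fun j => A j a b) (Ξhat a b)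

end

end GrassmannCVA

open GrassmannCVA

/-! The computed and the true representative are orthonormal bases of the graphs of Ξ̂ and Ξ in the
frame 𝒬. The projector onto a graph is Lipschitz in the coordinates with a constant depending on n
and p only (`norm_projector_sub_le`), so an entrywise bound on Ξ̂ - Ξ suffices. The velocity data
are the derivatives of the entries (`IsHorizontalLift.hasDerivAt_mvCoord`), and the error of an
entry is the error of exact Hermite interpolation plus the effect of rounding. The former is the
classical remainder, with a nodal polynomial that is a rescaled Chebyshev polynomial
(`abs_sub_hermite_le`, `prod_sub_chebNode_sq_le`).

For rounding, the computation is compared not with the exact Arnoldi basis but with the polynomials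
π_j generated by the computed Hessenberg matrix (`hessPoly`). The exact interpolant expands in the
π_j without error. The computed vectors Q_j are nearly the Hermite data of π_j, and the computed w_j
nearly the values of π_j, because they obey the same recurrence up to residuals of order j² ε.
Residuals propagate through associated polynomials (`recurrence_eq_sub`), whose values are
coordinates of difference quotients of the π_j (`hessAssoc_eval`); by Markov's inequality these grow
only polynomially in j. The π_j themselves are bounded on [0, 1] since, by Fejér's positivity
argument, Hermite data at Chebyshev nodes control a polynomial with the constant 3
(`abs_eval_le_of_hermite_data`).

The polynomial growth in j is paid for by smoothness. The j-th coefficient of the interpolant does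
not see polynomials of degree below j, so it decays like √k (j + 1)^(-11) when Ξ and its derivative
are approximable at the rate (j + 1)^(-11) (`exists_poly_approx_derivWithin`). An entry too rough
for this admits finitely many k only, and a larger K covers them
(`exists_poly_approx_of_contDiffOn`). The remaining errors involve the depth of pairwise summation
and the loss of orthogonality of the Q_j, which reorthogonalization keeps at the same level
(`FlRun.Good.abs_gram_sub_le`). Three factors √(2k + 2) meet: from the norm of the data, from the
sum of the |w_j|, and from the propagation constant or the summation depth. Hence k^(3/2).

These estimates presuppose bounds of order one on all quantities of a run (`FlRun.Good`). As ε₀(k)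
may depend on k in any way, they follow by continuity: as ε tends to 0 a run tends to the exact
process, which does not break down in 2k + 1 steps (`arnoldi_orthonormal`), and compactness makes
this uniform over all runs (`FlRun.exists_eps_good`). -/

namespace GrassmannCVA

open Filter Topology

/-! ### The Euclidean norm of a coordinate vector -/

section L2

variable {ι : Type*} [Fintype ι]

/-- The Euclidean norm of a real vector with coordinates indexed by `ι`. -/
noncomputable def l2 (v : ι → ℝ) : ℝ := √(∑ i, v i ^ 2)

theorem l2_eq_norm (v : ι → ℝ) : l2 v = ‖(WithLp.toLp 2 v : EuclideanSpace ℝ ι)‖ := by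
  simp [l2, EuclideanSpace.norm_eq]

theorem l2_nonneg (v : ι → ℝ) : 0 ≤ l2 v := Real.sqrt_nonneg _

theorem l2_sq (v : ι → ℝ) : l2 v ^ 2 = ∑ i, v i ^ 2 :=
  Real.sq_sqrt (Finset.sum_nonneg fun _ _ => sq_nonneg _)

theorem l2_add_le (v w : ι → ℝ) : l2 (fun i => v i + w i) ≤ l2 v + l2 w := by
  simp only [l2_eq_norm]
  exact norm_add_le (WithLp.toLp 2 v : EuclideanSpace ℝ ι) (WithLp.toLp 2 w)

theorem l2_smul (a : ℝ) (v : ι → ℝ) : l2 (fun i => a * v i) = |a| * l2 v := by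
  simp only [l2_eq_norm]
  exact norm_smul a (WithLp.toLp 2 v : EuclideanSpace ℝ ι)

theorem l2_mono {v w : ι → ℝ} (h : ∀ i, |v i| ≤ |w i|) : l2 v ≤ l2 w :=
  Real.sqrt_le_sqrt (Finset.sum_le_sum fun i _ => sq_le_sq.2 (h i))

theorem l2_abs (v : ι → ℝ) : l2 (fun i => |v i|) = l2 v := by simp [l2]

theorem l2_sub_le (v w : ι → ℝ) : l2 (fun i => v i - w i) ≤ l2 v + l2 w := by
  simp only [l2_eq_norm]
  exact norm_sub_le (WithLp.toLp 2 v : EuclideanSpace ℝ ι) (WithLp.toLp 2 w)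

theorem l2_sum_le {κ : Type*} (s : Finset κ) (f : κ → ι → ℝ) :
    l2 (fun i => ∑ l ∈ s, f l i) ≤ ∑ l ∈ s, l2 (f l) := by
  classical
  induction s using Finset.induction_on with
  | empty => simp [l2]
  | insert a s ha ih =>
    simp only [Finset.sum_insert ha]
    exact (l2_add_le _ _).trans (by gcongr)

theorem l2_le_mul_of_abs_le {v w : ι → ℝ} {B : ℝ} (hB : 0 ≤ B) (h : ∀ i, |v i| ≤ B * |w i|) :
    l2 v ≤ B * l2 w := by
  calc l2 v ≤ l2 (fun i => B * w i) :=
        l2_mono fun i => by rw [abs_mul, abs_of_nonneg hB]; exact h i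
    _ = B * l2 w := by rw [l2_smul, abs_of_nonneg hB]

theorem abs_le_l2 (v : ι → ℝ) (i : ι) : |v i| ≤ l2 v :=
  Real.abs_le_sqrt (Finset.single_le_sum (f := fun i => v i ^ 2)
    (fun _ _ => sq_nonneg _) (Finset.mem_univ i))

theorem sum_abs_mul_abs_le (v w : ι → ℝ) : ∑ i, |v i| * |w i| ≤ l2 v * l2 w := by
  rw [← l2_abs v, ← l2_abs w]
  exact Real.sum_mul_le_sqrt_mul_sqrt _ _ _

theorem sum_abs_mul_le (v w : ι → ℝ) : ∑ i, |v i * w i| ≤ l2 v * l2 w := by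
  simpa only [abs_mul] using sum_abs_mul_abs_le v w

theorem abs_sum_mul_le (v w : ι → ℝ) : |∑ i, v i * w i| ≤ l2 v * l2 w :=
  (Finset.abs_sum_le_sum_abs _ _).trans (sum_abs_mul_le v w)

theorem sum_abs_le_sqrt_card_mul (v : ι → ℝ) : ∑ i, |v i| ≤ √(Fintype.card ι) * l2 v := by
  have h := sum_abs_mul_abs_le (fun _ => (1 : ℝ)) v
  simpa [l2] using h

theorem l2_le_sqrt_card_mul {v : ι → ℝ} {B : ℝ} (h : ∀ i, |v i| ≤ B) (hB : 0 ≤ B) :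
    l2 v ≤ √(Fintype.card ι) * B := by
  calc l2 v ≤ l2 (fun _ : ι => B) := l2_mono fun i => (h i).trans (le_abs_self _)
    _ = √(Fintype.card ι) * B := by simp [l2, Real.sqrt_sq hB]

end L2

/-! ### Error bounds for floating-point sums and inner products -/

theorem list_abs_sum_le (l : List ℝ) : |l.sum| ≤ (l.map abs).sum := by
  induction l with
  | nil => simp
  | cons a l ih =>
    simp only [List.sum_cons, List.map_cons]
    exact (abs_add_le _ _).trans (by gcongr)

/-- Every level of the summation tree costs one factor 1 + ε. The two halves differ in length by at
most one, so if the whole has at most 2^(e+1) terms, each half has at most 2^e. -/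
theorem FlSum.abs_sub_sum_le {ε : ℝ} (hε : 0 ≤ ε) {l : List ℝ} {r : ℝ} (h : FlSum ε l r) :
    ∀ d : ℕ, l.length ≤ 2 ^ d → |r - l.sum| ≤ ((1 + ε) ^ d - 1) * (l.map abs).sum := by
  induction h with
  | nil => simp
  | single x =>
    intro d _
    have : 1 ≤ (1 + ε) ^ d := one_le_pow₀ (by linarith)
    simpa using mul_nonneg (sub_nonneg.2 this) (abs_nonneg x)
  | split l₁ l₂ r₁ r₂ r hpos hle hle' _ _ hr ih₁ ih₂ =>
    intro d hd
    rw [List.length_append] at hd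
    obtain _ | e := d
    · simp at hd; omega
    have e1 := ih₁ e (by rw [pow_succ] at hd; omega)
    have e2 := ih₂ e (by rw [pow_succ] at hd; omega)
    set A₁ := (l₁.map abs).sum
    set A₂ := (l₂.map abs).sum
    have a1 : |l₁.sum| ≤ A₁ := list_abs_sum_le l₁
    have a2 : |l₂.sum| ≤ A₂ := list_abs_sum_le l₂
    have hr' : |r - (r₁ + r₂)| ≤ ε * |r₁ + r₂| := hr
    have h3 : |r₁ + r₂| ≤ (1 + ε) ^ e * (A₁ + A₂) := by
      calc |r₁ + r₂| = |(r₁ - l₁.sum) + (r₂ - l₂.sum) + (l₁.sum + l₂.sum)| := by ring_nf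
        _ ≤ |r₁ - l₁.sum| + |r₂ - l₂.sum| + (|l₁.sum| + |l₂.sum|) :=
          (abs_add_le _ _).trans (add_le_add (abs_add_le _ _) (abs_add_le _ _))
        _ ≤ _ := by nlinarith
    simp only [List.sum_append, List.map_append]
    calc |r - (l₁.sum + l₂.sum)|
        = |(r - (r₁ + r₂)) + ((r₁ - l₁.sum) + (r₂ - l₂.sum))| := by ring_nf
      _ ≤ |r - (r₁ + r₂)| + (|r₁ - l₁.sum| + |r₂ - l₂.sum|) :=
          (abs_add_le _ _).trans (add_le_add le_rfl (abs_add_le _ _))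
      _ ≤ ε * ((1 + ε) ^ e * (A₁ + A₂)) +
          (((1 + ε) ^ e - 1) * A₁ + ((1 + ε) ^ e - 1) * A₂) :=
          add_le_add (hr'.trans (mul_le_mul_of_nonneg_left h3 hε)) (add_le_add e1 e2)
      _ = _ := by rw [pow_succ]; ring

/-- Rounding the products adds one level to the d levels of the summation. -/
theorem FlDot.abs_sub_sum_le {ι : Type*} {ε : ℝ} (hε : 0 ≤ ε) {l : List ι} {a b : ι → ℝ} {r : ℝ}
    (h : FlDot ε l a b r) {d : ℕ} (hd : l.length ≤ 2 ^ d) :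
    |r - (l.map fun i => a i * b i).sum| ≤
      ((1 + ε) ^ (d + 1) - 1) * (l.map fun i => |a i * b i|).sum := by
  obtain ⟨z, hz, hr⟩ := h
  have h1 := hr.abs_sub_sum_le hε d (by simpa using hd)
  rw [List.map_map] at h1
  have h2 : ∀ l : List ι, |(l.map z).sum - (l.map fun i => a i * b i).sum| ≤
      ε * (l.map fun i => |a i * b i|).sum := by
    intro l
    induction l with
    | nil => simp
    | cons i l ih =>
      have := hz i
      unfold FlRound at this
      simp only [List.map_cons, List.sum_cons]
      calc _ = |(z i - a i * b i) + ((l.map z).sum - (l.map fun i => a i * b i).sum)| := by ring_nf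
        _ ≤ _ := abs_add_le _ _
        _ ≤ _ := by linarith
  have h3 : ∀ l : List ι, (l.map (abs ∘ z)).sum ≤ (1 + ε) * (l.map fun i => |a i * b i|).sum := by
    intro l
    induction l with
    | nil => simp
    | cons i l ih =>
      have := hz i
      unfold FlRound at this
      have h4 : |z i| ≤ |z i - a i * b i| + |a i * b i| := by
        simpa using abs_add_le (z i - a i * b i) (a i * b i)
      simp only [List.map_cons, List.sum_cons, Function.comp_apply]
      linarith
  have h5 : 0 ≤ (1 + ε) ^ d - 1 := sub_nonneg.2 (one_le_pow₀ (by linarith))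
  calc _ = |(r - (l.map z).sum) + ((l.map z).sum - (l.map fun i => a i * b i).sum)| := by ring_nf
    _ ≤ _ := abs_add_le _ _
    _ ≤ ((1 + ε) ^ d - 1) * ((1 + ε) * (l.map fun i => |a i * b i|).sum) +
        ε * (l.map fun i => |a i * b i|).sum :=
      add_le_add (h1.trans (mul_le_mul_of_nonneg_left (h3 l) h5)) (h2 l)
    _ = _ := by rw [pow_succ]; ring

theorem one_add_pow_sub_one_le {ε : ℝ} (hε : 0 ≤ ε) {d : ℕ} (h : d * ε ≤ 1) :
    (1 + ε) ^ d - 1 ≤ 2 * d * ε := by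
  have h1 : (1 + ε) ^ d ≤ Real.exp (d * ε) := by
    rw [Real.exp_nat_mul]
    exact pow_le_pow_left₀ (by linarith) (by linarith [Real.add_one_le_exp ε]) d
  have h0 : 0 ≤ d * ε := by positivity
  have h2 := Real.abs_exp_sub_one_sub_id_le (x := d * ε) (by rwa [abs_of_nonneg h0])
  have h3 := le_of_abs_le h2
  nlinarith

theorem sum_map_augIndex {m : ℕ} (f : Fin m ⊕ Fin m → ℝ) :
    ((augIndex m).map f).sum = ∑ i, f i := by
  simp [augIndex, Fin.sum_univ_def, Function.comp_def]

theorem sum_map_range (n : ℕ) (f : ℕ → ℝ) :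
    ((List.range n).map f).sum = ∑ l ∈ Finset.range n, f l := by
  induction n with
  | zero => simp
  | succ n ih => rw [List.range_succ, Finset.sum_range_succ]; simp [ih]

theorem FlDot.abs_sub_le_aug {m : ℕ} {ε : ℝ} (hε : 0 ≤ ε) {a b : Fin m ⊕ Fin m → ℝ} {r : ℝ}
    (h : FlDot ε (augIndex m) a b r) {d : ℕ} (hd : 2 * m ≤ 2 ^ d) (hdε : ((d : ℝ) + 1) * ε ≤ 1) :
    |r - ∑ i, a i * b i| ≤ 2 * ((d : ℝ) + 1) * ε * ∑ i, |a i * b i| := by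
  have h1 := h.abs_sub_sum_le hε (d := d) (by simpa [augIndex, two_mul] using hd)
  rw [sum_map_augIndex, sum_map_augIndex] at h1
  have h2 := one_add_pow_sub_one_le hε (d := d + 1) (by exact_mod_cast hdε)
  push_cast at h2
  exact h1.trans (mul_le_mul_of_nonneg_right h2 (Finset.sum_nonneg fun _ _ => abs_nonneg _))

theorem FlDot.abs_sub_le_range {n : ℕ} {ε : ℝ} (hε : 0 ≤ ε) {a b : ℕ → ℝ} {r : ℝ}
    (h : FlDot ε (List.range n) a b r) {d : ℕ} (hd : n ≤ 2 ^ d) (hdε : ((d : ℝ) + 1) * ε ≤ 1) :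
    |r - ∑ l ∈ Finset.range n, a l * b l| ≤
      2 * ((d : ℝ) + 1) * ε * ∑ l ∈ Finset.range n, |a l * b l| := by
  have h1 := h.abs_sub_sum_le hε (d := d) (by simpa using hd)
  rw [sum_map_range, sum_map_range] at h1
  have h2 := one_add_pow_sub_one_le hε (d := d + 1) (by exact_mod_cast hdε)
  push_cast at h2
  exact h1.trans (mul_le_mul_of_nonneg_right h2 (Finset.sum_nonneg fun _ _ => abs_nonneg _))

/-! ### Limits of floating-point operations as the unit roundoff tends to zero -/

section Limits

variable {α : Type*} {F : Filter α} {ε : α → ℝ}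

/-- The filter is arbitrary, so that these limits can be taken along an ultrafilter on the set of
all floating-point runs. -/
theorem tendsto_of_flRound (hε : Tendsto ε F (𝓝 0)) {x y : α → ℝ} {a : ℝ}
    (hx : Tendsto x F (𝓝 a)) (h : ∀ᶠ s in F, FlRound (ε s) (x s) (y s)) : Tendsto y F (𝓝 a) := by
  have h1 : Tendsto (fun s => y s - x s) F (𝓝 0) := by
    refine squeeze_zero_norm' (a := fun s => ε s * |x s|) ?_ (by simpa using hε.mul hx.abs)
    exact h
  simpa using h1.add hx

theorem tendsto_of_flDot {ι : Type*} (hε : Tendsto ε F (𝓝 0)) (hε0 : ∀ s, 0 ≤ ε s) (l : List ι)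
    {a b : α → ι → ℝ} {a₀ b₀ : ι → ℝ} {r : α → ℝ}
    (ha : ∀ i ∈ l, Tendsto (fun s => a s i) F (𝓝 (a₀ i)))
    (hb : ∀ i ∈ l, Tendsto (fun s => b s i) F (𝓝 (b₀ i)))
    (h : ∀ᶠ s in F, FlDot (ε s) l (a s) (b s) (r s)) :
    Tendsto r F (𝓝 (l.map fun i => a₀ i * b₀ i).sum) := by
  have h1 : Tendsto (fun s => (l.map fun i => a s i * b s i).sum) F
      (𝓝 (l.map fun i => a₀ i * b₀ i).sum) :=
    tendsto_list_sum l fun i hi => (ha i hi).mul (hb i hi)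
  have h2 : Tendsto (fun s => (l.map fun i => |a s i * b s i|).sum) F
      (𝓝 (l.map fun i => |a₀ i * b₀ i|).sum) :=
    tendsto_list_sum l fun i hi => ((ha i hi).mul (hb i hi)).abs
  have h3 : Tendsto (fun s => r s - (l.map fun i => a s i * b s i).sum) F (𝓝 0) := by
    refine squeeze_zero_norm' (a := fun s => ((1 + ε s) ^ (l.length + 1) - 1) *
      (l.map fun i => |a s i * b s i|).sum) ?_ ?_
    · filter_upwards [h] with s hs
      -- Any fixed depth serves for a limit; the length of the list is always enough.
      exact hs.abs_sub_sum_le (hε0 s) (Nat.lt_two_pow_self).le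
    · simpa using (((hε.const_add 1).pow (l.length + 1)).sub_const 1).mul h2
  simpa using h3.add h1

theorem tendsto_of_flDot_aug {m : ℕ} (hε : Tendsto ε F (𝓝 0)) (hε0 : ∀ s, 0 ≤ ε s)
    {a b : α → Fin m ⊕ Fin m → ℝ} {a₀ b₀ : Fin m ⊕ Fin m → ℝ} {r : α → ℝ}
    (ha : ∀ i, Tendsto (fun s => a s i) F (𝓝 (a₀ i)))
    (hb : ∀ i, Tendsto (fun s => b s i) F (𝓝 (b₀ i)))
    (h : ∀ᶠ s in F, FlDot (ε s) (augIndex m) (a s) (b s) (r s)) :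
    Tendsto r F (𝓝 (∑ i, a₀ i * b₀ i)) := by
  have := tendsto_of_flDot hε hε0 (augIndex m) (fun i _ => ha i) (fun i _ => hb i) h
  rwa [sum_map_augIndex] at this

theorem tendsto_of_flDot_range {n : ℕ} (hε : Tendsto ε F (𝓝 0)) (hε0 : ∀ s, 0 ≤ ε s)
    {a b : α → ℕ → ℝ} {a₀ b₀ : ℕ → ℝ} {r : α → ℝ}
    (ha : ∀ i < n, Tendsto (fun s => a s i) F (𝓝 (a₀ i)))
    (hb : ∀ i < n, Tendsto (fun s => b s i) F (𝓝 (b₀ i)))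
    (h : ∀ᶠ s in F, FlDot (ε s) (List.range n) (a s) (b s) (r s)) :
    Tendsto r F (𝓝 (∑ l ∈ Finset.range n, a₀ l * b₀ l)) := by
  have := tendsto_of_flDot hε hε0 (List.range n) (fun i hi => ha i (List.mem_range.1 hi))
    (fun i hi => hb i (List.mem_range.1 hi)) h
  rwa [sum_map_range] at this

end Limits

end GrassmannCVA

namespace GrassmannCVA

open Polynomial

/-! ### Markov's inequality on the unit interval -/

/-- The affine map from [-1, 1] to the segment from a to b sends 1 to b, and at the endpoint 1 the
Chebyshev polynomial, with derivative n² there, is extremal. The sign of b - a plays no role. -/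
theorem derivative_eval_mul_le_of_bounded {p : ℝ[X]} {n : ℕ} (hp : p.natDegree ≤ n) {B : ℝ}
    (hB : 0 < B) {a b : ℝ} (h : ∀ s ∈ Set.Icc (0 : ℝ) 1, |p.eval (a + s * (b - a))| ≤ B) :
    p.derivative.eval b * (b - a) ≤ 2 * n ^ 2 * B := by
  set P : ℝ[X] := C B⁻¹ * p.comp (C ((b - a) / 2) * X + C ((a + b) / 2)) with hP
  have hdeg : P.degree ≤ n := by
    refine degree_le_of_natDegree_le ((natDegree_C_mul_le _ _).trans ?_)
    refine natDegree_comp_le.trans ?_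
    calc p.natDegree * _ ≤ p.natDegree * 1 := Nat.mul_le_mul_left _ (natDegree_linear_le)
      _ ≤ n := by simpa using hp
  have hbnd : ∀ x ∈ Set.Icc (-1 : ℝ) 1, |P.eval x| ≤ 1 := by
    intro x hx
    have h1 := h ((x + 1) / 2) ⟨by linarith [hx.1], by linarith [hx.2]⟩
    have h2 : a + (x + 1) / 2 * (b - a) = (b - a) / 2 * x + (a + b) / 2 := by ring
    rw [h2] at h1
    simp only [hP, eval_mul, eval_C, eval_comp, eval_add, eval_X, abs_mul, abs_inv, abs_of_pos hB]
    rw [inv_mul_le_iff₀ hB]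
    simpa using h1
  have h1 := Chebyshev.eval_iterate_derivative_le_of_forall_abs_le_one (k := 1) (x := 1) le_rfl
    hdeg hbnd
  simp only [Function.iterate_one, Chebyshev.derivative_T_eval_one] at h1
  have h3 : (b - a) / 2 + (a + b) / 2 = b := by ring
  simp [hP, derivative_comp, h3] at h1
  rw [inv_mul_le_iff₀ hB] at h1
  nlinarith

theorem abs_derivative_eval_mul_le_of_bounded {p : ℝ[X]} {n : ℕ} (hp : p.natDegree ≤ n) {B : ℝ}
    (hB : 0 < B) {a b : ℝ} (h : ∀ s ∈ Set.Icc (0 : ℝ) 1, |p.eval (a + s * (b - a))| ≤ B) :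
    |p.derivative.eval b * (b - a)| ≤ 2 * n ^ 2 * B := by
  refine abs_le.2 ⟨?_, derivative_eval_mul_le_of_bounded hp hB h⟩
  have := derivative_eval_mul_le_of_bounded (p := -p) (by simpa using hp) hB (a := a) (b := b)
    (by simpa using h)
  simp at this
  linarith

/-- **Markov's inequality** on `[0, 1]`, with a non-optimal constant. -/
theorem abs_derivative_eval_le {p : ℝ[X]} {n : ℕ} (hp : p.natDegree ≤ n) {B : ℝ}
    (h : ∀ x ∈ Set.Icc (0 : ℝ) 1, |p.eval x| ≤ B) {x : ℝ} (hx : x ∈ Set.Icc (0 : ℝ) 1) :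
    |p.derivative.eval x| ≤ 4 * n ^ 2 * B := by
  have hB0 : 0 ≤ B := (abs_nonneg _).trans (h x hx)
  -- The rescaling divides by the bound, which therefore has to be positive; B itself is recovered
  -- in the limit.
  have key : ∀ B' > B, |p.derivative.eval x| ≤ 4 * n ^ 2 * B' := by
    intro B' hB'
    have hpos : 0 < B' := hB0.trans_lt hB'
    -- Every x is an endpoint of a segment inside [0, 1] of length at least 1/2, so the endpoint
    -- estimate suffices, at the price of a factor 2.
    obtain ⟨a, ha, hax⟩ : ∃ a ∈ Set.Icc (0 : ℝ) 1, 1 / 2 ≤ |x - a| := by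
      rcases le_total x (1 / 2) with h1 | h1
      · exact ⟨1, by simp, by rw [abs_sub_comm]; exact le_trans (by linarith) (le_abs_self _)⟩
      · exact ⟨0, by simp, by simpa using h1.trans (le_abs_self _)⟩
    have h1 := abs_derivative_eval_mul_le_of_bounded hp hpos (a := a) (b := x) (by
      intro s hs
      refine (h _ ?_).trans hB'.le
      have := (convex_Icc (0 : ℝ) 1).add_smul_sub_mem ha hx hs
      simpa using this)
    rw [abs_mul] at h1
    nlinarith [abs_nonneg (p.derivative.eval x)]
  refine le_of_forall_pos_le_add fun δ hδ => ?_
  have h1 := key (B + δ / (4 * n ^ 2 + 1)) (by linarith [show 0 < δ / (4 * (n : ℝ) ^ 2 + 1) by positivity])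
  have h2 : 4 * (n : ℝ) ^ 2 * (δ / (4 * n ^ 2 + 1)) ≤ δ := by
    rw [mul_div_assoc', div_le_iff₀ (by positivity)]
    nlinarith
  linarith

/-! ### Hermite interpolation at simple nodes -/

theorem eq_zero_of_double_roots {m : ℕ} {t : Fin m → ℝ} (ht : Function.Injective t) {p : ℝ[X]}
    (hp : p.degree < (2 * m : ℕ)) (h0 : ∀ i, p.eval (t i) = 0)
    (h1 : ∀ i, p.derivative.eval (t i) = 0) : p = 0 := by
  by_contra hne
  have hd : ∏ i, (X - C (t i)) ^ 2 ∣ p := by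
    refine Finset.prod_dvd_of_coprime ?_ ?_
    · intro i _ j _ hij
      exact (pairwise_coprime_X_sub_C ht hij).pow
    · intro i _
      rw [← le_rootMultiplicity_iff hne]
      exact (one_lt_rootMultiplicity_iff_isRoot hne).2 ⟨h0 i, h1 i⟩
  have h2 := degree_le_of_dvd hd hne
  rw [degree_prod] at h2
  simp at h2
  refine absurd (h2.trans_lt hp) (not_lt.2 ?_)
  rw [mul_comm]
  push_cast
  exact le_rfl

/-- A polynomial of degree less than `2 m` is determined by its values and derivatives at `m` nodes,
through the Hermite basis built from the Lagrange basis `ℓ`. -/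
theorem eq_sum_hermite {k : ℕ} {t : Fin (k + 1) → ℝ} (ht : Function.Injective t)
    {ℓ : Fin (k + 1) → ℝ[X]} (hdeg : ∀ i, (ℓ i).natDegree ≤ k)
    (hℓ : ∀ i j, (ℓ i).eval (t j) = if i = j then 1 else 0) {f : ℝ[X]}
    (hf : f.natDegree ≤ 2 * k + 1) :
    f = ∑ i, (C (f.eval (t i)) * ((1 - C (2 * (ℓ i).derivative.eval (t i)) * (X - C (t i))) * ℓ i ^ 2)
      + C (f.derivative.eval (t i)) * ((X - C (t i)) * ℓ i ^ 2)) := by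
  rw [← sub_eq_zero]
  apply eq_zero_of_double_roots ht
  · refine (degree_le_of_natDegree_le (n := 2 * k + 1) ?_).trans_lt (by norm_cast; omega)
    refine (natDegree_sub_le _ _).trans (max_le hf ?_)
    refine natDegree_sum_le_of_forall_le _ _ fun i _ => ?_
    have h1 : (ℓ i ^ 2).natDegree ≤ 2 * k := by
      refine natDegree_pow_le.trans ?_
      have := hdeg i
      omega
    have h2 : (1 - C (2 * (ℓ i).derivative.eval (t i)) * (X - C (t i))).natDegree ≤ 1 := by
      refine (natDegree_sub_le _ _).trans (max_le (by simp) ?_)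
      exact (natDegree_C_mul_le _ _).trans (natDegree_X_sub_C_le _)
    refine natDegree_add_le_of_degree_le ((natDegree_C_mul_le _ _).trans ?_)
      ((natDegree_C_mul_le _ _).trans ?_)
    · exact natDegree_mul_le.trans (by omega)
    · have := natDegree_X_sub_C_le (t i)
      exact natDegree_mul_le.trans (by omega)
  · intro j
    rw [eval_sub, eval_finsetSum, Finset.sum_eq_single j]
    · simp [hℓ]
    · intro i _ hij
      simp [hℓ, hij]
    · simp
  · intro j
    rw [derivative_sub, derivative_sum, eval_sub, eval_finsetSum, Finset.sum_eq_single j]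
    · simp [hℓ, derivative_mul, derivative_pow]
    · intro i _ hij
      simp [hℓ, hij, derivative_mul, derivative_pow]
    · simp

/-! ### Chebyshev nodes -/

theorem two_mul_chebNode_sub_one (k : ℕ) (i : Fin (k + 1)) :
    2 * chebNode k i - 1 = Real.cos ((2 * ((i : ℕ) : ℝ) + 1) * Real.pi / (2 * ((k + 1 : ℕ) : ℝ))) := by
  unfold chebNode
  push_cast
  ring

theorem chebNode_injective (k : ℕ) : Function.Injective (chebNode k) := by
  intro i j hij
  have h := two_mul_chebNode_sub_one k i
  rw [hij, two_mul_chebNode_sub_one] at h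
  have h1 := (Finset.range (k + 1)).nodup_map_iff_injOn.mp (Chebyshev.roots_T_real_nodup (k + 1))
  exact Fin.ext (h1 (by simp; omega) (by simp; omega) h.symm)

theorem chebNode_mem_Ioo (k : ℕ) (i : Fin (k + 1)) : chebNode k i ∈ Set.Ioo (0 : ℝ) 1 := by
  have hk : (0 : ℝ) < 2 * ((k : ℝ) + 1) := by positivity
  have hi : (i : ℝ) < k + 1 := by exact_mod_cast i.2
  set θ := (2 * (i : ℝ) + 1) * Real.pi / (2 * ((k : ℝ) + 1)) with hθ
  have h0 : 0 < θ := by positivity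
  have hpi : θ < Real.pi := by
    rw [hθ, div_lt_iff₀ hk]
    nlinarith [Real.pi_pos, show (i : ℝ) + 1 ≤ k + 1 by exact_mod_cast i.2]
  have h1 : Real.cos θ < 1 := by
    simpa using Real.cos_lt_cos_of_nonneg_of_le_pi le_rfl hpi.le h0
  have h2 : -1 < Real.cos θ := by
    simpa using Real.cos_lt_cos_of_nonneg_of_le_pi h0.le le_rfl hpi
  constructor <;> simp only [chebNode] <;> linarith

theorem chebNode_mem_Icc (k : ℕ) (i : Fin (k + 1)) : chebNode k i ∈ Set.Icc (0 : ℝ) 1 :=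
  Set.Ioo_subset_Icc_self (chebNode_mem_Ioo k i)

/-- T_(k+1) has leading coefficient 2^k, and the substitution 2x - 1 contributes 2^(k+1). Both the
size of the nodal polynomial on [0, 1] and its differential equation at the nodes are read off from
this identity. -/
theorem chebyshev_comp_eq_nodal (k : ℕ) :
    (Chebyshev.T ℝ ((k + 1 : ℕ) : ℤ)).comp (C 2 * X - 1) =
      C (2 ^ (2 * k + 1)) * ∏ i, (X - C (chebNode k i)) := by
  have hroots := Chebyshev.roots_T_real (k + 1)
  have h1 : Chebyshev.T ℝ ((k + 1 : ℕ) : ℤ) = C (2 ^ k) *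
      ∏ i : Fin (k + 1), (X - C (2 * chebNode k i - 1)) := by
    have hc : (Chebyshev.T ℝ ((k + 1 : ℕ) : ℤ)).roots.card =
        (Chebyshev.T ℝ ((k + 1 : ℕ) : ℤ)).natDegree := by
      rw [hroots, Chebyshev.natDegree_T, Int.natAbs_natCast, Finset.card_val,
        Finset.card_image_of_injOn]
      · simp
      · exact (Finset.range (k + 1)).nodup_map_iff_injOn.mp (Chebyshev.roots_T_real_nodup (k + 1))
    have h2 := C_leadingCoeff_mul_prod_multiset_X_sub_C hc
    rw [Chebyshev.leadingCoeff_T, hroots] at h2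
    rw [← h2]
    congr 1
    change (∏ r ∈ _, (X - C r)) = _
    rw [Finset.prod_image, ← Fin.prod_univ_eq_prod_range
      (fun i => X - C (Real.cos ((2 * (i : ℝ) + 1) * Real.pi / (2 * ((k + 1 : ℕ) : ℝ)))))]
    · simp_rw [two_mul_chebNode_sub_one]
    · exact (Finset.range (k + 1)).nodup_map_iff_injOn.mp (Chebyshev.roots_T_real_nodup (k + 1))
  rw [h1, mul_comp, prod_comp]
  have h3 : ∀ i : Fin (k + 1), (X - C (2 * chebNode k i - 1)).comp (C 2 * X - 1) =
      C 2 * (X - C (chebNode k i)) := by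
    intro i
    simp [mul_sub]
  simp_rw [h3, Finset.prod_mul_distrib]
  simp only [C_comp, Finset.prod_const, Finset.card_univ, Fintype.card_fin, ← mul_assoc, ← C_pow,
    ← C_mul]
  congr 2
  ring

/-- This is |T_(k+1)| ≤ 1 on [-1, 1], squared: the source of the factor 2^(-(4k+2)) in the
truncation error. -/
theorem prod_sub_chebNode_sq_le (k : ℕ) {x : ℝ} (hx : x ∈ Set.Icc (0 : ℝ) 1) :
    ∏ i, (x - chebNode k i) ^ 2 ≤ 1 / 2 ^ (4 * k + 2) := by
  have h := congrArg (eval x) (chebyshev_comp_eq_nodal k)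
  simp only [eval_comp, eval_mul, eval_sub, eval_C, eval_X, eval_one, eval_prod] at h
  have h1 := Chebyshev.abs_eval_T_real_le_one ((k + 1 : ℕ) : ℤ) (x := 2 * x - 1)
    (abs_le.2 ⟨by linarith [hx.1], by linarith [hx.2]⟩)
  rw [h] at h1
  have h2 := (sq_le_one_iff_abs_le_one _).2 h1
  rw [Finset.prod_pow, le_div_iff₀ (by positivity)]
  calc _ = (2 ^ (2 * k + 1) * ∏ i, (x - chebNode k i)) ^ 2 := by
        rw [mul_pow, ← pow_mul]; ring_nf
    _ ≤ 1 := h2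

/-- The second-order differential equation of the Chebyshev polynomials at a node. -/
theorem chebNode_nodal_ode (k : ℕ) (i : Fin (k + 1)) :
    4 * chebNode k i * (1 - chebNode k i) *
      (∏ j, (X - C (chebNode k j))).derivative.derivative.eval (chebNode k i) =
    2 * (2 * chebNode k i - 1) * (∏ j, (X - C (chebNode k j))).derivative.eval (chebNode k i) := by
  set T := Chebyshev.T ℝ ((k + 1 : ℕ) : ℤ)
  set ω : ℝ[X] := ∏ j, (X - C (chebNode k j)) with hω
  have h := chebyshev_comp_eq_nodal k
  have hode := Chebyshev.one_sub_X_sq_mul_derivative_derivative_T_eq_poly_in_T (R := ℝ) ((k + 1 : ℕ) : ℤ)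
  have hode' := congrArg (eval (2 * chebNode k i - 1)) hode
  have hT0 : T.eval (2 * chebNode k i - 1) = 0 := by
    have := congrArg (eval (chebNode k i)) h
    simp only [eval_comp, eval_mul, eval_sub, eval_C, eval_X, eval_one, eval_prod] at this
    rw [this, Finset.prod_eq_zero (Finset.mem_univ i) (by simp), mul_zero]
  have h1 := congrArg derivative h
  have h2 := congrArg derivative h1
  have e1 := congrArg (eval (chebNode k i)) h1
  have e2 := congrArg (eval (chebNode k i)) h2
  simp only [derivative_comp, derivative_mul, derivative_C, derivative_sub, derivative_X,
    derivative_one, eval_mul, eval_comp, eval_sub, eval_C, eval_X, eval_one,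
    zero_mul, zero_add, mul_one, sub_zero] at e1 e2
  simp only [Function.iterate_succ, Function.iterate_zero, Function.comp_apply, id, eval_mul,
    eval_sub, eval_one, eval_pow, eval_X] at hode'
  have hT0' : eval (2 * chebNode k i - 1) (Chebyshev.T ℝ ((k + 1 : ℕ) : ℤ)) = 0 := hT0
  rw [hT0', mul_zero, sub_zero] at hode'
  have hc : (2 : ℝ) ^ (2 * k + 1) ≠ 0 := by positivity
  apply mul_left_cancel₀ hc
  have e2' : (2 : ℝ) ^ (2 * k + 1) * eval (chebNode k i) (derivative (derivative ω)) = _ := e2.symm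
  have e1' : (2 : ℝ) ^ (2 * k + 1) * eval (chebNode k i) (derivative ω) = _ := e1.symm
  -- With z = 2x - 1 one has 1 - z² = 4x(1 - x), and the zeroth-order term of the equation vanishes
  -- at a zero of T.
  linear_combination (4 * chebNode k i * (1 - chebNode k i)) * e2' -
    (2 * (2 * chebNode k i - 1)) * e1' + 4 * hode'

/-- A polynomial of degree at most `2 k + 1` is controlled on `[0, 1]` by its values and
derivatives at the Chebyshev nodes (the Hermite-Fejér basis is nonnegative). -/
theorem abs_eval_le_of_hermite_data {k : ℕ} {f : ℝ[X]} (hf : f.natDegree ≤ 2 * k + 1) {B : ℝ}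
    (h0 : ∀ i, |f.eval (chebNode k i)| ≤ B) (h1 : ∀ i, |f.derivative.eval (chebNode k i)| ≤ B)
    {x : ℝ} (hx : x ∈ Set.Icc (0 : ℝ) 1) : |f.eval x| ≤ 3 * B := by
  set t := chebNode k with ht
  have hinj : Function.Injective t := chebNode_injective k
  set W : Fin (k + 1) → ℝ[X] := fun i => ∏ j ∈ Finset.univ.erase i, (X - C (t j)) with hW
  have hωW : ∀ i, ∏ j, (X - C (t j)) = (X - C (t i)) * W i := fun i =>
    (Finset.mul_prod_erase _ _ (Finset.mem_univ i)).symm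
  have hs : ∀ i, (W i).eval (t i) ≠ 0 := by
    intro i
    simp only [hW, eval_prod, eval_sub, eval_X, eval_C]
    refine Finset.prod_ne_zero_iff.2 fun j hj => sub_ne_zero.2 fun h => ?_
    exact (Finset.mem_erase.1 hj).1 (hinj h.symm)
  set ℓ : Fin (k + 1) → ℝ[X] := fun i => C ((W i).eval (t i))⁻¹ * W i with hℓdef
  have hdeg : ∀ i, (ℓ i).natDegree ≤ k := by
    intro i
    refine (natDegree_C_mul_le _ _).trans ((natDegree_prod_le _ _).trans ?_)
    simp
  have hℓ : ∀ i j, (ℓ i).eval (t j) = if i = j then 1 else 0 := by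
    intro i j
    split_ifs with hij
    · subst hij; simp [hℓdef, hs i]
    · have hz : (W i).eval (t j) = 0 := by
        simp only [hW, eval_prod]
        exact Finset.prod_eq_zero (i := j) (by simp [Ne.symm hij]) (by simp)
      simp [hℓdef, hz]
  -- With ω = (X - t_i) W_i one has ω'(t_i) = W_i(t_i) and ω''(t_i) = 2 W_i'(t_i), so the
  -- differential equation of ω gives the logarithmic derivative of W_i at t_i.
  have hℓ' : ∀ i, 4 * t i * (1 - t i) * (ℓ i).derivative.eval (t i) = 2 * t i - 1 := by
    intro i
    have h := chebNode_nodal_ode k i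
    rw [← ht, hωW i] at h
    simp only [derivative_mul, derivative_sub, derivative_X, derivative_C, derivative_add,
      eval_add, eval_mul, eval_sub, eval_X, eval_C, sub_self, zero_mul, sub_zero,
      one_mul, add_zero] at h
    simp only [hℓdef, derivative_mul, derivative_C, zero_mul, zero_add, eval_mul, eval_C]
    have := hs i
    field_simp
    linarith
  -- Fejér's positivity. After multiplication by 4t(1 - t), the excess over 1/2 equals 2((x - t)² +
  -- x(1 - x)).
  have hA : ∀ i, 1 / 2 ≤ 1 - 2 * (ℓ i).derivative.eval (t i) * (x - t i) := by
    intro i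
    obtain ⟨p0, p1⟩ := chebNode_mem_Ioo k i
    have hp : 0 < 4 * t i * (1 - t i) := by
      have : 0 < 1 - t i := by simpa [ht] using p1
      have : 0 < t i := p0
      positivity
    refine le_of_mul_le_mul_left ?_ hp
    have e : 4 * t i * (1 - t i) * (1 - 2 * (ℓ i).derivative.eval (t i) * (x - t i)) =
        4 * t i * (1 - t i) - 2 * (2 * t i - 1) * (x - t i) := by
      rw [← hℓ' i]; ring
    rw [e]
    nlinarith [sq_nonneg (x - t i), mul_nonneg hx.1 (sub_nonneg.2 hx.2)]
  -- Hermite interpolation reproduces the constant 1, so the nonnegative weights of the function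
  -- values sum to 1.
  have hsum : ∑ i, (1 - 2 * (ℓ i).derivative.eval (t i) * (x - t i)) * (ℓ i).eval x ^ 2 = 1 := by
    have := congrArg (eval x) (eq_sum_hermite hinj hdeg hℓ (f := 1) (by simp))
    simp only [eval_finsetSum] at this
    simpa using this.symm
  have hrep := congrArg (eval x) (eq_sum_hermite hinj hdeg hℓ hf)
  have hB : 0 ≤ B := (abs_nonneg _).trans (h0 0)
  rw [hrep, eval_finsetSum]
  calc _ ≤ ∑ i, 3 * B * ((1 - 2 * (ℓ i).derivative.eval (t i) * (x - t i)) *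
          (ℓ i).eval x ^ 2) := by
        refine (Finset.abs_sum_le_sum_abs _ _).trans (Finset.sum_le_sum fun i _ => ?_)
        simp only [eval_add, eval_mul, eval_sub, eval_one, eval_C, eval_X, eval_pow]
        have hxt : |x - t i| ≤ 1 := by
          obtain ⟨p0, p1⟩ := chebNode_mem_Ioo k i
          exact abs_le.2 ⟨by linarith [hx.1], by linarith [hx.2]⟩
        have hq := sq_nonneg ((ℓ i).eval x)
        have ha := hA i
        set a := 1 - 2 * (ℓ i).derivative.eval (t i) * (x - t i)
        set q := (ℓ i).eval x ^ 2
        refine (abs_add_le _ _).trans ?_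
        rw [abs_mul, abs_mul, abs_mul, abs_mul, abs_of_nonneg hq, abs_of_nonneg (by linarith : 0 ≤ a)]
        have e1 : |f.eval (t i)| * (a * q) ≤ B * (a * q) :=
          mul_le_mul_of_nonneg_right (h0 i) (by positivity)
        have e2 : |f.derivative.eval (t i)| * (|x - t i| * q) ≤ B * (1 * q) := by
          gcongr
          exact h1 i
        -- Since a ≥ 1/2, the weight q of a derivative is at most twice the weight of the value;
        -- hence 1 + 2 = 3.
        have e3 : B * q ≤ B * (2 * a * q) := by
          refine mul_le_mul_of_nonneg_left ?_ hB
          nlinarith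
        linarith
    _ = 3 * B := by rw [← Finset.mul_sum, hsum, mul_one]

end GrassmannCVA

namespace GrassmannCVA

open Polynomial

/-! ### Polynomial approximation of smooth functions on the unit interval -/

/-- The Bernstein polynomial is the mean of f at a binomial random point ν/n. By Cauchy-Schwarz the
mean distance of that point from x is at most its standard deviation, hence at most 1/√n. -/
theorem exists_poly_approx_of_lipschitz {f : ℝ → ℝ} {L : ℝ} (hL : 0 ≤ L)
    (hf : ∀ x ∈ Set.Icc (0 : ℝ) 1, ∀ y ∈ Set.Icc (0 : ℝ) 1, |f x - f y| ≤ L * |x - y|)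
    {n : ℕ} (hn : n ≠ 0) :
    ∃ p : ℝ[X], p.natDegree ≤ n ∧ ∀ x ∈ Set.Icc (0 : ℝ) 1, |f x - p.eval x| ≤ L / √n := by
  refine ⟨∑ ν : Fin (n + 1), C (f (bernstein.z ν)) * bernsteinPolynomial ℝ n ν, ?_, ?_⟩
  · refine natDegree_sum_le_of_forall_le _ _ fun ν _ => (natDegree_C_mul_le _ _).trans ?_
    have h1 : ((n.choose ν : ℝ[X]) * X ^ (ν : ℕ)).natDegree ≤ (ν : ℕ) := by
      rw [← C_eq_natCast]
      exact natDegree_C_mul_X_pow_le _ _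
    have h2 : (((1 : ℝ[X]) - X) ^ (n - ν)).natDegree ≤ n - ν := by
      refine natDegree_pow_le.trans ?_
      have : ((1 : ℝ[X]) - X).natDegree ≤ 1 := (natDegree_sub_le _ _).trans (by simp)
      calc _ ≤ (n - ν) * 1 := Nat.mul_le_mul_left _ this
        _ = _ := mul_one _
    have := ν.is_le
    unfold bernsteinPolynomial
    exact natDegree_mul_le.trans (by omega)
  · intro x hx
    set y : unitInterval := ⟨x, hx⟩
    have hb : ∀ ν : ℕ, (bernsteinPolynomial ℝ n ν).eval x = bernstein n ν y := fun ν => rfl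
    have hnn : ∀ ν : ℕ, 0 ≤ bernstein n ν y := fun ν => bernstein_nonneg
    have h1 : f x - (∑ ν : Fin (n + 1), C (f (bernstein.z ν)) * bernsteinPolynomial ℝ n ν).eval x =
        ∑ ν : Fin (n + 1), (f x - f (bernstein.z ν)) * bernstein n ν y := by
      simp only [eval_finsetSum, eval_mul, eval_C, hb, sub_mul, Finset.sum_sub_distrib,
        ← Finset.mul_sum, bernstein.probability, mul_one]
    have h2 : (∑ ν : Fin (n + 1), |x - bernstein.z ν| * bernstein n ν y) ^ 2 ≤ 1 / n := by
      have := Finset.sum_sq_le_sum_mul_sum_of_sq_le_mul Finset.univ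
        (r := fun ν : Fin (n + 1) => |x - bernstein.z ν| * bernstein n ν y)
        (f := fun ν => (x - bernstein.z ν) ^ 2 * bernstein n ν y)
        (g := fun ν => bernstein n ν y)
        (fun ν _ => mul_nonneg (sq_nonneg _) (hnn ν)) (fun ν _ => hnn ν)
        (fun ν _ => le_of_eq (by rw [mul_pow, sq_abs]; ring))
      refine this.trans ?_
      rw [bernstein.probability, mul_one, bernstein.variance hn y]
      gcongr
      change x * (1 - x) ≤ 1
      nlinarith [hx.1, hx.2]
    have h3 : ∑ ν : Fin (n + 1), |x - bernstein.z ν| * bernstein n ν y ≤ 1 / √n := by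
      rw [← Real.sqrt_one, ← Real.sqrt_div zero_le_one]
      exact Real.le_sqrt_of_sq_le h2
    rw [h1]
    calc _ ≤ ∑ ν : Fin (n + 1), |(f x - f (bernstein.z ν)) * bernstein n ν y| :=
          Finset.abs_sum_le_sum_abs _ _
      _ ≤ ∑ ν : Fin (n + 1), L * (|x - bernstein.z ν| * bernstein n ν y) := by
          refine Finset.sum_le_sum fun ν _ => ?_
          rw [abs_mul, abs_of_nonneg (hnn ν), ← mul_assoc]
          exact mul_le_mul_of_nonneg_right (hf x hx _ (bernstein.z ν).2) (hnn ν)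
      _ ≤ L / √n := by
          rw [← Finset.mul_sum, div_eq_mul_one_div]
          exact mul_le_mul_of_nonneg_left h3 hL

theorem exists_derivative_eq (g : ℝ[X]) {n : ℕ} (hg : g.natDegree ≤ n) :
    ∃ G : ℝ[X], G.derivative = g ∧ G.natDegree ≤ n + 1 := by
  refine ⟨∑ i ∈ Finset.range (n + 1), C (g.coeff i / (i + 1)) * X ^ (i + 1), ?_, ?_⟩
  · conv_rhs => rw [g.as_sum_range_C_mul_X_pow' (Nat.lt_succ_of_le hg)]
    rw [derivative_sum]
    refine Finset.sum_congr rfl fun i _ => ?_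
    rw [derivative_C_mul_X_pow, Nat.add_sub_cancel]
    congr 2
    have : (i : ℝ) + 1 ≠ 0 := by positivity
    push_cast
    field_simp
  · refine natDegree_sum_le_of_forall_le _ _ fun i hi => (natDegree_C_mul_X_pow_le _ _).trans ?_
    have := Finset.mem_range.1 hi
    omega

theorem exists_abs_le_of_continuousOn {f : ℝ → ℝ} (hf : ContinuousOn f (Set.Icc (0 : ℝ) 1)) :
    ∃ K : ℝ, 0 ≤ K ∧ ∀ x ∈ Set.Icc (0 : ℝ) 1, |f x| ≤ K := by
  obtain ⟨K, hK⟩ := isCompact_Icc.exists_bound_of_continuousOn hf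
  exact ⟨K, (abs_nonneg _).trans (hK 0 (by simp)), hK⟩

theorem abs_sub_le_of_abs_derivWithin_sub_le {f : ℝ → ℝ} {G : ℝ[X]} {e : ℝ}
    (hf : DifferentiableOn ℝ f (Set.Icc (0 : ℝ) 1))
    (h : ∀ x ∈ Set.Icc (0 : ℝ) 1,
      |derivWithin f (Set.Icc (0 : ℝ) 1) x - G.derivative.eval x| ≤ e) :
    ∀ x ∈ Set.Icc (0 : ℝ) 1, ∀ y ∈ Set.Icc (0 : ℝ) 1,
      |(f x - G.eval x) - (f y - G.eval y)| ≤ e * |x - y| := by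
  intro x hx y hy
  refine (convex_Icc (0 : ℝ) 1).norm_image_sub_le_of_norm_derivWithin_le
    (f := fun x => f x - G.eval x) (hf.sub G.differentiableOn) (fun z hz => ?_) hy hx
  rw [derivWithin_fun_sub (hf z hz) G.differentiableWithinAt,
    G.derivWithin (uniqueDiffOn_Icc zero_lt_one z hz)]
  exact h z hz

/-- A weak form of Jackson's theorem: functions of class `C^r` are approximated by polynomials of
degree `n` to order `n^(-r/2)`. -/
theorem exists_poly_approx (r : ℕ) : ∀ {f : ℝ → ℝ}, ContDiffOn ℝ r f (Set.Icc (0 : ℝ) 1) →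
    ∃ K : ℝ, 0 ≤ K ∧ ∀ n : ℕ, ∃ g : ℝ[X], g.natDegree ≤ n ∧
      ∀ x ∈ Set.Icc (0 : ℝ) 1, |f x - g.eval x| ≤ K / √((n : ℝ) + 1) ^ r := by
  induction r with
  | zero =>
    intro f hf
    obtain ⟨K, hK0, hK⟩ := exists_abs_le_of_continuousOn hf.continuousOn
    exact ⟨K, hK0, fun n => ⟨0, by simp, fun x hx => by simpa using hK x hx⟩⟩
  | succ r ih =>
    intro f hf
    have hd := (contDiffOn_succ_iff_derivWithin (n := (r : WithTop ℕ∞)) (f := f)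
      (uniqueDiffOn_Icc (zero_lt_one' ℝ))).1 (by exact_mod_cast hf)
    obtain ⟨K, hK0, hK⟩ := ih hd.2.2
    obtain ⟨K', hK0', hK'⟩ := exists_abs_le_of_continuousOn hf.continuousOn
    refine ⟨K * √2 ^ (r + 1) + K', by positivity, fun n => ?_⟩
    obtain _ | n := n
    · refine ⟨0, by simp, fun x hx => ?_⟩
      have := hK' x hx
      have : 0 ≤ K * √2 ^ (r + 1) := by positivity
      simp
      linarith
    obtain ⟨g, hg, hgK⟩ := hK n
    obtain ⟨G, hG, hGdeg⟩ := exists_derivative_eq g hg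
    -- G is an antiderivative of an approximant of f', so f - G has a Lipschitz constant as small as
    -- the error of that approximant. Its Bernstein approximation gains one more factor 1/√n.
    have hlip := abs_sub_le_of_abs_derivWithin_sub_le (G := G) hd.1 (by rw [hG]; exact hgK)
    obtain ⟨b, hb, hbL⟩ := exists_poly_approx_of_lipschitz (by positivity) hlip n.succ_ne_zero
    refine ⟨G + b, (natDegree_add_le _ _).trans (max_le hGdeg hb), fun x hx => ?_⟩
    have h1 := hbL x hx
    rw [eval_add, ← sub_sub]
    refine h1.trans ?_
    push_cast
    have h2 : √((n : ℝ) + 1 + 1) ≤ √2 * √((n : ℝ) + 1) := by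
      rw [← Real.sqrt_mul zero_le_two]
      exact Real.sqrt_le_sqrt (by linarith [Nat.cast_nonneg (α := ℝ) n])
    rw [div_div, ← pow_succ, div_le_div_iff₀ (by positivity) (by positivity)]
    calc K * √((n : ℝ) + 1 + 1) ^ (r + 1) ≤ K * (√2 * √((n : ℝ) + 1)) ^ (r + 1) := by gcongr
      _ = K * √2 ^ (r + 1) * √((n : ℝ) + 1) ^ (r + 1) := by rw [mul_pow]; ring
      _ ≤ _ := by gcongr; linarith

/-- Simultaneous approximation of a function of class `C^(2 s + 1)` and of its derivative by
polynomials of degree less than `j`. -/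
theorem exists_poly_approx_derivWithin (s : ℕ) {f : ℝ → ℝ}
    (hf : ContDiffOn ℝ ((2 * s + 1 : ℕ)) f (Set.Icc (0 : ℝ) 1)) :
    ∃ K : ℝ, 0 ≤ K ∧ ∀ j : ℕ, ∃ g : ℝ[X], g.degree < j ∧
      ∀ x ∈ Set.Icc (0 : ℝ) 1, |f x - g.eval x| ≤ K / ((j : ℝ) + 1) ^ s ∧
        |derivWithin f (Set.Icc (0 : ℝ) 1) x - g.derivative.eval x| ≤ K / ((j : ℝ) + 1) ^ s := by
  have hd := (contDiffOn_succ_iff_derivWithin (n := ((2 * s : ℕ) : WithTop ℕ∞)) (f := f)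
    (uniqueDiffOn_Icc (zero_lt_one' ℝ))).1 (by exact_mod_cast hf)
  obtain ⟨K, hK0, hK⟩ := exists_poly_approx (2 * s) hd.2.2
  obtain ⟨K₁, hK₁0, hK₁⟩ := exists_abs_le_of_continuousOn hf.continuousOn
  obtain ⟨K₂, hK₂0, hK₂⟩ := exists_abs_le_of_continuousOn hd.2.2.continuousOn
  refine ⟨(K + K₁ + K₂) * 3 ^ s, by positivity, fun j => ?_⟩
  -- The antiderivative below has degree at most n + 1 for j = n + 2. For j < 2 the zero polynomial
  -- is used, and the factor 3^s absorbs (j + 1)^s.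
  rcases lt_or_ge j 2 with hj | hj
  · refine ⟨0, by simp, fun x hx => ?_⟩
    have hle : (K₁ + K₂) ≤ (K + K₁ + K₂) * 3 ^ s / ((j : ℝ) + 1) ^ s := by
      rw [le_div_iff₀ (by positivity)]
      have : ((j : ℝ) + 1) ≤ 3 := by
        have : (j : ℝ) ≤ 2 := by exact_mod_cast hj.le
        linarith
      gcongr
      linarith
    simp only [eval_zero, sub_zero, derivative_zero]
    exact ⟨by linarith [hK₁ x hx], by linarith [hK₂ x hx]⟩
  · obtain ⟨n, rfl⟩ := Nat.exists_eq_add_of_le hj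
    obtain ⟨g, hg, hgK⟩ := hK n
    obtain ⟨G, hG, hGdeg⟩ := exists_derivative_eq g hg
    have hle : K / √((n : ℝ) + 1) ^ (2 * s) ≤
        (K + K₁ + K₂) * 3 ^ s / (((2 + n : ℕ) : ℝ) + 1) ^ s := by
      rw [pow_mul, Real.sq_sqrt (by positivity), div_le_div_iff₀ (by positivity) (by positivity)]
      calc K * (((2 + n : ℕ) : ℝ) + 1) ^ s ≤ K * (3 * ((n : ℝ) + 1)) ^ s := by
            gcongr
            push_cast
            linarith [Nat.cast_nonneg (α := ℝ) n]
        _ = K * 3 ^ s * ((n : ℝ) + 1) ^ s := by rw [mul_pow]; ring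
        _ ≤ _ := by gcongr; linarith
    have hlip := abs_sub_le_of_abs_derivWithin_sub_le (G := G) hd.1 (by rw [hG]; exact hgK)
    -- The constant makes the error vanish at 0, so on [0, 1] it is bounded by the error of the
    -- derivative.
    refine ⟨G + C (f 0 - G.eval 0), ?_, fun x hx => ⟨?_, ?_⟩⟩
    · have : (G + C (f 0 - G.eval 0)).natDegree ≤ n + 1 :=
        (natDegree_add_le _ _).trans (by simpa using hGdeg)
      exact (degree_le_of_natDegree_le this).trans_lt (by norm_cast; omega)
    · have h1 := hlip x hx 0 (by simp)
      rw [eval_add, eval_C]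
      have h2 : |x - 0| ≤ 1 := by rw [sub_zero, abs_of_nonneg hx.1]; exact hx.2
      calc _ = |f x - G.eval x - (f 0 - G.eval 0)| := by ring_nf
        _ ≤ _ := h1
        _ ≤ K / √((n : ℝ) + 1) ^ (2 * s) * 1 := by gcongr
        _ ≤ _ := by rw [mul_one]; exact hle
    · rw [derivative_add, derivative_C, add_zero, hG]
      exact (hgK x hx).trans hle

end GrassmannCVA

namespace GrassmannCVA

open Polynomial

/-! ### The error of Hermite interpolation -/

/-- Rolle's theorem for finitely many zeros: the zeros of the derivative lie strictly between the
given zeros of the function. -/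
theorem exists_zeros_derivWithin {f : ℝ → ℝ} (hf : ContinuousOn f (Set.Icc (0 : ℝ) 1))
    {S : Finset ℝ} {n : ℕ} (hcard : S.card = n + 1) (hS : ∀ x ∈ S, x ∈ Set.Icc (0 : ℝ) 1)
    (h0 : ∀ x ∈ S, f x = 0) :
    ∃ S' : Finset ℝ, S'.card = n ∧ Disjoint S' S ∧
      ∀ x ∈ S', x ∈ Set.Icc (0 : ℝ) 1 ∧ derivWithin f (Set.Icc (0 : ℝ) 1) x = 0 := by
  set x := S.orderEmbOfFin hcard
  have hx : ∀ i, x i ∈ S := fun i => S.orderEmbOfFin_mem hcard i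
  have hc : ∀ i : Fin n, ∃ c ∈ Set.Ioo (x i.castSucc) (x i.succ), deriv f c = 0 := fun i =>
    exists_deriv_eq_zero (x.strictMono i.castSucc_lt_succ)
      (hf.mono (Set.Icc_subset_Icc (hS _ (hx _)).1 (hS _ (hx _)).2))
      (by rw [h0 _ (hx _), h0 _ (hx _)])
  choose c hc hc0 using hc
  have hmono : StrictMono c := by
    intro i j hij
    refine (hc i).2.trans_le (le_trans (x.monotone ?_) (hc j).1.le)
    exact Fin.succ_le_castSucc_iff.2 hij
  refine ⟨Finset.univ.image c, ?_, ?_, ?_⟩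
  · rw [Finset.card_image_of_injective _ hmono.injective]; simp
  · rw [Finset.disjoint_left]
    intro y hy hyS
    obtain ⟨i, -, rfl⟩ := Finset.mem_image.1 hy
    obtain ⟨j, hj⟩ : c i ∈ Set.range x := by rw [S.range_orderEmbOfFin hcard]; exact hyS
    have h1 := hc i
    rw [← hj] at h1
    have h2 := x.lt_iff_lt.1 h1.1
    have h3 := x.lt_iff_lt.1 h1.2
    rw [Fin.lt_def] at h2 h3
    simp at h2 h3
    omega
  · intro y hy
    obtain ⟨i, -, rfl⟩ := Finset.mem_image.1 hy
    have h1 : c i ∈ Set.Ioo (0 : ℝ) 1 :=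
      ⟨(hS _ (hx _)).1.trans_lt (hc i).1, (hc i).2.trans_le (hS _ (hx _)).2⟩
    refine ⟨Set.Ioo_subset_Icc_self h1, ?_⟩
    rw [derivWithin_of_mem_nhds (Icc_mem_nhds h1.1 h1.2), hc0]

theorem exists_iteratedDerivWithin_eq_zero (r : ℕ) : ∀ {f : ℝ → ℝ},
    ContDiffOn ℝ r f (Set.Icc (0 : ℝ) 1) → ∀ {S : Finset ℝ}, S.card = r + 1 →
    (∀ x ∈ S, x ∈ Set.Icc (0 : ℝ) 1 ∧ f x = 0) →
    ∃ ξ ∈ Set.Icc (0 : ℝ) 1, iteratedDerivWithin r f (Set.Icc (0 : ℝ) 1) ξ = 0 := by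
  induction r with
  | zero =>
    intro f _ S hS h
    obtain ⟨x, hx⟩ := Finset.card_pos.1 (by omega : 0 < S.card)
    exact ⟨x, (h x hx).1, by simpa using (h x hx).2⟩
  | succ r ih =>
    intro f hf S hS h
    have hd := (contDiffOn_succ_iff_derivWithin (n := (r : WithTop ℕ∞)) (f := f)
      (uniqueDiffOn_Icc (zero_lt_one' ℝ))).1 (by exact_mod_cast hf)
    obtain ⟨S', hS', -, h'⟩ := exists_zeros_derivWithin hf.continuousOn hS
      (fun x hx => (h x hx).1) (fun x hx => (h x hx).2)
    obtain ⟨ξ, hξ, hξ0⟩ := ih hd.2.2 hS' h'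
    exact ⟨ξ, hξ, by rw [iteratedDerivWithin_succ', hξ0]⟩

theorem iteratedDerivWithin_polynomial (n : ℕ) (p : ℝ[X]) {x : ℝ} (hx : x ∈ Set.Icc (0 : ℝ) 1) :
    iteratedDerivWithin n (fun y => p.eval y) (Set.Icc (0 : ℝ) 1) x =
      (derivative^[n] p).eval x := by
  induction n generalizing p with
  | zero => simp
  | succ n ih =>
    rw [iteratedDerivWithin_succ', Function.iterate_succ_apply, ← ih]
    refine iteratedDerivWithin_congr (fun y hy => ?_) hx
    exact p.derivWithin (uniqueDiffOn_Icc zero_lt_one y hy)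

theorem iterate_derivative_eq_C_of_natDegree_le {n : ℕ} {p : ℝ[X]} (hp : p.natDegree ≤ n) :
    derivative^[n] p = C (n.factorial * p.coeff n) := by
  have h := natDegree_iterate_derivative p n
  rw [eq_C_of_natDegree_le_zero (h.trans (by omega)), coeff_iterate_derivative]
  simp [Nat.descFactorial_self]

/-- With ω = ∏ (X - t_i)², choose κ such that F = f - h - κ ω also vanishes at x. Rolle's theorem on
the k + 1 nodes and x gives k + 1 zeros of F' off these points, and the nodes are k + 1 more because
they are double zeros of F. So F' has 2k + 2 zeros, F^(2k+2) vanishes somewhere, and there f^(2k+2)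
= (2k + 2)! κ. -/
theorem abs_sub_hermite_le {k : ℕ} {t : Fin (k + 1) → ℝ} (ht : Function.Injective t)
    (htI : ∀ i, t i ∈ Set.Icc (0 : ℝ) 1) {f : ℝ → ℝ}
    (hf : ContDiffOn ℝ ((2 * k + 2 : ℕ)) f (Set.Icc (0 : ℝ) 1)) {h : ℝ[X]}
    (hh : h.natDegree ≤ 2 * k + 1) (h0 : ∀ i, h.eval (t i) = f (t i))
    (h1 : ∀ i, h.derivative.eval (t i) = derivWithin f (Set.Icc (0 : ℝ) 1) (t i)) {M : ℝ}
    (hM : ∀ ξ ∈ Set.Icc (0 : ℝ) 1,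
      |iteratedDerivWithin (2 * k + 2) f (Set.Icc (0 : ℝ) 1) ξ| ≤ M)
    {x : ℝ} (hx : x ∈ Set.Icc (0 : ℝ) 1) :
    |f x - h.eval x| ≤ M / (2 * k + 2).factorial * ∏ i, (x - t i) ^ 2 := by
  classical
  have hM0 : 0 ≤ M := (abs_nonneg _).trans (hM x hx)
  by_cases hxt : ∃ i, x = t i
  · obtain ⟨i, rfl⟩ := hxt
    rw [h0, sub_self, abs_zero]
    have : 0 ≤ ∏ j, (t i - t j) ^ 2 := Finset.prod_nonneg fun _ _ => sq_nonneg _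
    positivity
  push Not at hxt
  set ω : ℝ[X] := ∏ i, (X - C (t i)) ^ 2 with hω
  have hωx : ω.eval x = ∏ i, (x - t i) ^ 2 := by simp [hω, eval_prod]
  have hωpos : 0 < ω.eval x := by
    rw [hωx]
    exact Finset.prod_pos fun i _ => by
      have := sub_ne_zero.2 (hxt i)
      positivity
  have hωmonic : ω.Monic := monic_prod_of_monic _ _ fun i _ => (monic_X_sub_C _).pow 2
  have hωdeg : ω.natDegree = 2 * k + 2 := by
    rw [hω, natDegree_prod_of_monic _ _ fun i _ => (monic_X_sub_C _).pow 2]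
    simp
    ring
  have hω0 : ∀ i, ω.eval (t i) = 0 := by
    intro i
    simp only [hω, eval_prod]
    exact Finset.prod_eq_zero (Finset.mem_univ i) (by simp)
  have hω1 : ∀ i, ω.derivative.eval (t i) = 0 := by
    intro i
    have : ω = (X - C (t i)) ^ 2 * ∏ j ∈ Finset.univ.erase i, (X - C (t j)) ^ 2 :=
      (Finset.mul_prod_erase _ _ (Finset.mem_univ i)).symm
    rw [this]
    simp [derivative_mul, derivative_pow]
  set κ := (f x - h.eval x) / ω.eval x with hκ
  set G : ℝ[X] := h + C κ * ω with hG
  set F : ℝ → ℝ := fun y => f y - G.eval y with hF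
  have hGc : ContDiffOn ℝ ((2 * k + 2 : ℕ)) (fun y => G.eval y) (Set.Icc (0 : ℝ) 1) :=
    (G.contDiff_aeval (𝕜 := ℝ) _).contDiffOn
  have hFc : ContDiffOn ℝ ((2 * k + 2 : ℕ)) F (Set.Icc (0 : ℝ) 1) := hf.sub hGc
  have hd := (contDiffOn_succ_iff_derivWithin (n := ((2 * k + 1 : ℕ) : WithTop ℕ∞)) (f := F)
      (uniqueDiffOn_Icc (zero_lt_one' ℝ))).1 (by exact_mod_cast hFc)
  have hFx : F x = 0 := by
    simp only [hF, hG, hκ, eval_add, eval_mul, eval_C]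
    field_simp
    ring
  have hFt : ∀ i, F (t i) = 0 := fun i => by simp [hF, hG, h0, hω0]
  have hFt' : ∀ i, derivWithin F (Set.Icc (0 : ℝ) 1) (t i) = 0 := by
    intro i
    have hu := uniqueDiffOn_Icc (zero_lt_one' ℝ) (t i) (htI i)
    simp only [hF]
    rw [derivWithin_fun_sub (hf.differentiableOn (by simp) _ (htI i)) G.differentiableWithinAt,
      G.derivWithin hu]
    simp [hG, h1, hω1]
  set S₀ : Finset ℝ := Finset.univ.image t with hS₀
  have hS₀c : S₀.card = k + 1 := by rw [hS₀, Finset.card_image_of_injective _ ht]; simp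
  have hxS : x ∉ S₀ := by
    intro h'
    obtain ⟨i, -, hi⟩ := Finset.mem_image.1 h'
    exact hxt i hi.symm
  obtain ⟨S', hS'c, hS'd, hS'⟩ := exists_zeros_derivWithin (S := insert x S₀) (n := k + 1)
    hFc.continuousOn (by rw [Finset.card_insert_of_notMem hxS, hS₀c])
    (by
      intro y hy
      rcases Finset.mem_insert.1 hy with rfl | hy
      · exact hx
      · obtain ⟨i, -, rfl⟩ := Finset.mem_image.1 hy
        exact htI i)
    (by
      intro y hy
      rcases Finset.mem_insert.1 hy with rfl | hy
      · exact hFx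
      · obtain ⟨i, -, rfl⟩ := Finset.mem_image.1 hy
        exact hFt i)
  obtain ⟨ξ, hξ, hξ0⟩ := exists_iteratedDerivWithin_eq_zero (2 * k + 1) hd.2.2 (S := S' ∪ S₀)
    (by
      rw [Finset.card_union_of_disjoint (hS'd.mono_right (Finset.subset_insert _ _)), hS'c, hS₀c]
      ring)
    (by
      intro y hy
      rcases Finset.mem_union.1 hy with hy | hy
      · exact hS' y hy
      · obtain ⟨i, -, rfl⟩ := Finset.mem_image.1 hy
        exact ⟨htI i, hFt' i⟩)
  rw [← iteratedDerivWithin_succ'] at hξ0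
  have hu := uniqueDiffOn_Icc (zero_lt_one' ℝ)
  have h2 : iteratedDerivWithin (2 * k + 2) F (Set.Icc (0 : ℝ) 1) ξ =
      iteratedDerivWithin (2 * k + 2) f (Set.Icc (0 : ℝ) 1) ξ - (2 * k + 2).factorial * κ := by
    have e : F = f - fun y => G.eval y := rfl
    rw [e, iteratedDerivWithin_sub hξ hu (hf ξ hξ) (hGc ξ hξ), iteratedDerivWithin_polynomial _ _ hξ,
      iterate_derivative_eq_C_of_natDegree_le, eval_C]
    · congr 2
      rw [hG, coeff_add, coeff_C_mul, coeff_eq_zero_of_natDegree_lt (by omega : h.natDegree < _),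
        ← hωdeg, hωmonic.coeff_natDegree]
      ring
    · refine (natDegree_add_le _ _).trans (max_le (by omega) ?_)
      exact (natDegree_C_mul_le _ _).trans hωdeg.le
  rw [show 2 * k + 1 + 1 = 2 * k + 2 from rfl, h2, sub_eq_zero] at hξ0
  have h3 := hM ξ hξ
  rw [hξ0, abs_mul, Nat.abs_cast] at h3
  have hfac : (0 : ℝ) < (2 * k + 2).factorial := by positivity
  have h4 : f x - h.eval x = κ * ω.eval x := by rw [hκ]; field_simp
  rw [h4, abs_mul, abs_of_pos hωpos, ← hωx]
  refine mul_le_mul_of_nonneg_right ?_ hωpos.le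
  rw [le_div_iff₀ hfac]
  linarith

end GrassmannCVA

namespace GrassmannCVA

/-! ### Projectors and MV coordinates -/

section Projector

open scoped Matrix.Norms.Frobenius

theorem frobNorm_eq_norm {α β : Type*} [Fintype α] [Fintype β] (A : Matrix α β ℝ) :
    frobNorm A = ‖A‖ := by
  rw [frobNorm, frobenius_norm_def, Real.sqrt_eq_rpow]
  simp

theorem norm_sq_eq_trace {α β : Type*} [Fintype α] [Fintype β] (A : Matrix α β ℝ) :
    ‖A‖ ^ 2 = (Aᵀ * A).trace := by
  have h : 0 ≤ ∑ i, ∑ j, A i j ^ 2 :=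
    Finset.sum_nonneg fun _ _ => Finset.sum_nonneg fun _ _ => sq_nonneg _
  rw [← frobNorm_eq_norm, frobNorm, Real.sq_sqrt h, Finset.sum_comm]
  simp [Matrix.trace, Matrix.mul_apply, sq]

theorem norm_le_sqrt_card {α β : Type*} [Fintype α] [Fintype β] [DecidableEq β] {A : Matrix α β ℝ}
    (h : Aᵀ * A = 1) : ‖A‖ ≤ √(Fintype.card β) := by
  refine Real.le_sqrt_of_sq_le ?_
  rw [norm_sq_eq_trace, h, trace_one]

theorem norm_le_of_abs_le {α β : Type*} [Fintype α] [Fintype β] {A : Matrix α β ℝ} {B : ℝ}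
    (hB : 0 ≤ B) (h : ∀ i j, |A i j| ≤ B) :
    ‖A‖ ≤ √(Fintype.card α * Fintype.card β) * B := by
  rw [← frobNorm_eq_norm, frobNorm]
  calc _ ≤ √(∑ _i : α, ∑ _j : β, B ^ 2) := by
        refine Real.sqrt_le_sqrt (Finset.sum_le_sum fun i _ => Finset.sum_le_sum fun j _ => ?_)
        exact sq_le_sq' (by linarith [neg_abs_le (A i j), h i j]) ((le_abs_self _).trans (h i j))
    _ = _ := by
        simp only [Finset.sum_const, Finset.card_univ, nsmul_eq_mul]
        rw [← mul_assoc, Real.sqrt_mul (by positivity), Real.sqrt_sq hB]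

variable {n p : ℕ}

/-- The block matrix `[I; X]`, whose column space is the graph of `X`. -/
def graphMatrix {d p : ℕ} (X : Matrix (Fin d) (Fin p) ℝ) : Matrix (Fin p ⊕ Fin d) (Fin p) ℝ :=
  fromRows 1 X

theorem transpose_mul_self_of_graph {𝒬 : Matrix (Fin n) (Fin p ⊕ Fin (n - p)) ℝ}
    (h𝒬 : 𝒬ᵀ * 𝒬 = 1) (X : Matrix (Fin (n - p)) (Fin p) ℝ) (S : Matrix (Fin p) (Fin p) ℝ) :
    (𝒬 * (graphMatrix X * S))ᵀ * (𝒬 * (graphMatrix X * S)) = Sᵀ * (1 + Xᵀ * X) * S := by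
  have h1 : (graphMatrix X)ᵀ * graphMatrix X = 1 + Xᵀ * X := by
    rw [graphMatrix, transpose_fromRows, fromCols_mul_fromRows]
    simp
  calc _ = Sᵀ * ((graphMatrix X)ᵀ * (𝒬ᵀ * 𝒬) * graphMatrix X) * S := by
        simp only [transpose_mul, Matrix.mul_assoc]
    _ = _ := by rw [h𝒬, Matrix.mul_one, h1]

/-- Taking traces in VᵀV = 1 gives ‖S‖² + ‖X S‖² = p. This bound is free of X, which is why the
Lipschitz constant of the projector does not depend on the trajectory. -/
theorem norm_le_of_graph {𝒬 : Matrix (Fin n) (Fin p ⊕ Fin (n - p)) ℝ} (h𝒬 : 𝒬ᵀ * 𝒬 = 1)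
    {X : Matrix (Fin (n - p)) (Fin p) ℝ} {S : Matrix (Fin p) (Fin p) ℝ}
    (hV : (𝒬 * (graphMatrix X * S))ᵀ * (𝒬 * (graphMatrix X * S)) = 1) : ‖S‖ ≤ √p := by
  refine Real.le_sqrt_of_sq_le ?_
  rw [transpose_mul_self_of_graph h𝒬] at hV
  have h1 : Sᵀ * (1 + Xᵀ * X) * S = Sᵀ * S + (X * S)ᵀ * (X * S) := by
    rw [transpose_mul, Matrix.mul_add, Matrix.add_mul, Matrix.mul_one]
    simp only [Matrix.mul_assoc]
  have h2 := congrArg Matrix.trace (h1.symm.trans hV)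
  rw [trace_add, ← norm_sq_eq_trace, ← norm_sq_eq_trace, trace_one, Fintype.card_fin] at h2
  nlinarith [sq_nonneg ‖X * S‖]

/-- V₁ differs by 𝒬 [0; X₁ - X₂] S₁ from a matrix whose columns lie in the range of V₂, and the
complementary projector kills that range. -/
theorem complement_mul_projector {𝒬 : Matrix (Fin n) (Fin p ⊕ Fin (n - p)) ℝ}
    {X₁ X₂ : Matrix (Fin (n - p)) (Fin p) ℝ} {S₁ S₂ : Matrix (Fin p) (Fin p) ℝ}
    {V₁ V₂ : Matrix (Fin n) (Fin p) ℝ} (hV₁ : V₁ = 𝒬 * (graphMatrix X₁ * S₁))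
    (hV₂ : V₂ = 𝒬 * (graphMatrix X₂ * S₂)) (hS₂ : IsUnit S₂) (h₂ : V₂ᵀ * V₂ = 1) :
    (1 - V₂ * V₂ᵀ) * (V₁ * V₁ᵀ) =
      (1 - V₂ * V₂ᵀ) * (𝒬 * (fromRows (0 : Matrix (Fin p) (Fin p) ℝ) (X₁ - X₂) * S₁) * V₁ᵀ) := by
  have h0 : (1 - V₂ * V₂ᵀ) * V₂ = 0 := by
    rw [Matrix.sub_mul, Matrix.one_mul, Matrix.mul_assoc, h₂, Matrix.mul_one, sub_self]
  have hcancel : S₂ * S₂⁻¹ = 1 := mul_nonsing_inv _ ((isUnit_iff_isUnit_det _).1 hS₂)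
  have hsplit : V₁ = 𝒬 * (fromRows (0 : Matrix (Fin p) (Fin p) ℝ) (X₁ - X₂) * S₁) +
      V₂ * (S₂⁻¹ * S₁) := by
    have e1 : V₂ * (S₂⁻¹ * S₁) = 𝒬 * (graphMatrix X₂ * S₁) := by
      rw [hV₂]
      calc _ = 𝒬 * (graphMatrix X₂ * ((S₂ * S₂⁻¹) * S₁)) := by simp only [Matrix.mul_assoc]
        _ = _ := by rw [hcancel, Matrix.one_mul]
    rw [e1, ← Matrix.mul_add, ← Matrix.add_mul, hV₁]
    congr 2
    ext (i | i) j <;> simp [graphMatrix]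
  have h3 : (1 - V₂ * V₂ᵀ) * V₁ =
      (1 - V₂ * V₂ᵀ) * (𝒬 * (fromRows (0 : Matrix (Fin p) (Fin p) ℝ) (X₁ - X₂) * S₁)) := by
    conv_lhs => rw [hsplit]
    rw [Matrix.mul_add, ← Matrix.mul_assoc (1 - V₂ * V₂ᵀ) V₂, h0, Matrix.zero_mul, add_zero]
  rw [← Matrix.mul_assoc, h3, Matrix.mul_assoc]

/-- The projector onto the graph of `X` depends on `X` in a Lipschitz way. -/
theorem norm_projector_sub_le {𝒬 : Matrix (Fin n) (Fin p ⊕ Fin (n - p)) ℝ} (hp : p ≤ n)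
    (h𝒬 : 𝒬ᵀ * 𝒬 = 1) {X₁ X₂ : Matrix (Fin (n - p)) (Fin p) ℝ}
    {S₁ S₂ : Matrix (Fin p) (Fin p) ℝ} {V₁ V₂ : Matrix (Fin n) (Fin p) ℝ}
    (hV₁ : V₁ = 𝒬 * (graphMatrix X₁ * S₁)) (hV₂ : V₂ = 𝒬 * (graphMatrix X₂ * S₂))
    (hS₁ : IsUnit S₁) (hS₂ : IsUnit S₂) (h₁ : V₁ᵀ * V₁ = 1) (h₂ : V₂ᵀ * V₂ = 1) {B : ℝ}
    (hB : 0 ≤ B) (hX : ∀ i j, |X₁ i j - X₂ i j| ≤ B) :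
    frobNorm (V₁ * V₁ᵀ - V₂ * V₂ᵀ) ≤ 2 * ((√n + √p * √p) * (√n * (√(n * p) * B * √p) * √p)) := by
  have key : ∀ {X₁ X₂ : Matrix (Fin (n - p)) (Fin p) ℝ}
      {S₁ S₂ : Matrix (Fin p) (Fin p) ℝ} {V₁ V₂ : Matrix (Fin n) (Fin p) ℝ}
      (hV₁ : V₁ = 𝒬 * (graphMatrix X₁ * S₁)) (hV₂ : V₂ = 𝒬 * (graphMatrix X₂ * S₂))
      (hS₂ : IsUnit S₂) (h₁ : V₁ᵀ * V₁ = 1) (h₂ : V₂ᵀ * V₂ = 1)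
      (hX : ∀ i j, |X₁ i j - X₂ i j| ≤ B),
      ‖(1 - V₂ * V₂ᵀ) * (V₁ * V₁ᵀ)‖ ≤
        (√n + √p * √p) * (√n * (√(n * p) * B * √p) * √p) := by
    intro X₁ X₂ S₁ S₂ V₁ V₂ hV₁ hV₂ hS₂ h₁ h₂ hX
    rw [complement_mul_projector hV₁ hV₂ hS₂ h₂]
    have n1 : ‖V₁‖ ≤ √p := by simpa using norm_le_sqrt_card h₁
    have n2 : ‖V₂‖ ≤ √p := by simpa using norm_le_sqrt_card h₂
    have nQ : ‖𝒬‖ ≤ √n := by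
      have := norm_le_sqrt_card h𝒬
      rw [Fintype.card_sum, Fintype.card_fin, Fintype.card_fin, Nat.add_sub_of_le hp] at this
      exact this
    have nS : ‖S₁‖ ≤ √p := norm_le_of_graph h𝒬 (by rw [← hV₁]; exact h₁)
    have n1' : ‖V₁ᵀ‖ ≤ √p := by rwa [frobenius_norm_transpose]
    have n2' : ‖V₂ᵀ‖ ≤ √p := by rwa [frobenius_norm_transpose]
    have nI : ‖(1 : Matrix (Fin n) (Fin n) ℝ)‖ ≤ √n := by
      simpa using norm_le_sqrt_card (A := (1 : Matrix (Fin n) (Fin n) ℝ)) (by simp)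
    have nD : ‖fromRows (0 : Matrix (Fin p) (Fin p) ℝ) (X₁ - X₂)‖ ≤ √(n * p) * B := by
      have := norm_le_of_abs_le (A := fromRows (0 : Matrix (Fin p) (Fin p) ℝ) (X₁ - X₂)) hB (by
        rintro (i | i) j
        · simpa using hB
        · simpa using hX i j)
      rw [Fintype.card_sum, Fintype.card_fin, Fintype.card_fin, Nat.add_sub_of_le hp] at this
      exact this
    have nC : ‖1 - V₂ * V₂ᵀ‖ ≤ √n + √p * √p := by
      refine (norm_sub_le _ _).trans (add_le_add nI ((frobenius_norm_mul _ _).trans ?_))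
      gcongr
    refine (frobenius_norm_mul _ _).trans ?_
    gcongr
    refine (frobenius_norm_mul _ _).trans ?_
    gcongr
    refine (frobenius_norm_mul _ _).trans ?_
    gcongr
    refine (frobenius_norm_mul _ _).trans ?_
    gcongr
  -- For orthogonal projectors, P₁ - P₂ = (1 - P₂) P₁ - ((1 - P₁) P₂)ᵀ, which reduces the claim to
  -- the one-sided estimate.
  have e : V₁ * V₁ᵀ - V₂ * V₂ᵀ =
      (1 - V₂ * V₂ᵀ) * (V₁ * V₁ᵀ) - ((1 - V₁ * V₁ᵀ) * (V₂ * V₂ᵀ))ᵀ := by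
    simp only [Matrix.sub_mul, Matrix.one_mul, transpose_sub, transpose_mul, transpose_transpose]
    abel
  rw [frobNorm_eq_norm, e, two_mul]
  refine (norm_sub_le _ _).trans (add_le_add (key hV₁ hV₂ hS₂ h₁ h₂ hX) ?_)
  rw [frobenius_norm_transpose]
  refine key hV₂ hV₁ hS₁ h₂ h₁ fun i j => ?_
  rw [abs_sub_comm]
  exact hX i j

end Projector

/-! ### Graph representations of subspaces and the velocity of the coordinates. -/

section Coordinates

variable {n p : ℕ} {𝒬 : Matrix (Fin n) (Fin p ⊕ Fin (n - p)) ℝ}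

theorem eq_graph_mvCoord (h𝒬 : 𝒬 * 𝒬ᵀ = 1) {U : Matrix (Fin n) (Fin p) ℝ}
    (hU : IsUnit (upperBlock 𝒬 U)) :
    U = 𝒬 * (graphMatrix (mvCoord 𝒬 U) * upperBlock 𝒬 U) := by
  have h1 : graphMatrix (mvCoord 𝒬 U) * upperBlock 𝒬 U = 𝒬ᵀ * U := by
    rw [graphMatrix, fromRows_mul, Matrix.one_mul, mvCoord, Matrix.mul_assoc,
      nonsing_inv_mul _ ((isUnit_iff_isUnit_det _).1 hU), Matrix.mul_one]
    exact fromRows_toRows _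
  rw [h1, ← Matrix.mul_assoc, h𝒬, Matrix.one_mul]

theorem isUnit_of_lowerTriangular {L : Matrix (Fin p) (Fin p) ℝ} (h0 : ∀ i j, i < j → L i j = 0)
    (h1 : ∀ i, 0 < L i i) : IsUnit L := by
  rw [isUnit_iff_isUnit_det, det_of_isLowerTriangular L fun i j hij => h0 i j hij]
  exact (Finset.prod_pos fun i _ => h1 i).ne'.isUnit

theorem IsReconstruction.exists_graph (h𝒬 : 𝒬ᵀ * 𝒬 = 1) {Ξ : Matrix (Fin (n - p)) (Fin p) ℝ}
    {V : Matrix (Fin n) (Fin p) ℝ} (h : IsReconstruction 𝒬 Ξ V) :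
    ∃ S : Matrix (Fin p) (Fin p) ℝ, IsUnit S ∧ V = 𝒬 * (graphMatrix Ξ * S) ∧ Vᵀ * V = 1 := by
  obtain ⟨L, h0, h1, hL, hV⟩ := h
  replace hV : V = 𝒬 * (graphMatrix Ξ * (L⁻¹)ᵀ) := hV
  have hu := isUnit_of_lowerTriangular h0 h1
  have hd := (isUnit_iff_isUnit_det _).1 hu
  refine ⟨(L⁻¹)ᵀ, ?_, hV, ?_⟩
  · rw [isUnit_iff_isUnit_det, det_transpose]
    exact isUnit_nonsing_inv_det _ hd
  · rw [hV, transpose_mul_self_of_graph h𝒬, ← hL, transpose_transpose, ← Matrix.mul_assoc,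
      nonsing_inv_mul _ hd, Matrix.one_mul, ← transpose_mul, nonsing_inv_mul _ hd, transpose_one]

theorem hasDerivAt_mul_mul_apply {α β γ δ : Type*} [Fintype β] [Fintype γ]
    (A : Matrix α β ℝ) (B : Matrix γ δ ℝ) {M : ℝ → Matrix β γ ℝ} {M' : Matrix β γ ℝ} {t : ℝ}
    (h : ∀ i j, HasDerivAt (fun τ => M τ i j) (M' i j) t) (i : α) (j : δ) :
    HasDerivAt (fun τ => (A * M τ * B) i j) ((A * M' * B) i j) t := by
  simp only [Matrix.mul_apply]
  exact HasDerivAt.fun_sum fun c _ =>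
    (HasDerivAt.fun_sum fun b _ => (h b c).const_mul (A i b)).mul_const (B c j)

/-- The coordinate velocity built from the horizontal lift is the derivative of the MV
coordinates. -/
theorem IsHorizontalLift.hasDerivAt_mvCoord {U : ℝ → Matrix (Fin n) (Fin p) ℝ} {t : ℝ}
    {T : Matrix (Fin n) (Fin p) ℝ} (hT : IsHorizontalLift U t T)
    (hU : ∀ᶠ τ in nhds t, IsUnit (upperBlock 𝒬 (U τ)))
    (hd : ∀ a b, DifferentiableAt ℝ (fun τ => mvCoord 𝒬 (U τ) a b) t) (a : Fin (n - p))
    (b : Fin p) :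
    HasDerivAt (fun τ => mvCoord 𝒬 (U τ) a b) (mvVelocity 𝒬 (U t) T a b) t := by
  set D : Matrix (Fin (n - p)) (Fin p) ℝ := fun a b => deriv (fun τ => mvCoord 𝒬 (U τ) a b) t
  have hD : ∀ a b, HasDerivAt (fun τ => mvCoord 𝒬 (U τ) a b) (D a b) t :=
    fun a b => (hd a b).hasDerivAt
  set U₁ := upperBlock 𝒬 (U t) with hU₁
  set U₂ := lowerBlock 𝒬 (U t) with hU₂
  have hunit : IsUnit U₁ := hU.self_of_nhds
  have hdet := (isUnit_iff_isUnit_det _).1 hunit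
  have hdetT : IsUnit (U₁ᵀ).det := by rwa [det_transpose]
  have hP := hasDerivAt_mul_mul_apply 𝒬ᵀ 𝒬 hT.2
  have hfac : ∀ A B : Matrix (Fin n) (Fin p) ℝ, 𝒬ᵀ * (A * Bᵀ) * 𝒬 = (𝒬ᵀ * A) * (𝒬ᵀ * B)ᵀ := by
    intro A B
    rw [transpose_mul, transpose_transpose]
    simp only [Matrix.mul_assoc]
  have hP' : 𝒬ᵀ * (T * (U t)ᵀ + U t * Tᵀ) * 𝒬 =
      (𝒬ᵀ * T) * (𝒬ᵀ * U t)ᵀ + (𝒬ᵀ * U t) * (𝒬ᵀ * T)ᵀ := by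
    rw [Matrix.mul_add, Matrix.add_mul, hfac, hfac]
  simp only [hfac, hP'] at hP
  -- Only the projector is known to be differentiable, not U. The blocks of 𝒬ᵀ P 𝒬 satisfy Ξ (U₁
  -- U₁ᵀ) = U₂ U₁ᵀ; differentiating this relation and cancelling U₁ᵀ and U₁ yields the derivative of
  -- Ξ.
  have h11 : ∀ c b : Fin p, HasDerivAt
      (fun τ => (upperBlock 𝒬 (U τ) * (upperBlock 𝒬 (U τ))ᵀ) c b)
      ((upperBlock 𝒬 T * U₁ᵀ + U₁ * (upperBlock 𝒬 T)ᵀ) c b) t :=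
    fun c b => hP (Sum.inl c) (Sum.inl b)
  have h21 : ∀ (a : Fin (n - p)) (b : Fin p), HasDerivAt
      (fun τ => (lowerBlock 𝒬 (U τ) * (upperBlock 𝒬 (U τ))ᵀ) a b)
      ((lowerBlock 𝒬 T * U₁ᵀ + U₂ * (upperBlock 𝒬 T)ᵀ) a b) t :=
    fun a b => hP (Sum.inr a) (Sum.inl b)
  have hprod : ∀ a b, HasDerivAt
      (fun τ => (mvCoord 𝒬 (U τ) * (upperBlock 𝒬 (U τ) * (upperBlock 𝒬 (U τ))ᵀ)) a b)
      ((D * (U₁ * U₁ᵀ) + mvCoord 𝒬 (U t) *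
        (upperBlock 𝒬 T * U₁ᵀ + U₁ * (upperBlock 𝒬 T)ᵀ)) a b) t := by
    intro a b
    rw [Matrix.add_apply, Matrix.mul_apply, Matrix.mul_apply, ← Finset.sum_add_distrib]
    simp only [Matrix.mul_apply (M := mvCoord 𝒬 _)]
    exact HasDerivAt.fun_sum fun c _ => (hD a c).mul (h11 c b)
  have hEq : ∀ a b, (fun τ => (mvCoord 𝒬 (U τ) *
      (upperBlock 𝒬 (U τ) * (upperBlock 𝒬 (U τ))ᵀ)) a b) =ᶠ[nhds t]
      fun τ => (lowerBlock 𝒬 (U τ) * (upperBlock 𝒬 (U τ))ᵀ) a b := by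
    intro a b
    filter_upwards [hU] with τ hτ
    rw [mvCoord, Matrix.mul_assoc, ← Matrix.mul_assoc _⁻¹,
      nonsing_inv_mul _ ((isUnit_iff_isUnit_det _).1 hτ), Matrix.one_mul]
  have hmat : D * (U₁ * U₁ᵀ) + mvCoord 𝒬 (U t) *
      (upperBlock 𝒬 T * U₁ᵀ + U₁ * (upperBlock 𝒬 T)ᵀ) =
      lowerBlock 𝒬 T * U₁ᵀ + U₂ * (upperBlock 𝒬 T)ᵀ := by
    ext a b
    exact (hprod a b).unique ((h21 a b).congr_of_eventuallyEq (hEq a b))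
  have hΞ : mvCoord 𝒬 (U t) * U₁ = U₂ := by
    rw [mvCoord, Matrix.mul_assoc, nonsing_inv_mul _ hdet, Matrix.mul_one]
  have h3 : D * U₁ * U₁ᵀ = (lowerBlock 𝒬 T - mvCoord 𝒬 (U t) * upperBlock 𝒬 T) * U₁ᵀ := by
    rw [Matrix.mul_add, ← Matrix.mul_assoc (mvCoord 𝒬 (U t)) U₁, hΞ, ← add_assoc, add_right_cancel_iff] at hmat
    rw [Matrix.sub_mul, Matrix.mul_assoc, Matrix.mul_assoc, ← hmat, add_sub_cancel_right]
  have h4 : D = mvVelocity 𝒬 (U t) T := by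
    have h5 := congrArg (fun M => M * (U₁ᵀ)⁻¹ * U₁⁻¹) h3
    simp only [Matrix.mul_assoc, mul_nonsing_inv _ hdetT, Matrix.mul_one,
      mul_nonsing_inv _ hdet] at h5
    exact h5
  rw [← h4]
  exact hD a b

end Coordinates

end GrassmannCVA

namespace GrassmannCVA

open Polynomial

/-! ### Hessenberg recurrences -/

section Hessenberg

/-- The solution of the recurrence `X z_j = ∑ l ≤ j + 1, H l j z_l + b_j` with initial value
`z₀`. -/
noncomputable def hessRec (H : ℕ → ℕ → ℝ) (z₀ : ℝ[X]) (b : ℕ → ℝ[X]) : ℕ → ℝ[X]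
  | 0 => z₀
  | j + 1 => C (H (j + 1) j)⁻¹ *
      (X * hessRec H z₀ b j - ∑ l : Fin (j + 1), C (H l j) * hessRec H z₀ b l - b j)

theorem hessRec_zero (H : ℕ → ℕ → ℝ) (z₀ : ℝ[X]) (b : ℕ → ℝ[X]) : hessRec H z₀ b 0 = z₀ := by
  rw [hessRec]

theorem X_mul_hessRec {H : ℕ → ℕ → ℝ} (z₀ : ℝ[X]) (b : ℕ → ℝ[X]) {j : ℕ} (hj : H (j + 1) j ≠ 0) :
    X * hessRec H z₀ b j =
      ∑ l ∈ Finset.range (j + 2), C (H l j) * hessRec H z₀ b l + b j := by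
  rw [Finset.sum_range_succ, hessRec, ← mul_assoc, ← C_mul, mul_inv_cancel₀ hj, C_1, one_mul,
    Fin.sum_univ_eq_sum_range (fun l => C (H l j) * hessRec H z₀ b l) (j + 1)]
  ring

theorem natDegree_hessRec_le {H : ℕ → ℕ → ℝ} {z₀ : ℝ[X]} {b : ℕ → ℝ[X]} (hz : z₀.natDegree ≤ 0)
    (hb : ∀ j, (b j).natDegree ≤ 0) (j : ℕ) : (hessRec H z₀ b j).natDegree ≤ j := by
  induction j using Nat.strong_induction_on with
  | _ j ih =>
    obtain _ | j := j
    · rwa [hessRec_zero]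
    rw [hessRec]
    refine (natDegree_C_mul_le _ _).trans ((natDegree_sub_le _ _).trans (max_le ?_ ?_))
    · refine (natDegree_sub_le _ _).trans (max_le ?_ ?_)
      · refine natDegree_mul_le.trans ?_
        have := ih j (Nat.lt_succ_self j)
        have := natDegree_X_le (R := ℝ)
        omega
      · refine natDegree_sum_le_of_forall_le _ _ fun l _ => (natDegree_C_mul_le _ _).trans ?_
        exact (ih l l.2).trans l.2.le
    · exact (hb j).trans (Nat.zero_le _)

theorem hessRec_eq_of_recurrence {V : Type*} [AddCommGroup V] [Module ℝ V] (a : V →ₗ[ℝ] V)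
    {H : ℕ → ℕ → ℝ} {N : ℕ} (hH : ∀ j < N, H (j + 1) j ≠ 0) {z z' f : ℕ → V} (h0 : z 0 = z' 0)
    (hz : ∀ j < N, a (z j) = ∑ l ∈ Finset.range (j + 2), H l j • z l + f j)
    (hz' : ∀ j < N, a (z' j) = ∑ l ∈ Finset.range (j + 2), H l j • z' l + f j) :
    ∀ j ≤ N, z j = z' j := by
  intro j
  induction j using Nat.strong_induction_on with
  | _ j ih =>
    intro hj
    obtain _ | j := j
    · exact h0
    have h1 := hz j hj
    have h2 := hz' j hj
    rw [ih j (Nat.lt_succ_self j) (Nat.le_of_succ_le hj), h2, add_left_inj, Finset.sum_range_succ,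
      Finset.sum_range_succ _ (j + 1), Finset.sum_congr rfl (g := fun l => H l j • z l),
      add_right_inj] at h1
    · exact (smul_right_injective V (hH j hj) h1).symm
    · intro l hl
      have := Finset.mem_range.1 hl
      rw [ih l this (by omega)]

/-- The polynomials generated by the Hessenberg matrix `H`, starting from the constant `c`. -/
noncomputable def hessPoly (c : ℝ) (H : ℕ → ℕ → ℝ) : ℕ → ℝ[X] := hessRec H (C c) 0

/-- The associated polynomials, which propagate a perturbation of the recurrence at step `l`. -/
noncomputable def hessAssoc (H : ℕ → ℕ → ℝ) (l : ℕ) : ℕ → ℝ[X] :=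
  hessRec H 0 fun j => if j = l then -1 else 0

variable {c : ℝ} {H : ℕ → ℕ → ℝ}

theorem natDegree_hessPoly_le (c : ℝ) (H : ℕ → ℕ → ℝ) (j : ℕ) : (hessPoly c H j).natDegree ≤ j :=
  natDegree_hessRec_le (by simp) (by simp) j

theorem natDegree_hessAssoc_le (H : ℕ → ℕ → ℝ) (l j : ℕ) : (hessAssoc H l j).natDegree ≤ j := by
  refine natDegree_hessRec_le (by simp) (fun i => ?_) j
  split_ifs <;> simp

theorem X_mul_hessPoly {j : ℕ} (hj : H (j + 1) j ≠ 0) :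
    X * hessPoly c H j = ∑ l ∈ Finset.range (j + 2), C (H l j) * hessPoly c H l := by
  simpa [hessPoly] using X_mul_hessRec (C c) 0 hj

theorem hessAssoc_eq_zero {l j : ℕ} (hj : j ≤ l) : hessAssoc H l j = 0 := by
  induction j using Nat.strong_induction_on with
  | _ j ih =>
    obtain _ | j := j
    · rw [hessAssoc, hessRec_zero]
    · rw [hessAssoc, hessRec, ← hessAssoc, ih j (Nat.lt_succ_self j) (by omega),
        if_neg (by omega), Finset.sum_eq_zero]
      · simp
      · intro i _
        rw [ih i i.2 (i.2.le.trans hj), mul_zero]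

theorem aeval_X_mul {V : Type*} [AddCommGroup V] [Module ℝ V] (a : V →ₗ[ℝ] V) (p : ℝ[X]) (v : V) :
    aeval a (X * p) v = a (aeval a p v) := by simp

/-- Propagation of perturbations in a Hessenberg recurrence. -/
theorem recurrence_eq_sub {V : Type*} [AddCommGroup V] [Module ℝ V] (a : V →ₗ[ℝ] V) {N : ℕ}
    (hH : ∀ j < N, H (j + 1) j ≠ 0) {z f : ℕ → V} {v : V} (h0 : z 0 = c • v)
    (hz : ∀ j < N, a (z j) = ∑ l ∈ Finset.range (j + 2), H l j • z l + f j) :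
    ∀ j ≤ N, z j = aeval a (hessPoly c H j) v -
      ∑ l ∈ Finset.range j, aeval a (hessAssoc H l j) (f l) := by
  -- The recurrence determines its solution, so it is enough that the right side solves it. The sum
  -- is extended to N because the associated polynomials vanish for j ≤ l.
  have key := hessRec_eq_of_recurrence a hH (z := z) (f := f)
    (z' := fun j => aeval a (hessPoly c H j) v -
      ∑ l ∈ Finset.range N, aeval a (hessAssoc H l j) (f l)) ?_ hz ?_
  · intro j hj
    rw [key j hj]
    congr 1
    refine (Finset.sum_subset (Finset.range_mono hj) fun l _ hl => ?_).symm
    rw [hessAssoc_eq_zero (by simpa using hl), map_zero, LinearMap.zero_apply]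
  · rw [h0, Finset.sum_eq_zero]
    · simp [hessPoly, hessRec_zero]
    · intro l _
      rw [hessAssoc_eq_zero (Nat.zero_le _), map_zero, LinearMap.zero_apply]
  · intro j hj
    have e1 : a (aeval a (hessPoly c H j) v) =
        ∑ l ∈ Finset.range (j + 2), H l j • aeval a (hessPoly c H l) v := by
      rw [← aeval_X_mul, X_mul_hessPoly (hH j hj), map_sum, LinearMap.sum_apply]
      simp
    have e2 : ∀ l, a (aeval a (hessAssoc H l j) (f l)) =
        ∑ i ∈ Finset.range (j + 2), H i j • aeval a (hessAssoc H l i) (f l) -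
          if j = l then f l else 0 := by
      intro l
      rw [← aeval_X_mul, hessAssoc, X_mul_hessRec _ _ (hH j hj), map_add, map_sum,
        LinearMap.add_apply, LinearMap.sum_apply, sub_eq_add_neg]
      congr 1
      · simp
      · split_ifs <;> simp
    rw [map_sub, map_sum, e1]
    simp only [e2, Finset.sum_sub_distrib, smul_sub, Finset.smul_sum]
    rw [Finset.sum_comm, Finset.sum_ite_eq, if_pos (Finset.mem_range.2 hj)]
    abel

/-- The associated polynomials in terms of a functional that is dual to the polynomials
`hessPoly`. -/
theorem hessAssoc_eval {N l : ℕ} (hH : ∀ j < N, H (j + 1) j ≠ 0) (Λ : ℝ[X] →ₗ[ℝ] ℝ)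
    (hΛ : ∀ j < N, Λ (hessPoly c H j) = if j = l then 1 else 0) (x : ℝ) {j : ℕ} (hj : j ≤ N) :
    (hessAssoc H l j).eval x = Λ (hessPoly c H j /ₘ (X - C x)) := by
  set π := hessPoly c H
  have hdiv : ∀ j, (X - C x) * (π j /ₘ (X - C x)) = π j - C ((π j).eval x) := by
    intro j
    have := modByMonic_add_div (π j) (X - C x)
    rw [modByMonic_X_sub_C_eq_C_eval] at this
    exact eq_sub_of_add_eq' this
  refine hessRec_eq_of_recurrence (LinearMap.mulLeft ℝ x) hH
    (z := fun j => (hessAssoc H l j).eval x) (z' := fun j => Λ (π j /ₘ (X - C x)))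
    (f := fun j => if j = l then -1 else 0) ?_ ?_ ?_ j hj
  · have : π 0 /ₘ (X - C x) = 0 := by
      rw [divByMonic_eq_zero_iff (monic_X_sub_C x), degree_X_sub_C]
      refine lt_of_le_of_lt (degree_le_of_natDegree_le (natDegree_hessPoly_le c H 0)) ?_
      norm_num
    simp [this, hessAssoc_eq_zero]
  · intro j hj
    have := congrArg (eval x) (X_mul_hessRec 0 (fun j => if j = l then -1 else 0) (hH j hj))
    rw [eval_add, eval_finsetSum] at this
    simp only [eval_mul, eval_X, eval_C] at this
    simp only [LinearMap.mulLeft_apply, smul_eq_mul, hessAssoc]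
    rw [this]
    congr 1
    split_ifs <;> simp
  · intro j hj
    -- Difference quotients turn X π_j into x d_j + π_j. So the d_j obey the recurrence of the π_j
    -- at the point x with the perturbation -π_j, and Λ makes this perturbation -1 at j = l and 0
    -- otherwise, as for the associated polynomials.
    have e : C x * (π j /ₘ (X - C x)) =
        ∑ i ∈ Finset.range (j + 2), C (H i j) * (π i /ₘ (X - C x)) - π j := by
      apply mul_left_cancel₀ (X_sub_C_ne_zero x)
      have h1 : (X - C x) * ∑ i ∈ Finset.range (j + 2), C (H i j) * (π i /ₘ (X - C x)) =
          X * π j - C (x * (π j).eval x) := by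
        have h2 := congrArg (eval x) (X_mul_hessPoly (c := c) (hH j hj))
        rw [eval_finsetSum] at h2
        simp only [eval_mul, eval_X, eval_C] at h2
        rw [X_mul_hessPoly (hH j hj), h2, map_sum, Finset.mul_sum, ← Finset.sum_sub_distrib]
        refine Finset.sum_congr rfl fun i _ => ?_
        rw [mul_left_comm, hdiv, mul_sub, C_mul]
      rw [mul_sub, h1, mul_left_comm, hdiv, C_mul]
      ring
    have := congrArg Λ e
    rw [map_sub, map_sum, hΛ j hj] at this
    simp only [← smul_eq_C_mul, map_smul, smul_eq_mul] at this
    simp only [LinearMap.mulLeft_apply, smul_eq_mul]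
    rw [this]
    split_ifs <;> ring

end Hessenberg

/-! ### The confluent action of polynomials and Hermite data -/

section Confluent

variable {m : ℕ}

/-- The linear map with matrix `[D, 0; I, D]`, where `D = diag t`. -/
def confluentMap (t : Fin m → ℝ) : (Fin m ⊕ Fin m → ℝ) →ₗ[ℝ] (Fin m ⊕ Fin m → ℝ) where
  toFun q := Sum.elim (fun i => t i * q (Sum.inl i)) fun i => q (Sum.inl i) + t i * q (Sum.inr i)
  map_add' q q' := by ext (i | i) <;> simp <;> ring
  map_smul' a q := by ext (i | i) <;> simp <;> ring

/-- The values and derivatives of a polynomial at the nodes `t`. -/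
noncomputable def hermiteData (t : Fin m → ℝ) : ℝ[X] →ₗ[ℝ] (Fin m ⊕ Fin m → ℝ) where
  toFun p := Sum.elim (fun i => p.eval (t i)) fun i => p.derivative.eval (t i)
  map_add' p q := by ext (i | i) <;> simp
  map_smul' a p := by ext (i | i) <;> simp

/-- The matrix C multiplies u + η u' by t + η, where η² = 0; hence p(C) multiplies by p(t) + η
p'(t). Applied to (e, 0) it produces exactly the Hermite data of p. -/
theorem aeval_confluentMap (t : Fin m → ℝ) (p : ℝ[X]) (v : Fin m ⊕ Fin m → ℝ) :
    aeval (confluentMap t) p v = Sum.elim (fun i => p.eval (t i) * v (Sum.inl i)) fun i =>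
      p.derivative.eval (t i) * v (Sum.inl i) + p.eval (t i) * v (Sum.inr i) := by
  induction p using Polynomial.induction_on' with
  | add p q hp hq =>
    rw [map_add, LinearMap.add_apply, hp, hq]
    ext (i | i) <;> simp <;> ring
  | monomial n a =>
    rw [← C_mul_X_pow_eq_monomial]
    induction n with
    | zero => ext (i | i) <;> simp
    | succ n ih =>
      rw [pow_succ', mul_left_comm, aeval_X_mul, ih]
      ext (i | i)
      · simp [confluentMap]
        ring
      · simp [confluentMap, derivative_mul]
        ring

theorem aeval_confluentMap_one (t : Fin m → ℝ) (p : ℝ[X]) :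
    aeval (confluentMap t) p (Sum.elim (fun _ => 1) fun _ => 0) = hermiteData t p := by
  rw [aeval_confluentMap]
  ext (i | i) <;> simp [hermiteData]

theorem l2_aeval_confluentMap_le {t : Fin m → ℝ} {p : ℝ[X]} {B B' : ℝ} (hB : 0 ≤ B) (hB' : 0 ≤ B')
    (h : ∀ i, |p.eval (t i)| ≤ B) (h' : ∀ i, |p.derivative.eval (t i)| ≤ B')
    (v : Fin m ⊕ Fin m → ℝ) : l2 (aeval (confluentMap t) p v) ≤ (B + B') * l2 v := by
  set v' : Fin m ⊕ Fin m → ℝ := Sum.elim (fun _ => 0) fun i => v (Sum.inl i)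
  have hv' : l2 v' ≤ l2 v := by
    unfold l2
    refine Real.sqrt_le_sqrt ?_
    rw [Fintype.sum_sum_type, Fintype.sum_sum_type]
    simp only [v', Sum.elim_inl, Sum.elim_inr, ne_eq, OfNat.ofNat_ne_zero, not_false_eq_true,
      zero_pow, Finset.sum_const_zero, zero_add]
    exact le_add_of_nonneg_right (Finset.sum_nonneg fun _ _ => sq_nonneg _)
  have e : aeval (confluentMap t) p v = fun i =>
      Sum.elim (fun i => p.eval (t i) * v (Sum.inl i)) (fun i => p.eval (t i) * v (Sum.inr i)) i +
      Sum.elim (fun _ => 0) (fun i => p.derivative.eval (t i) * v (Sum.inl i)) i := by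
    rw [aeval_confluentMap]
    ext (i | i)
    · simp
    · simp [add_comm]
  rw [e, add_mul]
  refine (l2_add_le _ _).trans (add_le_add (l2_le_mul_of_abs_le hB ?_)
    ((l2_le_mul_of_abs_le (w := v') hB' ?_).trans (mul_le_mul_of_nonneg_left hv' hB')))
  · rintro (i | i) <;> simp only [Sum.elim_inl, Sum.elim_inr, abs_mul] <;>
      exact mul_le_mul_of_nonneg_right (h i) (abs_nonneg _)
  · rintro (i | i)
    · simp [v']
    · simp only [Sum.elim_inr, abs_mul, v']
      exact mul_le_mul_of_nonneg_right (h' i) (abs_nonneg _)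

theorem l2_confluentMap_le {t : Fin m → ℝ} (h : ∀ i, |t i| ≤ 1) (v : Fin m ⊕ Fin m → ℝ) :
    l2 (confluentMap t v) ≤ 2 * l2 v := by
  have := l2_aeval_confluentMap_le (t := t) (p := X) (B := 1) (B' := 1) (by simp) (by simp)
    (by simpa using h) (by simp) v
  rw [aeval_X] at this
  linarith

end Confluent

/-! ### Coordinates in a nearly orthonormal basis -/

/-- The Gram matrix differs from the identity by entries of size η, so for nη ≤ 1/2 the squared norm
of a combination is at least half that of its coefficients. The n vectors are therefore a basis,
with coordinates bounded by √2 (here 2) times the norm. -/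
theorem exists_coordinates {ι : Type*} [Fintype ι] {n : ℕ} (hn : Fintype.card ι = n)
    {W : ℕ → ι → ℝ} {η : ℝ} (hη : n * η ≤ 1 / 2)
    (hW : ∀ a < n, ∀ b < n, |∑ i, W a i * W b i - if a = b then 1 else 0| ≤ η) :
    ∃ Λ : (ι → ℝ) →ₗ[ℝ] (ℕ → ℝ), (∀ v i, v i = ∑ j ∈ Finset.range n, Λ v j * W j i) ∧
      (∀ j < n, ∀ l < n, Λ (W j) l = if j = l then 1 else 0) ∧
      ∀ v, ∀ j < n, |Λ v j| ≤ 2 * l2 v := by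
  have hlow : ∀ α : Fin n → ℝ, l2 α ^ 2 ≤ 2 * l2 (fun i => ∑ j, α j * W j i) ^ 2 := by
    intro α
    rw [l2_sq (fun i => ∑ j, α j * W j i)]
    have e : ∑ i, (∑ j : Fin n, α j * W j i) ^ 2 =
        ∑ a : Fin n, ∑ b : Fin n, α a * α b * ∑ i, W a i * W b i := by
      simp_rw [sq, Finset.sum_mul_sum, Finset.mul_sum]
      rw [Finset.sum_comm]
      refine Finset.sum_congr rfl fun a _ => ?_
      rw [Finset.sum_comm]
      exact Finset.sum_congr rfl fun b _ => Finset.sum_congr rfl fun i _ => by ring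
    have e2 : l2 α ^ 2 = ∑ a : Fin n, ∑ b : Fin n, α a * α b * if (a : ℕ) = b then 1 else 0 := by
      rw [l2_sq]
      refine Finset.sum_congr rfl fun a _ => ?_
      simp [Fin.val_inj, sq]
    have e3 : |∑ i, (∑ j : Fin n, α j * W j i) ^ 2 - l2 α ^ 2| ≤ η * (∑ a, |α a|) ^ 2 := by
      rw [e, e2, ← Finset.sum_sub_distrib, sq, Finset.sum_mul_sum, Finset.mul_sum]
      refine (Finset.abs_sum_le_sum_abs _ _).trans (Finset.sum_le_sum fun a _ => ?_)
      rw [← Finset.sum_sub_distrib, Finset.mul_sum]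
      refine (Finset.abs_sum_le_sum_abs _ _).trans (Finset.sum_le_sum fun b _ => ?_)
      rw [← mul_sub, abs_mul, abs_mul, mul_comm η]
      exact mul_le_mul_of_nonneg_left (hW a a.2 b b.2) (by positivity)
    have e4 : (∑ a, |α a|) ^ 2 ≤ n * l2 α ^ 2 := by
      have := sum_abs_le_sqrt_card_mul α
      rw [Fintype.card_fin] at this
      calc _ ≤ (√n * l2 α) ^ 2 := by gcongr
        _ = _ := by rw [mul_pow, Real.sq_sqrt (by positivity)]
    rcases Nat.eq_zero_or_pos n with rfl | hpos
    · simp [l2]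
    have hη0 : 0 ≤ η := (abs_nonneg _).trans (hW 0 hpos 0 hpos)
    have e5 : η * (∑ a, |α a|) ^ 2 ≤ 1 / 2 * l2 α ^ 2 := by
      calc _ ≤ η * (n * l2 α ^ 2) := mul_le_mul_of_nonneg_left e4 hη0
        _ = (n * η) * l2 α ^ 2 := by ring
        _ ≤ _ := mul_le_mul_of_nonneg_right hη (sq_nonneg _)
    have := (abs_le.1 e3).1
    linarith
  set Φ : (Fin n → ℝ) →ₗ[ℝ] (ι → ℝ) :=
    { toFun := fun α i => ∑ j, α j * W j i
      map_add' := fun α β => by ext i; simp [add_mul, Finset.sum_add_distrib]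
      map_smul' := fun a α => by ext i; simp [Finset.mul_sum, mul_assoc] } with hΦ
  have hΦa : ∀ α i, Φ α i = ∑ j, α j * W j i := fun _ _ => rfl
  have hinj : Function.Injective Φ := by
    rw [injective_iff_map_eq_zero]
    intro α hα
    have h1 := hlow α
    have h2 : (fun i => ∑ j, α j * W j i) = 0 := hα
    rw [h2] at h1
    have h3 : l2 α ^ 2 ≤ 0 := by simpa [l2] using h1
    ext j
    have h4 := abs_le_l2 α j
    have h5 : l2 α = 0 := by nlinarith [l2_nonneg α]
    rw [h5] at h4
    exact abs_nonpos_iff.1 h4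
  set Ψ := LinearMap.linearEquivOfInjective Φ hinj (by simp [hn]) with hΨ
  have hΨa : ∀ α, Ψ α = Φ α := fun _ => rfl
  set ext0 : (Fin n → ℝ) →ₗ[ℝ] (ℕ → ℝ) :=
    { toFun := fun α j => if h : j < n then α ⟨j, h⟩ else 0
      map_add' := fun α β => by ext j; by_cases h : j < n <;> simp [h]
      map_smul' := fun a α => by ext j; by_cases h : j < n <;> simp [h] } with hext
  have hexta : ∀ α (j : Fin n), ext0 α j = α j := fun α j => by
    change (if h : (j : ℕ) < n then α ⟨j, h⟩ else 0) = α j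
    simp
  refine ⟨ext0 ∘ₗ Ψ.symm.toLinearMap, ?_, ?_, ?_⟩
  · intro v i
    have h1 : Φ (Ψ.symm v) i = v i := by rw [← hΨa, Ψ.apply_symm_apply]
    rw [← h1, hΦa, ← Fin.sum_univ_eq_sum_range
      (fun j => (ext0 ∘ₗ Ψ.symm.toLinearMap) v j * W j i)]
    simp [hexta]
  · intro j hj l hl
    have h1 : Ψ (Pi.single ⟨j, hj⟩ 1) = W j := by
      rw [hΨa]
      ext i
      rw [hΦa, Finset.sum_eq_single ⟨j, hj⟩]
      · simp
      · intro b _ hb; simp [hb]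
      · simp
    rw [← h1]
    have := hexta (Pi.single ⟨j, hj⟩ 1) ⟨l, hl⟩
    simp only [LinearMap.comp_apply, LinearEquiv.coe_coe, LinearEquiv.symm_apply_apply] at this ⊢
    rw [this, Pi.single_apply]
    simp [Fin.ext_iff, eq_comm]
  · intro v j hj
    have h0 := hexta (Ψ.symm v) ⟨j, hj⟩
    simp only [LinearMap.comp_apply, LinearEquiv.coe_coe] at h0 ⊢
    rw [h0]
    have h1 := hlow (Ψ.symm v)
    have h2 : (fun i => ∑ j, Ψ.symm v j * W j i) = v := by
      ext i
      rw [← hΦa, ← hΨa, Ψ.apply_symm_apply]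
    rw [h2] at h1
    refine (abs_le_l2 _ _).trans (abs_le_of_sq_le_sq' ?_ (by linarith [l2_nonneg v])).2
    nlinarith [l2_nonneg v]

end GrassmannCVA

namespace GrassmannCVA

open Polynomial

/-! ### Bounds for Hessenberg recurrences at the Chebyshev nodes -/

/-- Write g = X g₁ + const. By the recurrence, multiplication by X sends the span of the first n
polynomials into that of the first n + 1. -/
theorem mem_span_hessPoly {c : ℝ} {H : ℕ → ℕ → ℝ} {N : ℕ} (hc : c ≠ 0)
    (hH : ∀ j < N, H (j + 1) j ≠ 0) : ∀ n ≤ N + 1, ∀ g : ℝ[X], g.degree < n →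
      g ∈ Submodule.span ℝ (hessPoly c H '' Set.Iio n) := by
  intro n
  induction n with
  | zero =>
    intro _ g hg
    have : g = 0 := by simpa using hg
    rw [this]
    exact Submodule.zero_mem _
  | succ n ih =>
    intro hn g hg
    rw [← X_mul_divX_add g]
    refine Submodule.add_mem _ ?_ ?_
    · have h1 : g.divX.degree < n := by
        rcases eq_or_ne g.divX 0 with h0 | h0
        · rw [h0, degree_zero]; exact WithBot.bot_lt_coe _
        · have h2 : g ≠ 0 := by rintro rfl; simp at h0
          rw [degree_eq_natDegree h2] at hg
          rw [degree_eq_natDegree h0, natDegree_divX_eq_natDegree_tsub_one]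
          have h3 : g.natDegree ≠ 0 := by
            intro h4
            rw [eq_C_of_natDegree_eq_zero h4, divX_C] at h0
            exact h0 rfl
          norm_cast at hg ⊢
          omega
      have h2 := ih (Nat.le_of_succ_le hn) _ h1
      refine Submodule.span_induction (p := fun q _ =>
        X * q ∈ Submodule.span ℝ (hessPoly c H '' Set.Iio (n + 1))) ?_ ?_ ?_ ?_ h2
      · rintro _ ⟨i, hi, rfl⟩
        have hi' : i < n := hi
        rw [X_mul_hessPoly (hH i (by omega))]
        refine Submodule.sum_mem _ fun l hl => ?_
        rw [← smul_eq_C_mul]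
        refine Submodule.smul_mem _ _ (Submodule.subset_span ⟨l, ?_, rfl⟩)
        have := Finset.mem_range.1 hl
        exact Set.mem_Iio.2 (by omega)
      · simp
      · intro p q _ _ hp hq
        rw [mul_add]
        exact Submodule.add_mem _ hp hq
      · intro a p _ hp
        rw [mul_smul_comm]
        exact Submodule.smul_mem _ _ hp
    · have h1 : C (g.coeff 0) = (g.coeff 0 / c) • hessPoly c H 0 := by
        rw [hessPoly, hessRec_zero, smul_C, smul_eq_mul, div_mul_cancel₀ _ hc]
      rw [h1]
      exact Submodule.smul_mem _ _ (Submodule.subset_span ⟨0, by simp, rfl⟩)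

theorem abs_divByMonic_eval_le {p : ℝ[X]} {B : ℝ}
    (h : ∀ x ∈ Set.Icc (0 : ℝ) 1, |p.derivative.eval x| ≤ B) {x y : ℝ}
    (hx : x ∈ Set.Icc (0 : ℝ) 1) (hy : y ∈ Set.Icc (0 : ℝ) 1) :
    |(p /ₘ (X - C x)).eval y| ≤ B := by
  set d := p /ₘ (X - C x)
  have hdiv : C (p.eval x) + (X - C x) * d = p := by
    have := modByMonic_add_div p (X - C x)
    rwa [modByMonic_X_sub_C_eq_C_eval] at this
  rcases eq_or_ne y x with rfl | hne
  · have := congrArg (fun q => q.derivative.eval y) hdiv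
    simp [derivative_mul] at this
    rw [this]
    exact h y hy
  · have h1 := congrArg (eval y) hdiv
    simp at h1
    have h2 := (convex_Icc (0 : ℝ) 1).norm_image_sub_le_of_norm_derivWithin_le
      (f := fun x => p.eval x) (C := B) p.differentiableOn (fun z hz => by
        rw [p.derivWithin (uniqueDiffOn_Icc zero_lt_one z hz)]
        exact h z hz) hx hy
    simp only [Real.norm_eq_abs] at h2
    rw [← h1, add_sub_cancel_left, abs_mul, mul_comm] at h2
    exact le_of_mul_le_mul_right h2 (abs_pos.2 (sub_ne_zero.2 hne))

section Bounds

variable {k : ℕ} {c : ℝ} {H : ℕ → ℕ → ℝ}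

/-- The Hermite data of the polynomials generated by `H` are nearly orthonormal. -/
def NearlyOrthonormal (k : ℕ) (c : ℝ) (H : ℕ → ℕ → ℝ) : Prop :=
  ∀ a < 2 * k + 2, ∀ b < 2 * k + 2,
    |∑ i, hermiteData (chebNode k) (hessPoly c H a) i * hermiteData (chebNode k) (hessPoly c H b) i -
      if a = b then 1 else 0| ≤ 1 / (4 * ((k : ℝ) + 1))

theorem NearlyOrthonormal.l2_le (hW : NearlyOrthonormal k c H) {j : ℕ} (hj : j < 2 * k + 2) :
    l2 (hermiteData (chebNode k) (hessPoly c H j)) ≤ 2 := by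
  have h := (abs_le.1 (hW j hj j hj)).2
  rw [if_pos rfl] at h
  have h1 : 1 / (4 * ((k : ℝ) + 1)) ≤ 1 := by
    rw [div_le_one (by positivity)]
    linarith [Nat.cast_nonneg (α := ℝ) k]
  refine abs_le_of_sq_le_sq' ?_ (by norm_num) |>.2
  rw [l2_sq]
  simp only [sq]
  linarith

theorem NearlyOrthonormal.const_ne_zero (hW : NearlyOrthonormal k c H) : c ≠ 0 := by
  rintro rfl
  have h := (abs_le.1 (hW 0 (by omega) 0 (by omega))).1
  have h0 : hessPoly 0 H 0 = 0 := by simp [hessPoly, hessRec_zero]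
  rw [h0, map_zero, if_pos rfl] at h
  simp at h
  have h1 : ((k : ℝ) + 1)⁻¹ ≤ 1 := inv_le_one_of_one_le₀ (by linarith [Nat.cast_nonneg (α := ℝ) k])
  linarith

theorem NearlyOrthonormal.exists_coordinates (hW : NearlyOrthonormal k c H) :
    ∃ Λ : (Fin (k + 1) ⊕ Fin (k + 1) → ℝ) →ₗ[ℝ] (ℕ → ℝ),
      (∀ v i, v i = ∑ j ∈ Finset.range (2 * k + 2),
        Λ v j * hermiteData (chebNode k) (hessPoly c H j) i) ∧
      (∀ j < 2 * k + 2, ∀ l < 2 * k + 2,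
        Λ (hermiteData (chebNode k) (hessPoly c H j)) l = if j = l then 1 else 0) ∧
      ∀ v, ∀ j < 2 * k + 2, |Λ v j| ≤ 2 * l2 v := by
  -- The tolerance of `NearlyOrthonormal` is chosen so that (2k + 2) η is exactly 1/2.
  refine GrassmannCVA.exists_coordinates (η := 1 / (4 * ((k : ℝ) + 1))) (by simp; ring) ?_ hW
  push_cast
  refine le_of_eq ?_
  field_simp
  ring

/-- This is what makes coefficients of smooth data decay: before taking the j-th coordinate, any
polynomial of degree below j may be subtracted. -/
theorem coordinate_eq_zero_of_degree_lt (hc : c ≠ 0) (hH : ∀ j < 2 * k + 1, H (j + 1) j ≠ 0)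
    {Λ : (Fin (k + 1) ⊕ Fin (k + 1) → ℝ) →ₗ[ℝ] (ℕ → ℝ)}
    (hΛ : ∀ j < 2 * k + 2, ∀ l < 2 * k + 2,
        Λ (hermiteData (chebNode k) (hessPoly c H j)) l = if j = l then 1 else 0)
    {j : ℕ} (hj : j < 2 * k + 2) {g : ℝ[X]} (hg : g.degree < j) :
    Λ (hermiteData (chebNode k) g) j = 0 := by
  refine Submodule.span_induction (p := fun q _ => Λ (hermiteData (chebNode k) q) j = 0)
    ?_ ?_ ?_ ?_ (mem_span_hessPoly hc hH j (by omega) g hg)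
  · rintro _ ⟨i, hi, rfl⟩
    have hi' : i < j := hi
    rw [hΛ i (by omega) j hj, if_neg (by omega)]
  · simp
  · intro p q _ _ hp hq
    rw [map_add, map_add, Pi.add_apply, hp, hq, add_zero]
  · intro a p _ hp
    rw [map_smul, map_smul, Pi.smul_apply, hp, smul_zero]

theorem abs_eval_le_l2_hermiteData {f : ℝ[X]} (hf : f.natDegree ≤ 2 * k + 1) {x : ℝ}
    (hx : x ∈ Set.Icc (0 : ℝ) 1) : |f.eval x| ≤ 3 * l2 (hermiteData (chebNode k) f) :=
  abs_eval_le_of_hermite_data hf (fun i => abs_le_l2 (hermiteData (chebNode k) f) (Sum.inl i))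
    (fun i => abs_le_l2 (hermiteData (chebNode k) f) (Sum.inr i)) hx

theorem NearlyOrthonormal.abs_hessPoly_eval_le (hW : NearlyOrthonormal k c H) {j : ℕ}
    (hj : j < 2 * k + 2) {x : ℝ} (hx : x ∈ Set.Icc (0 : ℝ) 1) : |(hessPoly c H j).eval x| ≤ 6 := by
  have := abs_eval_le_l2_hermiteData (k := k) ((natDegree_hessPoly_le c H j).trans (by omega)) hx
  linarith [hW.l2_le hj]

/-- The value at x is the l-th coordinate of the Hermite data of the difference quotient of π_j.
Since |π_j| ≤ 6, Markov's inequality bounds the quotient by 24 j² and its derivative by 96 j⁴; the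
coordinate costs a factor 2 and the norm of 2k + 2 entries the square root. -/
theorem NearlyOrthonormal.abs_hessAssoc_eval_le (hW : NearlyOrthonormal k c H)
    (hH : ∀ j < 2 * k + 1, H (j + 1) j ≠ 0) {l j : ℕ} (hl : l < 2 * k + 2) (hj : j < 2 * k + 2)
    {x : ℝ} (hx : x ∈ Set.Icc (0 : ℝ) 1) :
    |(hessAssoc H l j).eval x| ≤ 192 * √(2 * k + 2) * ((j : ℝ) + 1) ^ 4 := by
  obtain ⟨Λ, -, hΛ, hb⟩ := hW.exists_coordinates
  set lam : ℝ[X] →ₗ[ℝ] ℝ := LinearMap.proj l ∘ₗ Λ ∘ₗ hermiteData (chebNode k) with hlam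
  have h1 := hessAssoc_eval hH lam (c := c) (l := l)
    (fun j hj => hΛ j (by omega) l hl) x (j := j) (by omega)
  set d := hessPoly c H j /ₘ (X - C x)
  have hdeg : d.natDegree ≤ j := by
    rw [natDegree_divByMonic _ (monic_X_sub_C x)]
    exact (Nat.sub_le _ _).trans (natDegree_hessPoly_le c H j)
  have hπ' : ∀ y ∈ Set.Icc (0 : ℝ) 1, |(hessPoly c H j).derivative.eval y| ≤ 4 * j ^ 2 * 6 :=
    fun y hy => abs_derivative_eval_le (natDegree_hessPoly_le c H j)
      (fun z hz => hW.abs_hessPoly_eval_le hj hz) hy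
  have hd : ∀ y ∈ Set.Icc (0 : ℝ) 1, |d.eval y| ≤ 4 * j ^ 2 * 6 :=
    fun y hy => abs_divByMonic_eval_le hπ' hx hy
  have hd' : ∀ y ∈ Set.Icc (0 : ℝ) 1, |d.derivative.eval y| ≤ 4 * j ^ 2 * (4 * j ^ 2 * 6) :=
    fun y hy => abs_derivative_eval_le hdeg hd hy
  have hj0 : (0 : ℝ) ≤ j := Nat.cast_nonneg j
  have e1 : 4 * (j : ℝ) ^ 2 * 6 ≤ 96 * ((j : ℝ) + 1) ^ 4 := by
    nlinarith [pow_nonneg hj0 2, pow_nonneg hj0 3, pow_nonneg hj0 4]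
  have e2 : 4 * (j : ℝ) ^ 2 * (4 * j ^ 2 * 6) ≤ 96 * ((j : ℝ) + 1) ^ 4 := by
    nlinarith [pow_nonneg hj0 2, pow_nonneg hj0 3, pow_nonneg hj0 4]
  have hl2 : l2 (hermiteData (chebNode k) d) ≤
      √(Fintype.card (Fin (k + 1) ⊕ Fin (k + 1))) * (96 * ((j : ℝ) + 1) ^ 4) := by
    refine l2_le_sqrt_card_mul ?_ (by positivity)
    rintro (i | i)
    · exact (hd _ (chebNode_mem_Icc k i)).trans e1
    · exact (hd' _ (chebNode_mem_Icc k i)).trans e2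
  have hcard : ((Fintype.card (Fin (k + 1) ⊕ Fin (k + 1)) : ℕ) : ℝ) = 2 * k + 2 := by
    simp; ring
  rw [hcard] at hl2
  rw [h1]
  calc |lam d| ≤ 2 * l2 (hermiteData (chebNode k) d) := hb _ l hl
    _ ≤ 2 * (√(2 * k + 2) * (96 * ((j : ℝ) + 1) ^ 4)) := by gcongr
    _ = _ := by ring

theorem NearlyOrthonormal.abs_derivative_hessAssoc_eval_le (hW : NearlyOrthonormal k c H)
    (hH : ∀ j < 2 * k + 1, H (j + 1) j ≠ 0) {l j : ℕ} (hl : l < 2 * k + 2) (hj : j < 2 * k + 2)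
    {x : ℝ} (hx : x ∈ Set.Icc (0 : ℝ) 1) :
    |(hessAssoc H l j).derivative.eval x| ≤ 768 * √(2 * k + 2) * ((j : ℝ) + 1) ^ 6 := by
  have h := abs_derivative_eval_le (natDegree_hessAssoc_le H l j)
    (fun y hy => hW.abs_hessAssoc_eval_le hH hl hj hy) hx
  refine h.trans ?_
  calc 4 * (j : ℝ) ^ 2 * (192 * √(2 * k + 2) * ((j : ℝ) + 1) ^ 4)
      ≤ 4 * ((j : ℝ) + 1) ^ 2 * (192 * √(2 * k + 2) * ((j : ℝ) + 1) ^ 4) := by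
        gcongr
        linarith
    _ = _ := by ring

/-- A perturbed scalar recurrence stays close to the polynomials it generates. -/
theorem NearlyOrthonormal.abs_recurrence_sub_le (hW : NearlyOrthonormal k c H)
    (hH : ∀ j < 2 * k + 1, H (j + 1) j ≠ 0) {x : ℝ} (hx : x ∈ Set.Icc (0 : ℝ) 1) {w g : ℕ → ℝ}
    (h0 : w 0 = c)
    (hw : ∀ j < 2 * k + 1, x * w j = ∑ l ∈ Finset.range (j + 2), H l j * w l + g j)
    {j : ℕ} (hj : j < 2 * k + 2) {δ : ℝ} (hδ0 : 0 ≤ δ) (hδ : ∀ l < j, |g l| ≤ δ) :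
    |w j - (hessPoly c H j).eval x| ≤ 192 * √(2 * k + 2) * ((j : ℝ) + 1) ^ 5 * δ := by
  have h := recurrence_eq_sub (LinearMap.mulLeft ℝ x) hH (z := w) (f := g) (v := 1) (c := c)
    (by simpa using h0) (by simpa using hw) j (by omega)
  have hev : ∀ (p : ℝ[X]) (y : ℝ), aeval (LinearMap.mulLeft ℝ x) p y = p.eval x * y := by
    intro p y
    induction p using Polynomial.induction_on' with
    | add p q hp hq => rw [map_add, LinearMap.add_apply, hp, hq, eval_add, add_mul]
    | monomial n a => simp [aeval_monomial, mul_assoc]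
  simp only [hev, mul_one] at h
  rw [h, sub_sub_cancel_left, abs_neg]
  refine (Finset.abs_sum_le_sum_abs _ _).trans ?_
  calc _ ≤ ∑ _l ∈ Finset.range j, 192 * √(2 * k + 2) * ((j : ℝ) + 1) ^ 4 * δ := by
        refine Finset.sum_le_sum fun l hl => ?_
        have hl' := Finset.mem_range.1 hl
        rw [abs_mul]
        exact mul_le_mul (hW.abs_hessAssoc_eval_le hH (by omega) hj hx) (hδ l hl') (abs_nonneg _)
          (by positivity)
    _ = 192 * √(2 * k + 2) * ((j : ℝ) + 1) ^ 4 * (j * δ) := by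
        rw [Finset.sum_const, Finset.card_range, nsmul_eq_mul]; ring
    _ ≤ 192 * √(2 * k + 2) * ((j : ℝ) + 1) ^ 4 * (((j : ℝ) + 1) * δ) := by
        gcongr
        linarith
    _ = _ := by ring

/-- A perturbed Arnoldi recurrence stays close to the Hermite data of the polynomials it
generates. -/
theorem NearlyOrthonormal.l2_hermiteData_sub_le (hW : NearlyOrthonormal k c H)
    (hH : ∀ j < 2 * k + 1, H (j + 1) j ≠ 0) {Q f : ℕ → Fin (k + 1) ⊕ Fin (k + 1) → ℝ}
    (h0 : Q 0 = Sum.elim (fun _ => c) (fun _ => 0))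
    (hQ : ∀ j < 2 * k + 1, confluentMap (chebNode k) (Q j) =
      ∑ l ∈ Finset.range (j + 2), H l j • Q l + f j)
    {j : ℕ} (hj : j < 2 * k + 2) {δ : ℝ} (hδ0 : 0 ≤ δ) (hδ : ∀ l < j, l2 (f l) ≤ δ) :
    l2 (fun i => hermiteData (chebNode k) (hessPoly c H j) i - Q j i) ≤
      960 * √(2 * k + 2) * ((j : ℝ) + 1) ^ 7 * δ := by
  have h := recurrence_eq_sub (confluentMap (chebNode k)) hH (z := Q) (f := f)
    (v := Sum.elim (fun _ => 1) (fun _ => 0)) (c := c)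
    (by rw [h0]; ext (i | i) <;> simp) hQ j (by omega)
  rw [aeval_confluentMap_one] at h
  have e : (fun i => hermiteData (chebNode k) (hessPoly c H j) i - Q j i) =
      fun i => ∑ l ∈ Finset.range j, aeval (confluentMap (chebNode k)) (hessAssoc H l j) (f l) i := by
    ext i
    rw [h]
    simp
  rw [e]
  refine (l2_sum_le _ _).trans ?_
  calc _ ≤ ∑ _l ∈ Finset.range j, 960 * √(2 * k + 2) * ((j : ℝ) + 1) ^ 6 * δ := by
        refine Finset.sum_le_sum fun l hl => ?_
        have hl' := Finset.mem_range.1 hl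
        refine (l2_aeval_confluentMap_le (B := 192 * √(2 * k + 2) * ((j : ℝ) + 1) ^ 4)
          (B' := 768 * √(2 * k + 2) * ((j : ℝ) + 1) ^ 6) (by positivity) (by positivity)
          (fun i => hW.abs_hessAssoc_eval_le hH (by omega) hj (chebNode_mem_Icc k i))
          (fun i => hW.abs_derivative_hessAssoc_eval_le hH (by omega) hj
            (chebNode_mem_Icc k i)) (f l)).trans ?_
        refine mul_le_mul ?_ (hδ l hl') (l2_nonneg _) (by positivity)
        have : ((j : ℝ) + 1) ^ 4 ≤ ((j : ℝ) + 1) ^ 6 :=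
          pow_le_pow_right₀ (by linarith [Nat.cast_nonneg (α := ℝ) j]) (by norm_num)
        have := mul_le_mul_of_nonneg_left this (Real.sqrt_nonneg (2 * (k : ℝ) + 2))
        nlinarith
    _ = 960 * √(2 * k + 2) * ((j : ℝ) + 1) ^ 6 * (j * δ) := by
        rw [Finset.sum_const, Finset.card_range, nsmul_eq_mul]; ring
    _ ≤ 960 * √(2 * k + 2) * ((j : ℝ) + 1) ^ 6 * (((j : ℝ) + 1) * δ) := by
        gcongr
        linarith
    _ = _ := by ring

end Bounds

end GrassmannCVA

namespace GrassmannCVA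

open Polynomial

/-! ### The Arnoldi process in exact arithmetic -/

section ExactArnoldi

variable {m : ℕ}

theorem sum_mul_sub_sum {ι : Type*} [Fintype ι] (a b : ι → ℝ) (s : Finset ℕ) (x : ℕ → ℝ)
    (q : ℕ → ι → ℝ) : ∑ i, a i * (b i - ∑ l ∈ s, x l * q l i) =
      ∑ i, a i * b i - ∑ l ∈ s, x l * ∑ i, a i * q l i := by
  simp only [mul_sub, Finset.sum_sub_distrib, Finset.mul_sum]
  congr 1
  rw [Finset.sum_comm]
  exact Finset.sum_congr rfl fun l _ => Finset.sum_congr rfl fun i _ => by ring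

/-- The part of `C q_j` that is orthogonal to `q_0, …, q_j`, when these are orthonormal. -/
noncomputable def arnoldiResidual (t : Fin m → ℝ) (q : ℕ → Fin m ⊕ Fin m → ℝ) (j : ℕ) :
    Fin m ⊕ Fin m → ℝ := fun i =>
  confluentMap t (q j) i -
    ∑ l ∈ Finset.range (j + 1), (∑ i', q l i' * confluentMap t (q j) i') * q l i

/-- The basis vectors of the Arnoldi process in exact arithmetic. -/
noncomputable def arnoldiVec (t : Fin m → ℝ) : ℕ → Fin m ⊕ Fin m → ℝ
  | 0 => Sum.elim (fun _ => 1 / √m) fun _ => 0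
  | j + 1 => fun i =>
      arnoldiResidual t (fun l => if _h : l < j + 1 then arnoldiVec t l else 0) j i /
        l2 (arnoldiResidual t (fun l => if _h : l < j + 1 then arnoldiVec t l else 0) j)

theorem arnoldiVec_zero (t : Fin m → ℝ) :
    arnoldiVec t 0 = Sum.elim (fun _ => 1 / √m) fun _ => 0 := by
  rw [arnoldiVec]

/-- The cutoff in the definition only serves well-founded recursion: the residual at step j reads no
vector beyond index j. -/
theorem arnoldiVec_succ (t : Fin m → ℝ) (j : ℕ) (i : Fin m ⊕ Fin m) :
    arnoldiVec t (j + 1) i =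
      arnoldiResidual t (arnoldiVec t) j i / l2 (arnoldiResidual t (arnoldiVec t) j) := by
  have e : arnoldiResidual t (fun l => if _h : l < j + 1 then arnoldiVec t l else 0) j =
      arnoldiResidual t (arnoldiVec t) j := by
    ext i
    simp only [arnoldiResidual, Nat.lt_succ_self, dite_true]
    congr 1
    refine Finset.sum_congr rfl fun l hl => ?_
    simp only [Finset.mem_range.1 hl, dite_true]
  rw [arnoldiVec, e]

/-- The Hessenberg matrix of the Arnoldi process in exact arithmetic. -/
noncomputable def arnoldiHess (t : Fin m → ℝ) (l j : ℕ) : ℝ :=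
  if l = j + 1 then l2 (arnoldiResidual t (arnoldiVec t) j)
  else ∑ i, arnoldiVec t l i * confluentMap t (arnoldiVec t j) i

theorem confluentMap_arnoldiVec (t : Fin m → ℝ) {j : ℕ}
    (hj : l2 (arnoldiResidual t (arnoldiVec t) j) ≠ 0) :
    confluentMap t (arnoldiVec t j) =
      ∑ l ∈ Finset.range (j + 2), arnoldiHess t l j • arnoldiVec t l := by
  ext i
  rw [Finset.sum_range_succ, Pi.add_apply, Finset.sum_apply, Pi.smul_apply, smul_eq_mul,
    arnoldiVec_succ, arnoldiHess, if_pos rfl, mul_div_cancel₀ _ hj, arnoldiResidual]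
  rw [Finset.sum_congr rfl (g := fun l => (∑ i', arnoldiVec t l i' *
    confluentMap t (arnoldiVec t j) i') * arnoldiVec t l i)]
  · ring
  · intro l hl
    have := Finset.mem_range.1 hl
    rw [Pi.smul_apply, smul_eq_mul, arnoldiHess, if_neg (by omega)]

theorem coeff_hessPoly_ne_zero {c : ℝ} {H : ℕ → ℕ → ℝ} (hc : c ≠ 0) {n : ℕ}
    (hH : ∀ j < n, H (j + 1) j ≠ 0) : ∀ j ≤ n, (hessPoly c H j).coeff j ≠ 0 := by
  intro j
  induction j with
  | zero => intro _; simpa [hessPoly, hessRec_zero] using hc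
  | succ j ih =>
    intro hj
    rw [hessPoly, hessRec, ← hessPoly, coeff_C_mul, coeff_sub, coeff_sub, coeff_X_mul,
      finsetSum_coeff, Finset.sum_eq_zero]
    · simpa using ⟨hH j hj, ih (Nat.le_of_succ_le hj)⟩
    · intro l _
      rw [coeff_C_mul, coeff_eq_zero_of_natDegree_lt, mul_zero]
      exact (natDegree_hessPoly_le c H l).trans_lt l.2

theorem hermiteData_X_mul (t : Fin m → ℝ) (p : ℝ[X]) :
    hermiteData t (X * p) = confluentMap t (hermiteData t p) := by
  ext (i | i) <;> simp [hermiteData, confluentMap, derivative_mul]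

theorem hermiteData_C_mul (t : Fin m → ℝ) (a : ℝ) (p : ℝ[X]) :
    hermiteData t (C a * p) = a • hermiteData t p := by
  rw [← smul_eq_C_mul, map_smul]

theorem hermiteData_hessPoly_arnoldi (t : Fin m → ℝ) {n : ℕ}
    (hn : ∀ j < n, l2 (arnoldiResidual t (arnoldiVec t) j) ≠ 0) {j : ℕ} (hj : j ≤ n) :
    arnoldiVec t j = hermiteData t (hessPoly (1 / √m) (arnoldiHess t) j) := by
  have h := recurrence_eq_sub (confluentMap t) (H := arnoldiHess t) (c := 1 / √m) (N := n)
    (fun j hj => by rw [arnoldiHess, if_pos rfl]; exact hn j hj) (z := arnoldiVec t) (f := 0)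
    (v := Sum.elim (fun _ => 1) fun _ => 0)
    (by rw [arnoldiVec_zero]; ext (i | i) <;> simp)
    (fun j hj => by rw [Pi.zero_apply, add_zero]; exact confluentMap_arnoldiVec t (hn j hj)) j hj
  rw [h, aeval_confluentMap_one]
  simp

/-- The point is that there is no breakdown. A vanishing residual at step n would be the Hermite
data of a polynomial of degree exactly n + 1 ≤ 2k + 1 with double zeros at k + 1 nodes, which is
impossible. -/
theorem arnoldi_orthonormal (k : ℕ) : ∀ n ≤ 2 * k + 1,
    (∀ a ≤ n, ∀ b ≤ n, ∑ i, arnoldiVec (chebNode k) a i * arnoldiVec (chebNode k) b i =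
      if a = b then 1 else 0) ∧
    ∀ j < n, 0 < l2 (arnoldiResidual (chebNode k) (arnoldiVec (chebNode k)) j) := by
  intro n
  set q := arnoldiVec (chebNode k) with hq
  induction n with
  | zero =>
    intro _
    refine ⟨fun a ha b hb => ?_, by simp⟩
    obtain rfl : a = 0 := by omega
    obtain rfl : b = 0 := by omega
    rw [hq, arnoldiVec_zero, Fintype.sum_sum_type]
    have : (k : ℝ) + 1 ≠ 0 := by positivity
    simp only [Sum.elim_inl, Sum.elim_inr, mul_zero, Finset.sum_const_zero, add_zero,
      Finset.sum_const, Finset.card_univ, Fintype.card_fin, nsmul_eq_mul, if_true,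
      div_mul_div_comm, mul_one]
    rw [Real.mul_self_sqrt (by positivity)]
    push_cast
    field_simp
  | succ n ih =>
    intro hn
    obtain ⟨ho, hr⟩ := ih (by omega)
    have hcm : (1 / √((k + 1 : ℕ) : ℝ)) ≠ 0 := by positivity
    have hpoly : ∀ j ≤ n, q j =
        hermiteData (chebNode k) (hessPoly (1 / √((k + 1 : ℕ) : ℝ)) (arnoldiHess (chebNode k)) j) :=
      fun j hj => hermiteData_hessPoly_arnoldi _ (fun i hi => (hr i hi).ne') hj
    have hres : 0 < l2 (arnoldiResidual (chebNode k) q n) := by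
      refine lt_of_le_of_ne (l2_nonneg _) fun h0 => ?_
      set π := hessPoly (1 / √((k + 1 : ℕ) : ℝ)) (arnoldiHess (chebNode k)) with hπ
      set P : ℝ[X] := X * π n - ∑ l ∈ Finset.range (n + 1),
        C (∑ i', q l i' * confluentMap (chebNode k) (q n) i') * π l with hP
      have hdeg : ∀ l ≤ n, (π l).natDegree ≤ l := fun l _ => natDegree_hessPoly_le _ _ l
      have hPd : hermiteData (chebNode k) P = arnoldiResidual (chebNode k) q n := by
        rw [hP, map_sub, map_sum, hermiteData_X_mul, ← hpoly n le_rfl]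
        ext i
        rw [arnoldiResidual, Pi.sub_apply, Finset.sum_apply]
        congr 1
        refine Finset.sum_congr rfl fun l hl => ?_
        rw [hermiteData_C_mul, ← hpoly l (by have := Finset.mem_range.1 hl; omega)]
        rfl
      have hz : ∀ i, hermiteData (chebNode k) P i = 0 := by
        intro i
        have := abs_le_l2 (arnoldiResidual (chebNode k) q n) i
        rw [← h0] at this
        rw [hPd]
        exact abs_nonpos_iff.1 this
      have hP0 : P = 0 := by
        refine eq_zero_of_double_roots (chebNode_injective k) ?_ (fun i => hz (Sum.inl i))
          (fun i => hz (Sum.inr i))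
        refine (degree_le_of_natDegree_le (n := n + 1) ?_).trans_lt (by norm_cast; omega)
        refine (natDegree_sub_le _ _).trans (max_le ?_ ?_)
        · have := hdeg n le_rfl
          have := natDegree_X_le (R := ℝ)
          exact natDegree_mul_le.trans (by omega)
        · refine natDegree_sum_le_of_forall_le _ _ fun l hl => (natDegree_C_mul_le _ _).trans ?_
          have := Finset.mem_range.1 hl
          exact (hdeg l (by omega)).trans (by omega)
      have hcoef : P.coeff (n + 1) = (π n).coeff n := by
        rw [hP, coeff_sub, coeff_X_mul, finsetSum_coeff, Finset.sum_eq_zero, sub_zero]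
        intro l hl
        have := Finset.mem_range.1 hl
        rw [coeff_C_mul, coeff_eq_zero_of_natDegree_lt ((hdeg l (by omega)).trans_lt this),
          mul_zero]
      rw [hP0, coeff_zero] at hcoef
      exact coeff_hessPoly_ne_zero hcm (n := n) (fun j hj => by
        rw [arnoldiHess, if_pos rfl]; exact (hr j hj).ne') n le_rfl hcoef.symm
    have horth : ∀ a ≤ n, ∑ i, q a i * arnoldiResidual (chebNode k) q n i = 0 := by
      intro a ha
      simp only [arnoldiResidual]
      rw [sum_mul_sub_sum, Finset.sum_congr rfl (g := fun l =>
        if a = l then ∑ i', q l i' * confluentMap (chebNode k) (q n) i' else 0),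
        Finset.sum_ite_eq, if_pos (Finset.mem_range.2 (by omega)), sub_self]
      intro l hl
      rw [ho a ha l (by have := Finset.mem_range.1 hl; omega)]
      split_ifs <;> simp
    have hnew : ∀ a ≤ n, ∑ i, q a i * q (n + 1) i = 0 := by
      intro a ha
      rw [hq]
      simp only [arnoldiVec_succ, ← mul_div_assoc, ← Finset.sum_div]
      rw [← hq, horth a ha, zero_div]
    have hself : ∑ i, q (n + 1) i * q (n + 1) i = 1 := by
      rw [hq]
      simp only [arnoldiVec_succ, div_mul_div_comm, ← Finset.sum_div]
      rw [← hq, ← sq, l2_sq]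
      simp only [sq]
      refine div_self ?_
      simp only [← sq, ← l2_sq]
      exact (pow_pos hres 2).ne'
    refine ⟨fun a ha b hb => ?_, fun j hj => ?_⟩
    · rcases Nat.lt_or_ge n a with ha' | ha' <;> rcases Nat.lt_or_ge n b with hb' | hb'
      · obtain rfl : a = n + 1 := by omega
        obtain rfl : b = n + 1 := by omega
        rw [if_pos rfl, hself]
      · obtain rfl : a = n + 1 := by omega
        rw [if_neg (by omega), ← hnew b hb']
        exact Finset.sum_congr rfl fun i _ => mul_comm _ _
      · obtain rfl : b = n + 1 := by omega
        rw [if_neg (by omega), hnew a ha']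
      · exact ho a ha' b hb'
    · rcases Nat.lt_or_ge j n with hj' | hj'
      · exact hr j hj'
      · obtain rfl : j = n := by omega
        exact hres

end ExactArnoldi

end GrassmannCVA

namespace GrassmannCVA

open Polynomial Filter Topology

/-! ### Floating-point runs of the Arnoldi process -/

/-- A floating-point run of the Arnoldi process at the Chebyshev nodes and of the evaluation at the
point `s`, with all its intermediate results. -/
structure FlRun (k : ℕ) where
  /-- The unit roundoff. -/
  ε : ℝ
  /-- The computed value of `1 / √(k + 1)`. -/
  c : ℝ
  /-- The evaluation point. -/
  s : ℝ
  /-- The computed basis vectors. -/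
  Q : ℕ → Fin (k + 1) ⊕ Fin (k + 1) → ℝ
  /-- The computed Hessenberg matrix. -/
  H : ℕ → ℕ → ℝ
  /-- The computed basis functions at `s`. -/
  w : ℕ → ℝ
  /-- The computed products `C q_j`. -/
  V : ℕ → Fin (k + 1) ⊕ Fin (k + 1) → ℝ
  /-- The vectors after the first Gram-Schmidt pass. -/
  V' : ℕ → Fin (k + 1) ⊕ Fin (k + 1) → ℝ
  /-- The vectors after the second Gram-Schmidt pass. -/
  V'' : ℕ → Fin (k + 1) ⊕ Fin (k + 1) → ℝ
  /-- The coefficients of the first pass. -/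
  x : ℕ → ℕ → ℝ
  /-- The coefficients of the second pass. -/
  y : ℕ → ℕ → ℝ
  /-- The computed squared norms. -/
  r : ℕ → ℝ
  eps_nonneg : 0 ≤ ε
  mem_Icc : s ∈ Set.Icc (0 : ℝ) 1
  flStart : FlStart ε (k + 1) c
  start : Q 0 = Sum.elim (fun _ => c) (fun _ => 0)
  mul : ∀ j < 2 * k + 1, FlConfluentMul ε (chebNode k) (Q j) (V j)
  pass₁ : ∀ j < 2 * k + 1, FlGramSchmidtPass ε Q j (V j) (x j) (V' j)
  pass₂ : ∀ j < 2 * k + 1, FlGramSchmidtPass ε Q j (V' j) (y j) (V'' j)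
  hess : ∀ j < 2 * k + 1, ∀ l ≤ j, FlRound ε (x j l + y j l) (H l j)
  dot : ∀ j < 2 * k + 1, FlDot ε (augIndex (k + 1)) (V'' j) (V'' j) (r j)
  sqrt : ∀ j < 2 * k + 1, FlRound ε (√(r j)) (H (j + 1) j)
  div : ∀ j < 2 * k + 1, ∀ i, FlRound ε (V'' j i / H (j + 1) j) (Q (j + 1) i)
  eval : FlEval ε (2 * k + 1) c H s w

/-- Bundling makes the runs with arbitrary roundoff and evaluation point into one type, on which
filters express the limit ε → 0. -/
theorem exists_flRun {k : ℕ} {ε c s : ℝ} {Q : ℕ → Fin (k + 1) ⊕ Fin (k + 1) → ℝ}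
    {H : ℕ → ℕ → ℝ} {w : ℕ → ℝ} (hε : 0 ≤ ε) (hs : s ∈ Set.Icc (0 : ℝ) 1)
    (hc : FlStart ε (k + 1) c) (hA : FlArnoldi ε (chebNode k) (2 * k + 1) c Q H)
    (hw : FlEval ε (2 * k + 1) c H s w) :
    ∃ R : FlRun k, R.ε = ε ∧ R.c = c ∧ R.s = s ∧ R.Q = Q ∧ R.H = H ∧ R.w = w := by
  have h := hA.step
  choose! V V' V'' x y r h1 h2 h3 h4 h5 h6 h7 using h
  exact ⟨⟨ε, c, s, Q, H, w, V, V', V'', x, y, r, hε, hs, hc, hA.start, h1, h2, h3, h4, h5, h6, h7,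
    hw⟩, rfl, rfl, rfl, rfl, rfl, rfl⟩

namespace FlRun

variable {k : ℕ} {F : Filter (FlRun k)}

theorem tendsto_pass {j : ℕ} (hF : Tendsto FlRun.ε F (𝓝 0))
    {q : ℕ → Fin (k + 1) ⊕ Fin (k + 1) → ℝ} {v₀ : Fin (k + 1) ⊕ Fin (k + 1) → ℝ}
    {v v' : FlRun k → Fin (k + 1) ⊕ Fin (k + 1) → ℝ} {x : FlRun k → ℕ → ℝ}
    (hQ : ∀ l ≤ j, ∀ i, Tendsto (fun R : FlRun k => R.Q l i) F (𝓝 (q l i)))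
    (hv : ∀ i, Tendsto (fun R => v R i) F (𝓝 (v₀ i)))
    (h : ∀ R : FlRun k, FlGramSchmidtPass R.ε R.Q j (v R) (x R) (v' R)) :
    (∀ l ≤ j, Tendsto (fun R => x R l) F (𝓝 (∑ i, q l i * v₀ i))) ∧
    ∀ i, Tendsto (fun R => v' R i) F
      (𝓝 (v₀ i - ∑ l ∈ Finset.range (j + 1), (∑ i', q l i' * v₀ i') * q l i)) := by
  have hx : ∀ l ≤ j, Tendsto (fun R => x R l) F (𝓝 (∑ i, q l i * v₀ i)) := fun l hl =>
    tendsto_of_flDot_aug hF (fun R => R.eps_nonneg) (hQ l hl) hv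
      (Eventually.of_forall fun R => (h R).1 l hl)
  refine ⟨hx, fun i => ?_⟩
  choose d hd hr using fun R => (h R).2 i
  have hd' := tendsto_of_flDot_range (a₀ := fun l => ∑ i', q l i' * v₀ i')
    (b₀ := fun l => q l i) (a := x) (b := fun (R : FlRun k) l => R.Q l i) hF
    (fun R => R.eps_nonneg) (fun l hl => hx l (by omega)) (fun l hl => hQ l (by omega) i)
    (Eventually.of_forall hd)
  exact tendsto_of_flRound hF ((hv i).sub hd') (Eventually.of_forall hr)

theorem tendsto_c (hF : Tendsto FlRun.ε F (𝓝 0)) :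
    Tendsto (fun R : FlRun k => R.c) F (𝓝 (1 / √((k + 1 : ℕ) : ℝ))) := by
  choose β h1 h2 using fun R : FlRun k => R.flStart
  have hβ : Tendsto β F (𝓝 (√((k + 1 : ℕ) : ℝ))) :=
    tendsto_of_flRound hF tendsto_const_nhds (Eventually.of_forall h1)
  have h0 : √((k + 1 : ℕ) : ℝ) ≠ 0 := by positivity
  exact tendsto_of_flRound hF (tendsto_const_nhds.div hβ h0) (Eventually.of_forall h2)

/-- The quantities computed in one step of the Arnoldi process converge to the exact ones. -/
structure StepTendsto (F : Filter (FlRun k)) (j : ℕ) : Prop where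
  V' : ∀ i, Tendsto (fun R : FlRun k => R.V' j i) F
    (𝓝 (arnoldiResidual (chebNode k) (arnoldiVec (chebNode k)) j i))
  V'' : ∀ i, Tendsto (fun R : FlRun k => R.V'' j i) F
    (𝓝 (arnoldiResidual (chebNode k) (arnoldiVec (chebNode k)) j i))
  x : ∀ l ≤ j, Tendsto (fun R : FlRun k => R.x j l) F (𝓝 (arnoldiHess (chebNode k) l j))
  y : ∀ l ≤ j, Tendsto (fun R : FlRun k => R.y j l) F (𝓝 0)
  H : ∀ l ≤ j + 1, Tendsto (fun R : FlRun k => R.H l j) F (𝓝 (arnoldiHess (chebNode k) l j))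
  Q : ∀ i, Tendsto (fun R : FlRun k => R.Q (j + 1) i) F (𝓝 (arnoldiVec (chebNode k) (j + 1) i))

theorem sum_mul_arnoldiResidual_eq_zero {j l : ℕ} (hj : j < 2 * k + 1) (hl : l ≤ j) :
    ∑ i, arnoldiVec (chebNode k) l i *
      arnoldiResidual (chebNode k) (arnoldiVec (chebNode k)) j i = 0 := by
  obtain ⟨ho, hr⟩ := arnoldi_orthonormal k (j + 1) hj
  have h := ho l (by omega) (j + 1) le_rfl
  rw [if_neg (by omega)] at h
  simp only [arnoldiVec_succ, ← mul_div_assoc, ← Finset.sum_div] at h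
  exact (div_eq_zero_iff.1 h).resolve_right (hr j (Nat.lt_succ_self j)).ne'

/-- All operations of the step are continuous at the exact values, the division because the exact
residual is nonzero. The second pass changes nothing in the limit, the exact residual being already
orthogonal, so its coefficients tend to 0. -/
theorem stepTendsto_of_tendsto (hF : Tendsto FlRun.ε F (𝓝 0)) {j : ℕ} (hj : j < 2 * k + 1)
    (hQ : ∀ l ≤ j, ∀ i, Tendsto (fun R : FlRun k => R.Q l i) F
      (𝓝 (arnoldiVec (chebNode k) l i))) : StepTendsto F j := by
  set t := chebNode k
  set q := arnoldiVec t
  have hpos : 0 < l2 (arnoldiResidual t q j) :=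
    (arnoldi_orthonormal k (j + 1) hj).2 j (Nat.lt_succ_self j)
  have hV : ∀ i, Tendsto (fun R : FlRun k => R.V j i) F (𝓝 (confluentMap t (q j) i)) := by
    rintro (i | i)
    · exact tendsto_of_flRound hF ((hQ j le_rfl (Sum.inl i)).const_mul (t i))
        (Eventually.of_forall fun R => (R.mul j hj).1 i)
    · choose z hz hz' using fun R : FlRun k => (R.mul j hj).2 i
      have h1 := tendsto_of_flRound hF ((hQ j le_rfl (Sum.inr i)).const_mul (t i))
        (Eventually.of_forall hz)
      exact tendsto_of_flRound hF ((hQ j le_rfl (Sum.inl i)).add h1) (Eventually.of_forall hz')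
  obtain ⟨hx, hV'⟩ := tendsto_pass hF hQ hV fun R => R.pass₁ j hj
  obtain ⟨hy, hV''⟩ := tendsto_pass (v₀ := arnoldiResidual t q j) hF hQ hV' fun R => R.pass₂ j hj
  have hz : ∀ l ≤ j, ∑ i, q l i * arnoldiResidual t q j i = 0 :=
    fun l hl => sum_mul_arnoldiResidual_eq_zero hj hl
  have hV''' : ∀ i, Tendsto (fun R : FlRun k => R.V'' j i) F (𝓝 (arnoldiResidual t q j i)) := by
    intro i
    have h1 := hV'' i
    rw [Finset.sum_eq_zero, sub_zero] at h1
    · exact h1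
    · intro l hl
      rw [hz l (by have := Finset.mem_range.1 hl; omega), zero_mul]
  have hr : Tendsto (fun R : FlRun k => R.r j) F (𝓝 (l2 (arnoldiResidual t q j) ^ 2)) := by
    rw [l2_sq]
    simp only [sq]
    exact tendsto_of_flDot_aug hF (fun R => R.eps_nonneg) hV''' hV'''
      (Eventually.of_forall fun R => R.dot j hj)
  have hHs : Tendsto (fun R : FlRun k => R.H (j + 1) j) F (𝓝 (l2 (arnoldiResidual t q j))) := by
    have h1 := hr.sqrt
    rw [Real.sqrt_sq (l2_nonneg _)] at h1
    exact tendsto_of_flRound hF h1 (Eventually.of_forall fun R => R.sqrt j hj)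
  have hx' : ∀ l ≤ j, Tendsto (fun R : FlRun k => R.x j l) F (𝓝 (arnoldiHess t l j)) := by
    intro l hl
    rw [arnoldiHess, if_neg (by omega)]
    exact hx l hl
  have hy' : ∀ l ≤ j, Tendsto (fun R : FlRun k => R.y j l) F (𝓝 0) := by
    intro l hl
    have h1 := hy l hl
    rwa [hz l hl] at h1
  refine ⟨hV', hV''', hx', hy', fun l hl => ?_, fun i => ?_⟩
  · rcases Nat.lt_or_ge j l with h1 | h1
    · obtain rfl : l = j + 1 := by omega
      rw [arnoldiHess, if_pos rfl]
      exact hHs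
    · have h2 := (hx' l h1).add (hy' l h1)
      rw [add_zero] at h2
      exact tendsto_of_flRound hF h2 (Eventually.of_forall fun R => R.hess j hj l h1)
  · rw [arnoldiVec_succ]
    exact tendsto_of_flRound hF ((hV''' i).div hHs hpos.ne')
      (Eventually.of_forall fun R => R.div j hj i)

theorem tendsto_Q (hF : Tendsto FlRun.ε F (𝓝 0)) : ∀ j ≤ 2 * k + 1, ∀ i,
    Tendsto (fun R : FlRun k => R.Q j i) F (𝓝 (arnoldiVec (chebNode k) j i)) := by
  intro j
  induction j using Nat.strong_induction_on with
  | _ j ih =>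
    intro hj
    obtain _ | j := j
    · rw [arnoldiVec_zero]
      rintro (i | i)
      · simp only [start, Sum.elim_inl]
        exact tendsto_c hF
      · simp only [start, Sum.elim_inr]
        exact tendsto_const_nhds
    · exact (stepTendsto_of_tendsto hF hj fun l hl => ih l (by omega) (by omega)).Q

theorem stepTendsto (hF : Tendsto FlRun.ε F (𝓝 0)) {j : ℕ} (hj : j < 2 * k + 1) :
    StepTendsto F j :=
  stepTendsto_of_tendsto hF hj fun l hl => tendsto_Q hF l (by omega)

theorem arnoldiHess_succ_pos {j : ℕ} (hj : j < 2 * k + 1) :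
    0 < arnoldiHess (chebNode k) (j + 1) j := by
  rw [arnoldiHess, if_pos rfl]
  exact (arnoldi_orthonormal k (j + 1) hj).2 j (Nat.lt_succ_self j)

theorem tendsto_hermiteData (hF : Tendsto FlRun.ε F (𝓝 0)) : ∀ j ≤ 2 * k + 1, ∀ i,
    Tendsto (fun R : FlRun k => hermiteData (chebNode k) (hessPoly R.c R.H j) i) F
      (𝓝 (arnoldiVec (chebNode k) j i)) := by
  intro j hj i
  rw [hermiteData_hessPoly_arnoldi (chebNode k)
    (fun j hj => ((arnoldi_orthonormal k (2 * k + 1) le_rfl).2 j hj).ne') hj]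
  induction j using Nat.strong_induction_on generalizing i with
  | _ j ih =>
    obtain _ | j := j
    · simp only [hessPoly, hessRec_zero]
      rcases i with i | i
      · simpa [hermiteData] using tendsto_c (k := k) hF
      · simp [hermiteData, tendsto_const_nhds]
    · have e : ∀ (c : ℝ) (H : ℕ → ℕ → ℝ), hermiteData (chebNode k) (hessPoly c H (j + 1)) i =
          (H (j + 1) j)⁻¹ * (confluentMap (chebNode k) (hermiteData (chebNode k) (hessPoly c H j)) i
            - ∑ l : Fin (j + 1), H l j * hermiteData (chebNode k) (hessPoly c H l) i) := by
        intro c H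
        rw [hessPoly, hessRec, ← hessPoly, hermiteData_C_mul, map_sub, map_sub, map_sum,
          hermiteData_X_mul]
        simp [hermiteData_C_mul]
      simp only [e]
      have hst := stepTendsto hF hj
      have hC : Tendsto (fun R : FlRun k => confluentMap (chebNode k)
          (hermiteData (chebNode k) (hessPoly R.c R.H j)) i) F (𝓝 (confluentMap (chebNode k)
          (hermiteData (chebNode k) (hessPoly (1 / √((k + 1 : ℕ) : ℝ))
            (arnoldiHess (chebNode k)) j)) i)) := by
        have h1 := fun i => ih j (Nat.lt_succ_self j) (by omega) i
        rcases i with i | i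
        · exact (h1 (Sum.inl i)).const_mul _
        · exact (h1 (Sum.inl i)).add ((h1 (Sum.inr i)).const_mul _)
      refine ((hst.H (j + 1) le_rfl).inv₀ (arnoldiHess_succ_pos hj).ne').mul (hC.sub ?_)
      exact tendsto_finsetSum _ fun l _ =>
        (hst.H l l.2.le).mul (ih l l.2 (by omega) i)

theorem tendsto_w (hF : Tendsto FlRun.ε F (𝓝 0)) {s₀ : ℝ}
    (hs : Tendsto (fun R : FlRun k => R.s) F (𝓝 s₀)) : ∀ j ≤ 2 * k + 1,
    Tendsto (fun R : FlRun k => R.w j) F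
      (𝓝 ((hessPoly (1 / √((k + 1 : ℕ) : ℝ)) (arnoldiHess (chebNode k)) j).eval s₀)) := by
  intro j
  set π := hessPoly (1 / √((k + 1 : ℕ) : ℝ)) (arnoldiHess (chebNode k)) with hπ
  induction j using Nat.strong_induction_on with
  | _ j ih =>
    intro hj
    obtain _ | j := j
    · simp only [hπ, hessPoly, hessRec_zero, eval_C]
      exact (tendsto_c hF).congr fun R => R.eval.start.symm
    · have e : (π (j + 1)).eval s₀ = (s₀ * (π j).eval s₀ - ∑ l ∈ Finset.range (j + 1),
          arnoldiHess (chebNode k) l j * (π l).eval s₀) / arnoldiHess (chebNode k) (j + 1) j := by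
        rw [hπ, hessPoly, hessRec, ← hessPoly, eval_mul, eval_sub, eval_sub, eval_finsetSum,
          ← Fin.sum_univ_eq_sum_range (fun l => arnoldiHess (chebNode k) l j *
            (hessPoly (1 / √((k + 1 : ℕ) : ℝ)) (arnoldiHess (chebNode k)) l).eval s₀)]
        simp [div_eq_inv_mul]
      rw [e]
      have hst := stepTendsto hF hj
      choose a d z ha hd hz hw using fun R : FlRun k => R.eval.step j hj
      have ha' := tendsto_of_flRound hF (hs.mul (ih j (Nat.lt_succ_self j) (by omega)))
        (Eventually.of_forall ha)
      have hd' := tendsto_of_flDot_range (n := j + 1) hF (fun R => R.eps_nonneg)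
        (fun l hl => hst.H l (by omega)) (fun l hl => ih l hl (by omega))
        (Eventually.of_forall hd)
      have hz' := tendsto_of_flRound hF (ha'.sub hd') (Eventually.of_forall hz)
      exact tendsto_of_flRound hF
        (hz'.div (hst.H (j + 1) le_rfl) (arnoldiHess_succ_pos hj).ne') (Eventually.of_forall hw)

/-- A reproducing-kernel argument: f = ∑ π_j(s) π_j has value σ at s and Hermite data of norm √σ, so
σ ≤ 3√σ. This makes the sum of the |w_j| of order √k rather than k. -/
theorem sum_hessPoly_eval_sq_le {s : ℝ} (hs : s ∈ Set.Icc (0 : ℝ) 1) :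
    ∑ j ∈ Finset.range (2 * k + 2),
      (hessPoly (1 / √((k + 1 : ℕ) : ℝ)) (arnoldiHess (chebNode k)) j).eval s ^ 2 ≤ 9 := by
  set π := hessPoly (1 / √((k + 1 : ℕ) : ℝ)) (arnoldiHess (chebNode k)) with hπ
  set σ := ∑ j ∈ Finset.range (2 * k + 2), (π j).eval s ^ 2 with hσ
  have hσ0 : 0 ≤ σ := Finset.sum_nonneg fun _ _ => sq_nonneg _
  set f : ℝ[X] := ∑ j ∈ Finset.range (2 * k + 2), C ((π j).eval s) * π j with hf
  obtain ⟨ho, hr⟩ := arnoldi_orthonormal k (2 * k + 1) le_rfl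
  have hdata : ∀ i, hermiteData (chebNode k) f i = ∑ j ∈ Finset.range (2 * k + 2),
      (π j).eval s * arnoldiVec (chebNode k) j i := by
    intro i
    rw [hf, map_sum, Finset.sum_apply]
    refine Finset.sum_congr rfl fun j hj => ?_
    rw [hermiteData_C_mul, Pi.smul_apply, smul_eq_mul,
      hermiteData_hessPoly_arnoldi (chebNode k) (fun j hj => (hr j hj).ne')
        (show j ≤ 2 * k + 1 by have := Finset.mem_range.1 hj; omega)]
  have hl2 : l2 (hermiteData (chebNode k) f) ^ 2 = σ := by
    rw [l2_sq]
    simp only [hdata, sq, Finset.sum_mul_sum]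
    rw [Finset.sum_comm]
    simp only [hσ, sq]
    refine Finset.sum_congr rfl fun a ha => ?_
    rw [Finset.sum_comm, Finset.sum_eq_single a]
    · have h1 := ho a (by have := Finset.mem_range.1 ha; omega) a
        (by have := Finset.mem_range.1 ha; omega)
      rw [if_pos rfl] at h1
      calc _ = (π a).eval s * (π a).eval s * ∑ i, arnoldiVec (chebNode k) a i *
            arnoldiVec (chebNode k) a i := by
            rw [Finset.mul_sum]; exact Finset.sum_congr rfl fun i _ => by ring
        _ = _ := by rw [h1, mul_one]
    · intro b hb hba
      have h1 := ho a (by have := Finset.mem_range.1 ha; omega) b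
        (by have := Finset.mem_range.1 hb; omega)
      rw [if_neg (Ne.symm hba)] at h1
      calc _ = (π a).eval s * (π b).eval s * ∑ i, arnoldiVec (chebNode k) a i *
            arnoldiVec (chebNode k) b i := by
            rw [Finset.mul_sum]; exact Finset.sum_congr rfl fun i _ => by ring
        _ = _ := by rw [h1, mul_zero]
    · exact fun h => absurd ha h
  have hdeg : f.natDegree ≤ 2 * k + 1 := by
    refine natDegree_sum_le_of_forall_le _ _ fun j hj => (natDegree_C_mul_le _ _).trans ?_
    have := Finset.mem_range.1 hj
    exact (natDegree_hessPoly_le _ _ j).trans (by omega)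
  have hev : f.eval s = σ := by
    rw [hf, eval_finsetSum]
    simp [hσ, sq]
  have h := abs_eval_le_l2_hermiteData hdeg hs
  rw [hev, abs_of_nonneg hσ0, ← hl2] at h
  have h0 := l2_nonneg (hermiteData (chebNode k) f)
  rw [← hl2]
  nlinarith

theorem tendsto_l2 {α ι : Type*} [Fintype ι] {G : Filter α} {v : α → ι → ℝ} {v₀ : ι → ℝ}
    (h : ∀ i, Tendsto (fun a => v a i) G (𝓝 (v₀ i))) : Tendsto (fun a => l2 (v a)) G (𝓝 (l2 v₀)) :=
  (tendsto_finsetSum _ fun i _ => (h i).pow 2).sqrt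

theorem l2_arnoldiVec {j : ℕ} (hj : j ≤ 2 * k + 1) : l2 (arnoldiVec (chebNode k) j) = 1 := by
  have h := (arnoldi_orthonormal k (2 * k + 1) le_rfl).1 j hj j hj
  rw [if_pos rfl] at h
  rw [l2]
  simp only [sq]
  rw [h, Real.sqrt_one]

theorem abs_arnoldiHess_le {j l : ℕ} (hj : j < 2 * k + 1) (hl : l ≤ j + 1) :
    |arnoldiHess (chebNode k) l j| ≤ 2 := by
  obtain ⟨ho, hr⟩ := arnoldi_orthonormal k (2 * k + 1) le_rfl
  have e : arnoldiHess (chebNode k) l j =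
      ∑ i, arnoldiVec (chebNode k) l i * confluentMap (chebNode k) (arnoldiVec (chebNode k) j) i := by
    rw [confluentMap_arnoldiVec _ (hr j hj).ne']
    simp only [Finset.sum_apply, Pi.smul_apply, smul_eq_mul, Finset.mul_sum]
    rw [Finset.sum_comm, Finset.sum_eq_single l]
    · have h1 := ho l (by omega) l (by omega)
      rw [if_pos rfl] at h1
      calc _ = arnoldiHess (chebNode k) l j * ∑ i, arnoldiVec (chebNode k) l i *
            arnoldiVec (chebNode k) l i := by rw [h1, mul_one]
        _ = _ := by rw [Finset.mul_sum]; exact Finset.sum_congr rfl fun i _ => by ring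
    · intro b hb hbl
      have h1 := ho l (by omega) b (by have := Finset.mem_range.1 hb; omega)
      rw [if_neg (Ne.symm hbl)] at h1
      calc _ = arnoldiHess (chebNode k) b j * ∑ i, arnoldiVec (chebNode k) l i *
            arnoldiVec (chebNode k) b i := by
            rw [Finset.mul_sum]; exact Finset.sum_congr rfl fun i _ => by ring
        _ = _ := by rw [h1, mul_zero]
    · intro h
      exact absurd (Finset.mem_range.2 (by omega)) h
  rw [e]
  refine (abs_sum_mul_le _ _).trans ?_
  have h1 := l2_confluentMap_le (t := chebNode k) (fun i => by
    obtain ⟨h0, h1⟩ := chebNode_mem_Icc k i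
    rw [abs_of_nonneg h0]; exact h1) (arnoldiVec (chebNode k) j)
  rw [l2_arnoldiVec (by omega : l ≤ 2 * k + 1), one_mul]
  rw [l2_arnoldiVec (by omega : j ≤ 2 * k + 1)] at h1
  linarith

/-- A run that is close enough to exact arithmetic. -/
structure Good (R : FlRun k) : Prop where
  eps_le : ((2 * k + 3 : ℕ) : ℝ) * R.ε ≤ 1 / 100
  H_pos : ∀ j < 2 * k + 1, 0 < R.H (j + 1) j
  H_le : ∀ j < 2 * k + 1, ∀ l ≤ j + 1, |R.H l j| ≤ 3
  x_le : ∀ j < 2 * k + 1, ∀ l ≤ j, |R.x j l| ≤ 3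
  y_le : ∀ j < 2 * k + 1, ∀ l ≤ j, |R.y j l| ≤ R.H (j + 1) j / (400 * ((k : ℝ) + 1) ^ 2)
  V'_le : ∀ j < 2 * k + 1, l2 (R.V' j) ≤ 2 * R.H (j + 1) j
  V''_le : ∀ j < 2 * k + 1, l2 (R.V'' j) ≤ 2 * R.H (j + 1) j
  Q_le : ∀ j ≤ 2 * k + 1, l2 (R.Q j) ≤ 2
  orth : NearlyOrthonormal k R.c R.H
  w_le : ∑ j ∈ Finset.range (2 * k + 2), R.w j ^ 2 ≤ 16

theorem eventually_forall_lt {α : Type*} {G : Filter α} {n : ℕ} {p : ℕ → α → Prop}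
    (h : ∀ j < n, ∀ᶠ a in G, p j a) : ∀ᶠ a in G, ∀ j < n, p j a :=
  (Filter.eventually_all_finite (Set.finite_Iio n)).2 h

/-- Every bound in `Good` leaves slack over its exact counterpart: 3 against 2 for the Hessenberg
entries, 2 against 1 for norms, 16 against 9 for the evaluation, and a positive bound against the
limit 0 for the second pass. -/
theorem eventually_good (hF : Tendsto FlRun.ε F (𝓝 0)) {s₀ : ℝ} (hs₀ : s₀ ∈ Set.Icc (0 : ℝ) 1)
    (hs : Tendsto (fun R : FlRun k => R.s) F (𝓝 s₀)) : ∀ᶠ R in F, Good R := by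
  have h1 : ∀ᶠ R in F, ((2 * k + 3 : ℕ) : ℝ) * R.ε ≤ 1 / 100 := by
    have := hF.const_mul ((2 * k + 3 : ℕ) : ℝ)
    rw [mul_zero] at this
    exact this.eventually_le_const (by norm_num)
  have h2 : ∀ᶠ R in F, ∀ j < 2 * k + 1, 0 < R.H (j + 1) j := eventually_forall_lt fun j hj =>
    ((stepTendsto hF hj).H (j + 1) le_rfl).eventually_const_lt (arnoldiHess_succ_pos hj)
  have h3 : ∀ᶠ R in F, ∀ j < 2 * k + 1, ∀ l < j + 2, |R.H l j| ≤ 3 :=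
    eventually_forall_lt fun j hj => eventually_forall_lt fun l hl =>
      ((stepTendsto hF hj).H l (by omega)).abs.eventually_le_const
        ((abs_arnoldiHess_le hj (by omega)).trans_lt (by norm_num))
  have h4 : ∀ᶠ R in F, ∀ j < 2 * k + 1, ∀ l < j + 1, |R.x j l| ≤ 3 :=
    eventually_forall_lt fun j hj => eventually_forall_lt fun l hl =>
      ((stepTendsto hF hj).x l (by omega)).abs.eventually_le_const
        ((abs_arnoldiHess_le hj (by omega)).trans_lt (by norm_num))
  have h5 : ∀ᶠ R in F, ∀ j < 2 * k + 1, ∀ l < j + 1,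
      |R.y j l| ≤ R.H (j + 1) j / (400 * ((k : ℝ) + 1) ^ 2) :=
    eventually_forall_lt fun j hj => eventually_forall_lt fun l hl => by
      have hst := stepTendsto hF hj
      have e1 := (hst.y l (by omega)).abs
      rw [abs_zero] at e1
      have e2 := (hst.H (j + 1) le_rfl).div_const (400 * ((k : ℝ) + 1) ^ 2)
      refine (e1.eventually_lt e2 ?_).mono fun R hR => hR.le
      have := arnoldiHess_succ_pos hj
      positivity
  have hl2 : ∀ j < 2 * k + 1, arnoldiHess (chebNode k) (j + 1) j =
      l2 (arnoldiResidual (chebNode k) (arnoldiVec (chebNode k)) j) := fun j _ => by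
    rw [arnoldiHess, if_pos rfl]
  have h6 : ∀ᶠ R in F, ∀ j < 2 * k + 1, l2 (R.V' j) ≤ 2 * R.H (j + 1) j :=
    eventually_forall_lt fun j hj => by
      have hst := stepTendsto hF hj
      refine ((tendsto_l2 hst.V').eventually_lt ((hst.H (j + 1) le_rfl).const_mul 2) ?_).mono
        fun R hR => hR.le
      have := arnoldiHess_succ_pos hj
      rw [← hl2 j hj]
      linarith
  have h7 : ∀ᶠ R in F, ∀ j < 2 * k + 1, l2 (R.V'' j) ≤ 2 * R.H (j + 1) j :=
    eventually_forall_lt fun j hj => by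
      have hst := stepTendsto hF hj
      refine ((tendsto_l2 hst.V'').eventually_lt ((hst.H (j + 1) le_rfl).const_mul 2) ?_).mono
        fun R hR => hR.le
      have := arnoldiHess_succ_pos hj
      rw [← hl2 j hj]
      linarith
  have h8 : ∀ᶠ R in F, ∀ j < 2 * k + 2, l2 (R.Q j) ≤ 2 := eventually_forall_lt fun j hj => by
    refine (tendsto_l2 (tendsto_Q hF j (by omega))).eventually_le_const ?_
    rw [l2_arnoldiVec (by omega)]
    norm_num
  have h9 : ∀ᶠ R : FlRun k in F, NearlyOrthonormal k R.c R.H :=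
    eventually_forall_lt fun a ha => eventually_forall_lt fun b hb => by
      have e : Tendsto (fun R : FlRun k =>
          ∑ i, hermiteData (chebNode k) (hessPoly R.c R.H a) i *
            hermiteData (chebNode k) (hessPoly R.c R.H b) i) F
          (𝓝 (∑ i, arnoldiVec (chebNode k) a i * arnoldiVec (chebNode k) b i)) :=
        tendsto_finsetSum _ fun i _ =>
          (tendsto_hermiteData hF a (by omega) i).mul (tendsto_hermiteData hF b (by omega) i)
      rw [(arnoldi_orthonormal k (2 * k + 1) le_rfl).1 a (by omega) b (by omega)] at e
      have e2 := (e.sub_const (if a = b then 1 else 0)).abs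
      rw [sub_self, abs_zero] at e2
      exact e2.eventually_le_const (by positivity)
  have h10 : ∀ᶠ R in F, ∑ j ∈ Finset.range (2 * k + 2), R.w j ^ 2 ≤ 16 := by
    have e : Tendsto (fun R : FlRun k => ∑ j ∈ Finset.range (2 * k + 2), R.w j ^ 2) F
        (𝓝 (∑ j ∈ Finset.range (2 * k + 2),
          (hessPoly (1 / √((k + 1 : ℕ) : ℝ)) (arnoldiHess (chebNode k)) j).eval s₀ ^ 2)) :=
      tendsto_finsetSum _ fun j hj =>
        (tendsto_w hF hs j (by have := Finset.mem_range.1 hj; omega)).pow 2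
    exact e.eventually_le_const ((sum_hessPoly_eval_sq_le hs₀).trans_lt (by norm_num))
  filter_upwards [h1, h2, h3, h4, h5, h6, h7, h8, h9, h10] with R g1 g2 g3 g4 g5 g6 g7 g8 g9 g10
  exact ⟨g1, g2, fun j hj l hl => g3 j hj l (by omega), fun j hj l hl => g4 j hj l (by omega),
    fun j hj l hl => g5 j hj l (by omega), g6, g7, fun j hj => g8 j (by omega), g9, g10⟩

/-- For a sufficiently small unit roundoff every run is good. -/
theorem exists_eps_good (k : ℕ) : ∃ ε₀ : ℝ, 0 < ε₀ ∧ ∀ R : FlRun k, R.ε ≤ ε₀ → Good R := by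
  have h : ∀ᶠ R in comap (FlRun.ε (k := k)) (𝓝 0), Good R := by
    -- The evaluation point need not converge as ε tends to 0. Along an ultrafilter it does, by
    -- compactness of [0, 1], and this makes the threshold uniform in the point and in the rounding
    -- errors.
    rw [Filter.Eventually, mem_iff_ultrafilter]
    intro 𝒰 h𝒰
    have hF : Tendsto FlRun.ε (𝒰 : Filter (FlRun k)) (𝓝 0) := tendsto_comap.mono_left h𝒰
    obtain ⟨s₀, hs₀, hs⟩ := (isCompact_Icc (a := (0 : ℝ)) (b := 1)).ultrafilter_le_nhds'
      (𝒰.map FlRun.s) (Filter.mem_map.2 (Filter.univ_mem' fun R => R.mem_Icc))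
    exact eventually_good hF hs₀ hs
  rw [(Metric.nhds_basis_ball.comap _).eventually_iff] at h
  obtain ⟨δ, hδ, h⟩ := h
  refine ⟨δ / 2, by positivity, fun R hR => h ?_⟩
  rw [Set.mem_preimage, Metric.mem_ball, Real.dist_eq, sub_zero, abs_of_nonneg R.eps_nonneg]
  linarith

end FlRun

end GrassmannCVA

namespace GrassmannCVA

open Polynomial

/-! ### First-order error bounds for good runs -/

theorem FlRound.abs_sub_le_of_le_half {ε x y : ℝ} (h : FlRound ε x y) (hε0 : 0 ≤ ε)
    (hε : ε ≤ 1 / 2) : |y - x| ≤ 2 * ε * |y| := by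
  have h' : |y - x| ≤ ε * |x| := h
  have h1 : |x| ≤ |y| + |y - x| := by
    have := abs_sub_abs_le_abs_sub x y
    rw [abs_sub_comm] at this
    linarith
  have h2 : |x| ≤ 2 * |y| := by nlinarith [abs_nonneg x]
  calc |y - x| ≤ ε * |x| := h'
    _ ≤ ε * (2 * |y|) := mul_le_mul_of_nonneg_left h2 hε0
    _ = _ := by ring

theorem FlRound.abs_le_two_mul {ε x y : ℝ} (h : FlRound ε x y) (hε : ε ≤ 1 / 2) :
    |x| ≤ 2 * |y| := by
  have h' : |y - x| ≤ ε * |x| := h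
  have := abs_sub_abs_le_abs_sub x y
  rw [abs_sub_comm] at this
  nlinarith [abs_nonneg x]

/-- The vector `(0, u)`, when `v = (u, u')`. -/
def shiftDown {m : ℕ} (v : Fin m ⊕ Fin m → ℝ) : Fin m ⊕ Fin m → ℝ :=
  Sum.elim (fun _ => 0) fun i => v (Sum.inl i)

theorem l2_shiftDown_le {m : ℕ} (v : Fin m ⊕ Fin m → ℝ) : l2 (shiftDown v) ≤ l2 v := by
  unfold l2
  refine Real.sqrt_le_sqrt ?_
  rw [Fintype.sum_sum_type, Fintype.sum_sum_type]
  simp only [shiftDown, Sum.elim_inl, Sum.elim_inr, ne_eq, OfNat.ofNat_ne_zero, not_false_eq_true,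
    zero_pow, Finset.sum_const_zero, zero_add]
  exact le_add_of_nonneg_right (Finset.sum_nonneg fun _ _ => sq_nonneg _)

theorem FlConfluentMul.l2_sub_le {m : ℕ} {ε : ℝ} (hε0 : 0 ≤ ε) (hε : ε ≤ 1 / 2) {t : Fin m → ℝ}
    (ht : ∀ i, |t i| ≤ 1) {q v : Fin m ⊕ Fin m → ℝ} (h : FlConfluentMul ε t q v) :
    l2 (fun i => confluentMap t q i - v i) ≤ 4 * ε * l2 q := by
  have hpt : ∀ i, |confluentMap t q i - v i| ≤ abs (3 * ε * |q i| + ε * |shiftDown q i|) := by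
    intro i
    rw [abs_of_nonneg (a := 3 * ε * |q i| + ε * |shiftDown q i|) (by positivity)]
    rcases i with i | i
    · have h1 : |v (Sum.inl i) - t i * q (Sum.inl i)| ≤ ε * |t i * q (Sum.inl i)| := h.1 i
      rw [abs_sub_comm, abs_mul] at h1
      have h2 : |t i| * |q (Sum.inl i)| ≤ 1 * |q (Sum.inl i)| :=
        mul_le_mul_of_nonneg_right (ht i) (abs_nonneg _)
      change |t i * q (Sum.inl i) - v (Sum.inl i)| ≤ _
      have h3 : 0 ≤ ε * |shiftDown q (Sum.inl i)| := by positivity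
      have h4 := mul_nonneg hε0 (abs_nonneg (q (Sum.inl i)))
      nlinarith
    · obtain ⟨z, hz, hv⟩ := h.2 i
      have h1 : |z - t i * q (Sum.inr i)| ≤ ε * |t i * q (Sum.inr i)| := hz
      have h2 : |v (Sum.inr i) - (q (Sum.inl i) + z)| ≤ ε * |q (Sum.inl i) + z| := hv
      have h3 : |t i * q (Sum.inr i)| ≤ |q (Sum.inr i)| := by
        rw [abs_mul]
        exact (mul_le_mul_of_nonneg_right (ht i) (abs_nonneg _)).trans (by rw [one_mul])
      have h4 : |z| ≤ 2 * |q (Sum.inr i)| := by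
        have := abs_sub_abs_le_abs_sub z (t i * q (Sum.inr i))
        nlinarith [abs_nonneg (q (Sum.inr i)), abs_nonneg (t i * q (Sum.inr i))]
      have h5 := abs_add_le (q (Sum.inl i)) z
      change |q (Sum.inl i) + t i * q (Sum.inr i) - v (Sum.inr i)| ≤
        3 * ε * |q (Sum.inr i)| + ε * |q (Sum.inl i)|
      calc _ = |-(z - t i * q (Sum.inr i)) + -(v (Sum.inr i) - (q (Sum.inl i) + z))| := by ring_nf
        _ ≤ |z - t i * q (Sum.inr i)| + |v (Sum.inr i) - (q (Sum.inl i) + z)| :=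
          (abs_add_le _ _).trans (by rw [abs_neg, abs_neg])
        _ ≤ ε * |q (Sum.inr i)| + ε * (|q (Sum.inl i)| + 2 * |q (Sum.inr i)|) := by
          refine add_le_add (h1.trans (mul_le_mul_of_nonneg_left h3 hε0))
            (h2.trans (mul_le_mul_of_nonneg_left ?_ hε0))
          linarith
        _ = _ := by ring
  refine (l2_mono hpt).trans ((l2_add_le _ _).trans ?_)
  rw [l2_smul, l2_smul, l2_abs, l2_abs, abs_of_nonneg hε0, abs_of_nonneg (by positivity)]
  have := mul_le_mul_of_nonneg_left (l2_shiftDown_le q) hε0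
  linarith

namespace FlRun

variable {k : ℕ} {R : FlRun k}

theorem Good.eps_le' (hR : Good R) : R.ε ≤ 1 / 100 := by
  have h := hR.eps_le
  have h0 := R.eps_nonneg
  have : (1 : ℝ) ≤ ((2 * k + 3 : ℕ) : ℝ) := by exact_mod_cast (by omega : 1 ≤ 2 * k + 3)
  nlinarith

theorem Good.mul_eps_le (hR : Good R) {n : ℕ} (hn : n ≤ 2 * k + 2) :
    ((n : ℝ) + 1) * R.ε ≤ 1 / 100 := by
  refine le_trans (mul_le_mul_of_nonneg_right ?_ R.eps_nonneg) hR.eps_le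
  exact_mod_cast (by omega : n + 1 ≤ 2 * k + 3)

theorem abs_chebNode_le (k : ℕ) (i : Fin (k + 1)) : |chebNode k i| ≤ 1 := by
  obtain ⟨h0, h1⟩ := chebNode_mem_Icc k i
  rwa [abs_of_nonneg h0]

/-- A Gram-Schmidt pass as an exact subtraction with small perturbations. -/
theorem pass_eq {ε : ℝ} (hε0 : 0 ≤ ε) (hε : ε ≤ 1 / 2) {j : ℕ}
    {Q : ℕ → Fin (k + 1) ⊕ Fin (k + 1) → ℝ} {v v' : Fin (k + 1) ⊕ Fin (k + 1) → ℝ} {x : ℕ → ℝ}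
    (h : FlGramSchmidtPass ε Q j v x v') {d : ℕ} (hd : j + 1 ≤ 2 ^ d)
    (hdε : ((d : ℝ) + 1) * ε ≤ 1) {B : ℝ} (hB : 0 ≤ B) (hx : ∀ l ≤ j, |x l| ≤ B)
    (hQ : ∀ l ≤ j, l2 (Q l) ≤ 2) :
    ∃ e e' : Fin (k + 1) ⊕ Fin (k + 1) → ℝ,
      (∀ i, v' i = v i - ∑ l ∈ Finset.range (j + 1), x l * Q l i + e i + e' i) ∧
      l2 e ≤ 2 * ε * l2 v' ∧ l2 e' ≤ 4 * ((d : ℝ) + 1) * ε * (((j : ℝ) + 1) * B) := by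
  choose D hD hv' using h.2
  -- The error e of the final subtraction is measured against the result v', which may be much
  -- smaller than v; e' is the error of the accumulated sum.
  refine ⟨fun i => v' i - (v i - D i), fun i => ∑ l ∈ Finset.range (j + 1), x l * Q l i - D i,
    fun i => by ring, ?_, ?_⟩
  · exact l2_le_mul_of_abs_le (by positivity) fun i => (hv' i).abs_sub_le_of_le_half hε0 hε
  · have h1 : ∀ i, |∑ l ∈ Finset.range (j + 1), x l * Q l i - D i| ≤
        2 * ((d : ℝ) + 1) * ε * abs (∑ l ∈ Finset.range (j + 1), |x l| * |Q l i|) := by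
      intro i
      rw [abs_sub_comm, abs_of_nonneg (a := ∑ l ∈ Finset.range (j + 1), |x l| * |Q l i|)
        (Finset.sum_nonneg fun _ _ => by positivity)]
      simpa only [abs_mul] using (hD i).abs_sub_le_range hε0 hd hdε
    refine (l2_le_mul_of_abs_le (by positivity) h1).trans ?_
    have h2 : l2 (fun i => ∑ l ∈ Finset.range (j + 1), |x l| * |Q l i|) ≤ ((j : ℝ) + 1) * (B * 2) := by
      refine (l2_sum_le _ _).trans ?_
      calc _ ≤ ∑ _l ∈ Finset.range (j + 1), B * 2 := by
            refine Finset.sum_le_sum fun l hl => ?_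
            have hl' : l ≤ j := by have := Finset.mem_range.1 hl; omega
            rw [l2_smul, l2_abs, abs_abs]
            exact mul_le_mul (hx l hl') (hQ l hl') (l2_nonneg _) hB
        _ = _ := by rw [Finset.sum_const, Finset.card_range, nsmul_eq_mul]; push_cast; ring
    calc _ ≤ 2 * ((d : ℝ) + 1) * ε * (((j : ℝ) + 1) * (B * 2)) := by gcongr
      _ = _ := by ring

theorem Good.y_le_one (hR : Good R) {j l : ℕ} (hj : j < 2 * k + 1) (hl : l ≤ j) :
    |R.y j l| ≤ 1 := by
  refine (hR.y_le j hj l hl).trans ?_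
  have h1 := hR.H_le j hj (j + 1) le_rfl
  have h2 := le_abs_self (R.H (j + 1) j)
  have hk : (0 : ℝ) ≤ k := Nat.cast_nonneg k
  rw [div_le_one (by positivity)]
  nlinarith

/-- The residual of the computed Arnoldi relation. -/
theorem Good.l2_residual_le (hR : Good R) {j : ℕ} (hj : j < 2 * k + 1) :
    l2 (confluentMap (chebNode k) (R.Q j) - ∑ l ∈ Finset.range (j + 2), R.H l j • R.Q l) ≤
      100 * ((j : ℝ) + 1) ^ 2 * R.ε := by
  have hε0 := R.eps_nonneg
  have hε : R.ε ≤ 1 / 2 := hR.eps_le'.trans (by norm_num)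
  have hdε : (((j + 1 : ℕ) : ℝ) + 1) * R.ε ≤ 1 :=
    (hR.mul_eps_le (by omega)).trans (by norm_num)
  -- A depth of j + 1 in place of the logarithm is harmless here: powers of j are absorbed later by
  -- the decay of the coefficients.
  have hpow : j + 1 ≤ 2 ^ (j + 1) := Nat.lt_two_pow_self.le
  have hQ : ∀ l ≤ j, l2 (R.Q l) ≤ 2 := fun l hl => hR.Q_le l (by omega)
  have hh : R.H (j + 1) j ≤ 3 := (le_abs_self _).trans (hR.H_le j hj (j + 1) le_rfl)
  have hh0 := hR.H_pos j hj
  obtain ⟨e₁, e₁', p₁, n₁, n₁'⟩ := pass_eq hε0 hε (R.pass₁ j hj) hpow hdε (B := 3) (by norm_num)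
    (hR.x_le j hj) hQ
  obtain ⟨e₂, e₂', p₂, n₂, n₂'⟩ := pass_eq hε0 hε (R.pass₂ j hj) hpow hdε (B := 1) (by norm_num)
    (fun l hl => hR.y_le_one hj hl) hQ
  have n₀ := (R.mul j hj).l2_sub_le hε0 hε (abs_chebNode_le k)
  have n₃ : l2 (fun i => R.V'' j i - R.H (j + 1) j * R.Q (j + 1) i) ≤ R.ε * l2 (R.V'' j) := by
    refine l2_le_mul_of_abs_le hε0 fun i => ?_
    have h1 : |R.Q (j + 1) i - R.V'' j i / R.H (j + 1) j| ≤
        R.ε * |R.V'' j i / R.H (j + 1) j| := R.div j hj i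
    rw [abs_div, abs_of_pos hh0] at h1
    have h2 : R.V'' j i - R.H (j + 1) j * R.Q (j + 1) i =
        -(R.H (j + 1) j * (R.Q (j + 1) i - R.V'' j i / R.H (j + 1) j)) := by
      field_simp
      ring
    rw [h2, abs_neg, abs_mul, abs_of_pos hh0]
    calc _ ≤ R.H (j + 1) j * (R.ε * (|R.V'' j i| / R.H (j + 1) j)) :=
          mul_le_mul_of_nonneg_left h1 hh0.le
      _ = _ := by field_simp
  have n₄ : l2 (fun i => ∑ l ∈ Finset.range (j + 1),
      (R.x j l + R.y j l - R.H l j) * R.Q l i) ≤ ((j : ℝ) + 1) * (8 * R.ε) := by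
    refine (l2_sum_le _ _).trans ?_
    calc _ ≤ ∑ _l ∈ Finset.range (j + 1), 8 * R.ε := by
          refine Finset.sum_le_sum fun l hl => ?_
          have hl' : l ≤ j := by have := Finset.mem_range.1 hl; omega
          have h1 : |R.H l j - (R.x j l + R.y j l)| ≤ R.ε * |R.x j l + R.y j l| := R.hess j hj l hl'
          have h2 : |R.x j l + R.y j l| ≤ 4 := by
            have := abs_add_le (R.x j l) (R.y j l)
            linarith [hR.x_le j hj l hl', hR.y_le_one hj hl']
          rw [l2_smul, abs_sub_comm]
          calc _ ≤ (R.ε * 4) * 2 := mul_le_mul (h1.trans (mul_le_mul_of_nonneg_left h2 hε0))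
                (hQ l hl') (l2_nonneg _) (by positivity)
            _ = _ := by ring
      _ = _ := by rw [Finset.sum_const, Finset.card_range, nsmul_eq_mul]; push_cast; ring
  have e : (confluentMap (chebNode k) (R.Q j) - ∑ l ∈ Finset.range (j + 2), R.H l j • R.Q l) =
      fun i => (((((((confluentMap (chebNode k) (R.Q j) i - R.V j i) - e₁ i) - e₁' i) - e₂ i) -
        e₂' i) + (R.V'' j i - R.H (j + 1) j * R.Q (j + 1) i)) +
        ∑ l ∈ Finset.range (j + 1), (R.x j l + R.y j l - R.H l j) * R.Q l i) := by
    ext i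
    rw [Pi.sub_apply, Finset.sum_range_succ, Pi.add_apply, Finset.sum_apply]
    simp only [Pi.smul_apply, smul_eq_mul, add_mul, sub_mul, Finset.sum_add_distrib,
      Finset.sum_sub_distrib]
    have := p₁ i
    have := p₂ i
    linarith
  rw [e]
  have s1 := l2_add_le (fun i => ((((((confluentMap (chebNode k) (R.Q j) i - R.V j i) - e₁ i) -
    e₁' i) - e₂ i) - e₂' i) + (R.V'' j i - R.H (j + 1) j * R.Q (j + 1) i)))
    (fun i => ∑ l ∈ Finset.range (j + 1), (R.x j l + R.y j l - R.H l j) * R.Q l i)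
  have s2 := l2_add_le (fun i => (((((confluentMap (chebNode k) (R.Q j) i - R.V j i) - e₁ i) -
    e₁' i) - e₂ i) - e₂' i)) (fun i => R.V'' j i - R.H (j + 1) j * R.Q (j + 1) i)
  have s3 := l2_sub_le (fun i => ((((confluentMap (chebNode k) (R.Q j) i - R.V j i) - e₁ i) -
    e₁' i) - e₂ i)) e₂'
  have s4 := l2_sub_le (fun i => (((confluentMap (chebNode k) (R.Q j) i - R.V j i) - e₁ i) -
    e₁' i)) e₂
  have s5 := l2_sub_le (fun i => ((confluentMap (chebNode k) (R.Q j) i - R.V j i) - e₁ i)) e₁'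
  have s6 := l2_sub_le (fun i => confluentMap (chebNode k) (R.Q j) i - R.V j i) e₁
  have b1 : l2 (R.V' j) ≤ 6 := by linarith [hR.V'_le j hj]
  have b2 : l2 (R.V'' j) ≤ 6 := by linarith [hR.V''_le j hj]
  have b3 := hQ j le_rfl
  have m0 : 4 * R.ε * l2 (R.Q j) ≤ 4 * R.ε * 2 := by gcongr
  have m1 : 2 * R.ε * l2 (R.V' j) ≤ 2 * R.ε * 6 := by gcongr
  have m2 : 2 * R.ε * l2 (R.V'' j) ≤ 2 * R.ε * 6 := by gcongr
  have m3 : R.ε * l2 (R.V'' j) ≤ R.ε * 6 := by gcongr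
  push_cast at n₁' n₂'
  have hj0 : (0 : ℝ) ≤ j := Nat.cast_nonneg j
  have q1 : 0 ≤ (j : ℝ) * R.ε := by positivity
  have q2 : 0 ≤ (j : ℝ) ^ 2 * R.ε := by positivity
  nlinarith

theorem Good.abs_w_le (hR : Good R) {j : ℕ} (hj : j < 2 * k + 2) : |R.w j| ≤ 4 := by
  have h := Finset.single_le_sum (f := fun j => R.w j ^ 2) (fun _ _ => sq_nonneg _)
    (Finset.mem_range.2 hj)
  have h2 := h.trans hR.w_le
  exact abs_le_of_sq_le_sq (by norm_num at h2 ⊢; linarith) (by norm_num)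

/-- The residual of the computed evaluation recurrence. -/
theorem Good.abs_eval_residual_le (hR : Good R) {j : ℕ} (hj : j < 2 * k + 1) :
    |R.s * R.w j - ∑ l ∈ Finset.range (j + 2), R.H l j * R.w l| ≤
      200 * ((j : ℝ) + 1) ^ 2 * R.ε := by
  have hε0 := R.eps_nonneg
  have hε : R.ε ≤ 1 / 2 := hR.eps_le'.trans (by norm_num)
  have hdε : (((j + 1 : ℕ) : ℝ) + 1) * R.ε ≤ 1 :=
    (hR.mul_eps_le (by omega)).trans (by norm_num)
  have hpow : j + 1 ≤ 2 ^ (j + 1) := Nat.lt_two_pow_self.le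
  have hh : R.H (j + 1) j ≤ 3 := (le_abs_self _).trans (hR.H_le j hj (j + 1) le_rfl)
  have hh0 := hR.H_pos j hj
  obtain ⟨a, d, z, ha, hd, hz, hw⟩ := R.eval.step j hj
  have h1 : |a - R.s * R.w j| ≤ R.ε * 4 := by
    have h : |a - R.s * R.w j| ≤ R.ε * |R.s * R.w j| := ha
    refine h.trans (mul_le_mul_of_nonneg_left ?_ hε0)
    rw [abs_mul, abs_of_nonneg R.mem_Icc.1]
    calc _ ≤ 1 * |R.w j| := mul_le_mul_of_nonneg_right R.mem_Icc.2 (abs_nonneg _)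
      _ ≤ 4 := by rw [one_mul]; exact hR.abs_w_le (by omega)
  have h2 : |d - ∑ l ∈ Finset.range (j + 1), R.H l j * R.w l| ≤
      2 * ((j : ℝ) + 2) * R.ε * (((j : ℝ) + 1) * 12) := by
    refine (hd.abs_sub_le_range hε0 hpow hdε).trans ?_
    push_cast
    have : ∑ l ∈ Finset.range (j + 1), |R.H l j * R.w l| ≤ ((j : ℝ) + 1) * 12 := by
      calc _ ≤ ∑ _l ∈ Finset.range (j + 1), (12 : ℝ) := by
            refine Finset.sum_le_sum fun l hl => ?_
            have hl' := Finset.mem_range.1 hl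
            rw [abs_mul]
            calc _ ≤ 3 * (4 : ℝ) := mul_le_mul (hR.H_le j hj l (by omega))
                  (hR.abs_w_le (by omega)) (abs_nonneg _) (by norm_num)
              _ = 12 := by norm_num
        _ = _ := by rw [Finset.sum_const, Finset.card_range, nsmul_eq_mul]; push_cast; ring
    calc _ ≤ 2 * ((j : ℝ) + 1 + 1) * R.ε * (((j : ℝ) + 1) * 12) := by gcongr
      _ = _ := by ring
  have hwle := hR.abs_w_le (j := j + 1) (by omega)
  -- The numerator is bounded backwards from the computed quotient w_(j+1): |z| ≤ 2 · 4 · 3.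
  have h3 : |z| ≤ 24 := by
    have := hw.abs_le_two_mul hε
    rw [abs_div, abs_of_pos hh0, div_le_iff₀ hh0] at this
    nlinarith [abs_nonneg (R.w (j + 1))]
  have h4 : |z - (a - d)| ≤ 2 * R.ε * 24 :=
    (hz.abs_sub_le_of_le_half hε0 hε).trans (by gcongr)
  have h5 : |z - R.H (j + 1) j * R.w (j + 1)| ≤ R.ε * 24 := by
    have h : |R.w (j + 1) - z / R.H (j + 1) j| ≤ R.ε * |z / R.H (j + 1) j| := hw
    rw [abs_div, abs_of_pos hh0] at h
    have e : z - R.H (j + 1) j * R.w (j + 1) =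
        -(R.H (j + 1) j * (R.w (j + 1) - z / R.H (j + 1) j)) := by
      field_simp
      ring
    rw [e, abs_neg, abs_mul, abs_of_pos hh0]
    calc _ ≤ R.H (j + 1) j * (R.ε * (|z| / R.H (j + 1) j)) := mul_le_mul_of_nonneg_left h hh0.le
      _ = R.ε * |z| := by field_simp
      _ ≤ _ := mul_le_mul_of_nonneg_left h3 hε0
  rw [Finset.sum_range_succ]
  have e : R.s * R.w j - (∑ l ∈ Finset.range (j + 1), R.H l j * R.w l +
      R.H (j + 1) j * R.w (j + 1)) = -(a - R.s * R.w j) +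
      (d - ∑ l ∈ Finset.range (j + 1), R.H l j * R.w l) + -(z - (a - d)) +
      (z - R.H (j + 1) j * R.w (j + 1)) := by ring
  rw [e]
  have t1 := abs_add_le (-(a - R.s * R.w j) +
      (d - ∑ l ∈ Finset.range (j + 1), R.H l j * R.w l) + -(z - (a - d)))
      (z - R.H (j + 1) j * R.w (j + 1))
  have t2 := abs_add_le (-(a - R.s * R.w j) +
      (d - ∑ l ∈ Finset.range (j + 1), R.H l j * R.w l)) (-(z - (a - d)))
  have t3 := abs_add_le (-(a - R.s * R.w j))
      (d - ∑ l ∈ Finset.range (j + 1), R.H l j * R.w l)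
  rw [abs_neg] at t2 t3
  have hj0 : (0 : ℝ) ≤ j := Nat.cast_nonneg j
  have q1 : 0 ≤ (j : ℝ) * R.ε := by positivity
  have q2 : 0 ≤ (j : ℝ) ^ 2 * R.ε := by positivity
  nlinarith

end FlRun

end GrassmannCVA

namespace GrassmannCVA

open Polynomial

namespace FlRun

variable {k : ℕ} {R : FlRun k}

/-! ### Orthogonality of the computed basis -/

/-- The depth of the pairwise summation of `2 k + 2` numbers. -/
def sumDepth (k : ℕ) : ℕ := Nat.clog 2 (2 * k + 2)

theorem le_two_pow_sumDepth (k : ℕ) : 2 * k + 2 ≤ 2 ^ sumDepth k :=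
  Nat.le_pow_clog (by norm_num) _

theorem sumDepth_le (k : ℕ) : sumDepth k ≤ 2 * k + 2 :=
  Nat.clog_le_of_le_pow Nat.lt_two_pow_self.le

/-- The relative error of a computed inner product, up to a factor of `2`. -/
noncomputable def dotError (R : FlRun k) : ℝ := ((sumDepth k : ℝ) + 1) * R.ε

theorem dotError_nonneg (R : FlRun k) : 0 ≤ R.dotError :=
  mul_nonneg (by positivity) R.eps_nonneg

theorem eps_le_dotError (R : FlRun k) : R.ε ≤ R.dotError := by
  have h : 0 ≤ (sumDepth k : ℝ) * R.ε := mul_nonneg (Nat.cast_nonneg _) R.eps_nonneg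
  rw [dotError]
  linarith

theorem Good.dotError_le (hR : Good R) : R.dotError ≤ 1 / 100 := hR.mul_eps_le (sumDepth_le k)

theorem Good.abs_flDot_sub_le (hR : Good R) {a b : Fin (k + 1) ⊕ Fin (k + 1) → ℝ} {r : ℝ}
    (h : FlDot R.ε (augIndex (k + 1)) a b r) :
    |r - ∑ i, a i * b i| ≤ 2 * R.dotError * (l2 a * l2 b) := by
  refine (h.abs_sub_le_aug R.eps_nonneg (le_two_pow_sumDepth k)
    (hR.dotError_le.trans (by norm_num))).trans ?_
  rw [mul_assoc 2]
  exact mul_le_mul_of_nonneg_left (sum_abs_mul_le a b) (mul_nonneg (by norm_num) R.dotError_nonneg)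

theorem abs_sum_start_sub_one_le {m : ℕ} (hm : 0 < m) {ε c : ℝ} (hε0 : 0 ≤ ε) (hε : ε ≤ 1 / 100)
    (h : FlStart ε m c) : |(m : ℝ) * c ^ 2 - 1| ≤ 7 * ε := by
  obtain ⟨β, h1, h2⟩ := h
  have hm' : (0 : ℝ) < m := Nat.cast_pos.2 hm
  obtain ⟨s, hs, hs2⟩ : ∃ s : ℝ, 0 < s ∧ √(m : ℝ) = s := ⟨_, Real.sqrt_pos.2 hm', rfl⟩
  have hms : (m : ℝ) = s ^ 2 := by rw [← hs2, Real.sq_sqrt hm'.le]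
  rw [hs2] at h1
  have h1' : |β - s| ≤ ε * |s| := h1
  have h2' : |c - 1 / β| ≤ ε * |1 / β| := h2
  rw [abs_of_pos hs] at h1'
  obtain ⟨l1, l2⟩ := abs_le.1 h1'
  have hβ : 0 < β := by nlinarith
  rw [abs_of_pos (by positivity : 0 < 1 / β)] at h2'
  have hb : β / s ∈ Set.Icc (1 - ε) (1 + ε) := by
    constructor
    · rw [le_div_iff₀ hs]; linarith
    · rw [div_le_iff₀ hs]; linarith
  have ha : |c * β - 1| ≤ ε := by
    have e : c * β - 1 = (c - 1 / β) * β := by field_simp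
    rw [e, abs_mul, abs_of_pos hβ]
    calc _ ≤ ε * (1 / β) * β := mul_le_mul_of_nonneg_right h2' hβ.le
      _ = ε := by field_simp
  obtain ⟨b, hb'⟩ : ∃ b, b = β / s := ⟨_, rfl⟩
  obtain ⟨a, ha'⟩ : ∃ a, a = c * β := ⟨_, rfl⟩
  rw [← hb'] at hb
  rw [← ha'] at ha
  obtain ⟨b1, b2⟩ := hb
  obtain ⟨a1, a2⟩ := abs_le.1 ha
  have hbpos : 0 < b := by linarith
  have e : (m : ℝ) * c ^ 2 - 1 = (a - b) * (a + b) / b ^ 2 := by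
    rw [hms, hb', ha']
    field_simp
    ring
  rw [e, abs_div, abs_mul, div_le_iff₀ (by positivity), abs_of_pos (by positivity : 0 < b ^ 2)]
  have k1 : |a - b| ≤ 2 * ε := abs_le.2 ⟨by linarith, by linarith⟩
  have k2 : |a + b| ≤ 3 := abs_le.2 ⟨by linarith, by linarith⟩
  have k3 : (6 / 7 : ℝ) ≤ b ^ 2 := by nlinarith
  calc _ ≤ 2 * ε * 3 := mul_le_mul k1 k2 (abs_nonneg _) (by positivity)
    _ ≤ 7 * ε * b ^ 2 := by nlinarith

/-- The division by the computed norm. -/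
theorem Good.l2_normalize_le (hR : Good R) {j : ℕ} (hj : j < 2 * k + 1) :
    l2 (fun i => R.Q (j + 1) i - R.V'' j i / R.H (j + 1) j) ≤ 2 * R.ε := by
  have hh0 := hR.H_pos j hj
  have h := l2_le_mul_of_abs_le R.eps_nonneg (R.div j hj)
  refine h.trans ?_
  have e : (fun i => R.V'' j i / R.H (j + 1) j) = fun i => (R.H (j + 1) j)⁻¹ * R.V'' j i := by
    ext i; rw [div_eq_inv_mul]
  rw [e, l2_smul, abs_of_pos (inv_pos.2 hh0), mul_comm 2]
  refine mul_le_mul_of_nonneg_left ?_ R.eps_nonneg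
  rw [inv_mul_le_iff₀ hh0, mul_comm]
  exact hR.V''_le j hj

/-- After the second pass every rounding error is relative to h, since V' and V'' have norms at most
2h, so division by h does not amplify it. The earlier loss of orthogonality Γ enters only through
the coefficients of the second pass. They are at most h/(400(k + 1)²), and at most 2k + 1 of them
are summed, so Γ is damped by 1/200 and does not accumulate over the steps. -/
theorem Good.abs_gram_succ_le (hR : Good R) {j l : ℕ} (hj : j < 2 * k + 1) (hl : l ≤ j) {Γ : ℝ}
    (hΓ : ∀ l' ≤ j, |∑ i, R.Q l i * R.Q l' i - if l = l' then 1 else 0| ≤ Γ) :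
    |∑ i, R.Q l i * R.Q (j + 1) i| ≤ 21 * R.dotError + Γ / 200 := by
  have hε0 := R.eps_nonneg
  have hε : R.ε ≤ 1 / 2 := hR.eps_le'.trans (by norm_num)
  have hu0 := R.dotError_nonneg
  have hεu := R.eps_le_dotError
  have hΓ0 : 0 ≤ Γ := (abs_nonneg _).trans (hΓ l hl)
  have hh0 := hR.H_pos j hj
  have hQ : ∀ l ≤ j, l2 (R.Q l) ≤ 2 := fun l hl => hR.Q_le l (by omega)
  set h := R.H (j + 1) j with hh
  set B := h / (400 * ((k : ℝ) + 1) ^ 2) with hB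
  have hB0 : 0 ≤ B := by positivity
  have hjB : ((j : ℝ) + 1) * B ≤ h / 200 := by
    have h1 : ((j : ℝ) + 1) ≤ 2 * ((k : ℝ) + 1) ^ 2 := by
      have : (j : ℝ) < 2 * k + 1 := by exact_mod_cast hj
      nlinarith [sq_nonneg (k : ℝ)]
    calc _ ≤ 2 * ((k : ℝ) + 1) ^ 2 * B := mul_le_mul_of_nonneg_right h1 hB0
      _ = h / 200 := by rw [hB]; field_simp; norm_num
  obtain ⟨e, e', p, n, n'⟩ := pass_eq hε0 hε (R.pass₂ j hj) (d := sumDepth k)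
    ((by omega : j + 1 ≤ 2 * k + 2).trans (le_two_pow_sumDepth k))
    (hR.dotError_le.trans (by norm_num)) hB0 (hR.y_le j hj) hQ
  have d1 : |R.y j l - ∑ i, R.Q l i * R.V' j i| ≤ 8 * R.dotError * h := by
    refine (hR.abs_flDot_sub_le ((R.pass₂ j hj).1 l hl)).trans ?_
    calc _ ≤ 2 * R.dotError * (2 * (2 * h)) := by
          gcongr
          · exact l2_nonneg _
          · exact hQ l hl
          · exact hR.V'_le j hj
      _ = _ := by ring
  have d2 : |∑ l' ∈ Finset.range (j + 1), R.y j l' *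
      (∑ i, R.Q l i * R.Q l' i - if l = l' then 1 else 0)| ≤ h / 200 * Γ := by
    refine (Finset.abs_sum_le_sum_abs _ _).trans ?_
    calc _ ≤ ∑ _l' ∈ Finset.range (j + 1), B * Γ := by
          refine Finset.sum_le_sum fun l' hl' => ?_
          have hl'' : l' ≤ j := by have := Finset.mem_range.1 hl'; omega
          rw [abs_mul]
          exact mul_le_mul (hR.y_le j hj l' hl'') (hΓ l' hl'') (abs_nonneg _) hB0
      _ = ((j : ℝ) + 1) * B * Γ := by
          rw [Finset.sum_const, Finset.card_range, nsmul_eq_mul]; push_cast; ring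
      _ ≤ _ := mul_le_mul_of_nonneg_right hjB hΓ0
  have d3 : |∑ i, R.Q l i * e i| ≤ 8 * R.dotError * h := by
    refine (abs_sum_mul_le _ _).trans ?_
    calc _ ≤ 2 * (2 * R.dotError * (2 * h)) := by
          refine mul_le_mul (hQ l hl) (n.trans ?_) (l2_nonneg _) (by norm_num)
          have := hR.V''_le j hj
          gcongr
          exact l2_nonneg _
      _ = _ := by ring
  have d4 : |∑ i, R.Q l i * e' i| ≤ R.dotError * h / 25 := by
    refine (abs_sum_mul_le _ _).trans ?_
    have n2 : l2 e' ≤ 4 * R.dotError * (h / 200) := by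
      refine n'.trans ?_
      rw [mul_assoc 4]
      exact mul_le_mul_of_nonneg_left hjB (by positivity)
    calc _ ≤ 2 * (4 * R.dotError * (h / 200)) :=
          mul_le_mul (hQ l hl) n2 (l2_nonneg _) (by norm_num)
      _ = _ := by ring
  have d5 : |∑ i, R.Q l i * (R.Q (j + 1) i - R.V'' j i / h)| ≤ 4 * R.dotError := by
    refine (abs_sum_mul_le _ _).trans ?_
    calc _ ≤ 2 * (2 * R.dotError) := mul_le_mul (hQ l hl)
          ((hR.l2_normalize_le hj).trans (by linarith)) (l2_nonneg _) (by norm_num)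
      _ = _ := by ring
  have id1 : ∑ i, R.Q l i * R.V'' j i = -(R.y j l - ∑ i, R.Q l i * R.V' j i) -
      ∑ l' ∈ Finset.range (j + 1), R.y j l' *
        (∑ i, R.Q l i * R.Q l' i - if l = l' then 1 else 0) +
      ∑ i, R.Q l i * e i + ∑ i, R.Q l i * e' i := by
    have h1 : ∑ l' ∈ Finset.range (j + 1), R.y j l' * (if l = l' then (1 : ℝ) else 0) = R.y j l := by
      simp [Finset.sum_ite_eq, Nat.lt_succ_of_le hl]
    have h2 := sum_mul_sub_sum (R.Q l) (R.V' j) (Finset.range (j + 1)) (R.y j) R.Q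
    have h3 : ∑ i, R.Q l i * R.V'' j i = ∑ i, R.Q l i * (R.V' j i -
        ∑ l' ∈ Finset.range (j + 1), R.y j l' * R.Q l' i) +
        ∑ i, R.Q l i * e i + ∑ i, R.Q l i * e' i := by
      simp only [← Finset.sum_add_distrib, ← mul_add]
      exact Finset.sum_congr rfl fun i _ => by rw [p i]
    rw [h3, h2]
    simp only [mul_sub, Finset.sum_sub_distrib]
    rw [h1]
    ring
  have id2 : ∑ i, R.Q l i * R.Q (j + 1) i =
      (∑ i, R.Q l i * R.V'' j i) / h + ∑ i, R.Q l i * (R.Q (j + 1) i - R.V'' j i / h) := by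
    rw [Finset.sum_div, ← Finset.sum_add_distrib]
    exact Finset.sum_congr rfl fun i _ => by ring
  have m1 : |∑ i, R.Q l i * R.V'' j i| ≤ (17 * R.dotError + Γ / 200) * h := by
    rw [id1]
    have hs : 0 ≤ R.dotError * h := by positivity
    rw [abs_le] at d1 d2 d3 d4 ⊢
    constructor <;> linarith [d1.1, d1.2, d2.1, d2.2, d3.1, d3.2, d4.1, d4.2]
  rw [id2]
  refine (abs_add_le _ _).trans ?_
  have m2 : |(∑ i, R.Q l i * R.V'' j i) / h| ≤ 17 * R.dotError + Γ / 200 := by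
    rw [abs_div, abs_of_pos hh0, div_le_iff₀ hh0]
    exact m1
  linarith

theorem Good.abs_norm_sq_sub_one_le (hR : Good R) {j : ℕ} (hj : j < 2 * k + 1) :
    |∑ i, R.Q (j + 1) i * R.Q (j + 1) i - 1| ≤ 36 * R.dotError := by
  have hε0 := R.eps_nonneg
  have hε := hR.eps_le'
  have hu0 := R.dotError_nonneg
  have hu := hR.dotError_le
  have hεu := R.eps_le_dotError
  have hh0 := hR.H_pos j hj
  have hN := hR.V''_le j hj
  have hdot := hR.abs_flDot_sub_le (R.dot j hj)
  have hsq : |R.H (j + 1) j - √(R.r j)| ≤ R.ε * |√(R.r j)| := R.sqrt j hj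
  have hdiv := R.div j hj
  set h := R.H (j + 1) j with hh
  set N := l2 (R.V'' j) with hNdef
  have hN0 : 0 ≤ N := l2_nonneg _
  have hNN : ∑ i, R.V'' j i * R.V'' j i = N ^ 2 := by
    rw [hNdef, l2_sq]
    exact Finset.sum_congr rfl fun i _ => by ring
  rw [hNN, ← sq] at hdot
  obtain ⟨r1, r2⟩ := abs_le.1 hdot
  have hr0 : 0 ≤ R.r j := by nlinarith [sq_nonneg N]
  obtain ⟨ρ, hρ0, hρ⟩ : ∃ ρ : ℝ, 0 ≤ ρ ∧ √(R.r j) = ρ := ⟨_, Real.sqrt_nonneg _, rfl⟩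
  have hρ2 : R.r j = ρ ^ 2 := by rw [← hρ, Real.sq_sqrt hr0]
  rw [hρ, abs_of_nonneg hρ0] at hsq
  obtain ⟨s1, s2⟩ := abs_le.1 hsq
  have h2 : |h ^ 2 - ρ ^ 2| ≤ 3 * R.ε * ρ ^ 2 := by
    have e : h ^ 2 - ρ ^ 2 = (h - ρ) * (h + ρ) := by ring
    rw [e, abs_mul]
    have : |h + ρ| ≤ 3 * ρ := abs_le.2 ⟨by linarith, by nlinarith⟩
    calc _ ≤ R.ε * ρ * (3 * ρ) := mul_le_mul hsq this (abs_nonneg _) (by positivity)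
      _ = _ := by ring
  have h3 : |h ^ 2 - N ^ 2| ≤ 6 * R.dotError * N ^ 2 := by
    have hN2 := sq_nonneg N
    have a1 : ρ ^ 2 ≤ 4 / 3 * N ^ 2 := by nlinarith
    have a2 : 3 * R.ε * ρ ^ 2 ≤ 3 * R.ε * (4 / 3 * N ^ 2) := by gcongr
    have a3 : R.ε * N ^ 2 ≤ R.dotError * N ^ 2 := by gcongr
    rw [hρ2] at r1 r2
    obtain ⟨b1, b2⟩ := abs_le.1 h2
    exact abs_le.2 ⟨by linarith, by linarith⟩
  have h4 : |N ^ 2 / h ^ 2 - 1| ≤ 24 * R.dotError := by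
    have e : N ^ 2 / h ^ 2 - 1 = -(h ^ 2 - N ^ 2) / h ^ 2 := by field_simp; ring
    rw [e, abs_div, abs_neg, abs_of_pos (by positivity : 0 < h ^ 2), div_le_iff₀ (by positivity)]
    have : N ^ 2 ≤ (2 * h) ^ 2 := by gcongr
    nlinarith
  have h5 : |∑ i, R.Q (j + 1) i * R.Q (j + 1) i - N ^ 2 / h ^ 2| ≤ 12 * R.ε := by
    rw [← hNN, Finset.sum_div, ← Finset.sum_sub_distrib]
    refine (Finset.abs_sum_le_sum_abs _ _).trans ?_
    calc _ ≤ ∑ i, 3 * R.ε * (R.V'' j i * R.V'' j i / h ^ 2) := by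
          refine Finset.sum_le_sum fun i _ => ?_
          have hi : |R.Q (j + 1) i - R.V'' j i / h| ≤ R.ε * |R.V'' j i / h| := hdiv i
          have e1 : R.V'' j i * R.V'' j i / h ^ 2 = (R.V'' j i / h) ^ 2 := by
            rw [div_pow, sq (R.V'' j i)]
          rw [e1]
          generalize R.V'' j i / h = a at hi ⊢
          generalize R.Q (j + 1) i = q at hi ⊢
          have e : q * q - a ^ 2 = (q - a) * ((q - a) + 2 * a) := by ring
          have t : |(q - a) + 2 * a| ≤ 3 * |a| := by
            refine (abs_add_le _ _).trans ?_
            rw [abs_mul, abs_two]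
            nlinarith [abs_nonneg a]
          rw [e, abs_mul, ← sq_abs a]
          calc _ ≤ R.ε * |a| * (3 * |a|) := mul_le_mul hi t (abs_nonneg _) (by positivity)
            _ = _ := by ring
      _ = 3 * R.ε * (N ^ 2 / h ^ 2) := by rw [← Finset.mul_sum, ← Finset.sum_div, hNN]
      _ ≤ 3 * R.ε * 4 := by
          refine mul_le_mul_of_nonneg_left ?_ (by positivity)
          rw [div_le_iff₀ (by positivity)]
          nlinarith
      _ = _ := by ring
  rw [abs_le] at h4 h5 ⊢
  constructor <;> linarith [h4.1, h4.2, h5.1, h5.2]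

/-- The computed basis vectors are orthonormal up to rounding. -/
theorem Good.abs_gram_sub_le (hR : Good R) {a b : ℕ} (ha : a < 2 * k + 2) (hb : b < 2 * k + 2) :
    |∑ i, R.Q a i * R.Q b i - if a = b then 1 else 0| ≤ 100 * R.dotError := by
  have hu0 := R.dotError_nonneg
  have key : ∀ j ≤ 2 * k + 1, ∀ a ≤ j, ∀ b ≤ j,
      |∑ i, R.Q a i * R.Q b i - if a = b then 1 else 0| ≤ 100 * R.dotError := by
    intro j
    induction j with
    | zero =>
      intro _ a ha b hb
      obtain rfl : a = 0 := by omega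
      obtain rfl : b = 0 := by omega
      have h := abs_sum_start_sub_one_le (Nat.succ_pos k) R.eps_nonneg hR.eps_le' R.flStart
      have e : ∑ i, R.Q 0 i * R.Q 0 i = ((k + 1 : ℕ) : ℝ) * R.c ^ 2 := by
        rw [R.start, Fintype.sum_sum_type]
        simp [sq]
      rw [if_pos rfl, e]
      have := R.eps_le_dotError
      refine h.trans (by linarith)
    | succ j ih =>
      intro hj a ha b hb
      have hj' : j < 2 * k + 1 := by omega
      -- The induction closes because 21 + 100/200 ≤ 100.
      have off : ∀ l ≤ j, |∑ i, R.Q l i * R.Q (j + 1) i| ≤ 100 * R.dotError := fun l hl =>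
        (hR.abs_gram_succ_le hj' hl fun l' hl' => ih (by omega) l hl l' hl').trans (by linarith)
      rcases Nat.lt_or_ge j a with ha' | ha' <;> rcases Nat.lt_or_ge j b with hb' | hb'
      · obtain rfl : a = j + 1 := by omega
        obtain rfl : b = j + 1 := by omega
        rw [if_pos rfl]
        exact (hR.abs_norm_sq_sub_one_le hj').trans (by linarith)
      · obtain rfl : a = j + 1 := by omega
        rw [if_neg (by omega), sub_zero]
        simpa only [mul_comm] using off b hb'
      · obtain rfl : b = j + 1 := by omega
        rw [if_neg (by omega), sub_zero]
        exact off a ha'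
      · exact ih (by omega) a ha' b hb'
  exact key (2 * k + 1) le_rfl a (by omega) b (by omega)

end FlRun

end GrassmannCVA

namespace GrassmannCVA

open Polynomial

/-! ### The computed interpolant and the exact one -/

theorem sum_inv_sq_le_two (n : ℕ) : ∑ j ∈ Finset.range n, 1 / ((j : ℝ) + 1) ^ 2 ≤ 2 := by
  suffices h : ∑ j ∈ Finset.range n, 1 / ((j : ℝ) + 1) ^ 2 ≤ 2 - 1 / (n : ℝ) from
    h.trans (sub_le_self _ (by positivity))
  induction n with
  | zero => simp
  | succ n ih =>
    rw [Finset.sum_range_succ]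
    rcases Nat.eq_zero_or_pos n with rfl | hn
    · norm_num
    · have hn' : (0 : ℝ) < n := Nat.cast_pos.2 hn
      have h : 1 / ((n : ℝ) + 1) ^ 2 ≤ 1 / (n : ℝ) - 1 / ((n : ℝ) + 1) := by
        rw [div_sub_div _ _ hn'.ne' (by positivity), div_le_div_iff₀ (by positivity) (by positivity)]
        nlinarith
      push_cast
      linarith

theorem sum_inv_pow_le_two (n : ℕ) {s : ℕ} (hs : 2 ≤ s) :
    ∑ j ∈ Finset.range n, 1 / ((j : ℝ) + 1) ^ s ≤ 2 := by
  refine le_trans (Finset.sum_le_sum fun j _ => ?_) (sum_inv_sq_le_two n)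
  have : (1 : ℝ) ≤ (j : ℝ) + 1 := by linarith [Nat.cast_nonneg (α := ℝ) j]
  exact one_div_le_one_div_of_le (by positivity) (pow_le_pow_right₀ this hs)

namespace FlRun

variable {k : ℕ} {R : FlRun k}

/-- The logarithmic depth is at most of order √k, a factor that the final k^(3/2) can afford; a
depth linear in k would cost a further √k in the bound. -/
theorem sumDepth_add_one_le (k : ℕ) : (sumDepth k : ℝ) + 1 ≤ 4 * √(2 * k + 2) := by
  have aux : ∀ e : ℕ, (e + 3) ^ 2 + 2 ≤ 16 * 2 ^ e := by
    intro e
    induction e with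
    | zero => norm_num
    | succ e ih => have : 2 ^ (e + 1) = 2 * 2 ^ e := pow_succ' 2 e; nlinarith
  have h1 : 2 ^ (sumDepth k).pred < 2 * k + 2 := Nat.pow_pred_clog_lt_self (by norm_num) (by omega)
  have h2 := aux (sumDepth k).pred
  have h3 : sumDepth k + 1 ≤ (sumDepth k).pred + 3 := by
    have := Nat.pred_eq_sub_one (n := sumDepth k)
    omega
  have h4 : (sumDepth k + 1) ^ 2 ≤ 16 * (2 * k + 2) := by
    have := Nat.pow_le_pow_left h3 2
    omega
  have h5 : ((sumDepth k : ℝ) + 1) ^ 2 ≤ 16 * (2 * k + 2) := by exact_mod_cast h4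
  refine abs_le_of_sq_le_sq' ?_ (by positivity) |>.2
  rw [mul_pow, Real.sq_sqrt (by positivity)]
  linarith

theorem dotError_le_mul_eps (R : FlRun k) : R.dotError ≤ 4 * √(2 * k + 2) * R.ε :=
  mul_le_mul_of_nonneg_right (sumDepth_add_one_le k) R.eps_nonneg

theorem Good.abs_w_sub_eval_le (hR : Good R) {j : ℕ} (hj : j < 2 * k + 2) :
    |R.w j - (hessPoly R.c R.H j).eval R.s| ≤ 38400 * √(2 * k + 2) * ((j : ℝ) + 1) ^ 7 * R.ε := by
  have hε0 := R.eps_nonneg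
  have h := hR.orth.abs_recurrence_sub_le (fun j hj => (hR.H_pos j hj).ne') R.mem_Icc R.eval.start
    (g := fun j => R.s * R.w j - ∑ l ∈ Finset.range (j + 2), R.H l j * R.w l)
    (fun j _ => by ring) hj (δ := 200 * ((j : ℝ) + 1) ^ 2 * R.ε) (by positivity) ?_
  · refine h.trans (le_of_eq (by ring))
  · intro l hl
    refine (hR.abs_eval_residual_le (by omega)).trans ?_
    have : (l : ℝ) ≤ j := by exact_mod_cast hl.le
    gcongr

theorem Good.l2_hermiteData_sub_le (hR : Good R) {j : ℕ} (hj : j < 2 * k + 2) :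
    l2 (fun i => hermiteData (chebNode k) (hessPoly R.c R.H j) i - R.Q j i) ≤
      96000 * √(2 * k + 2) * ((j : ℝ) + 1) ^ 9 * R.ε := by
  have hε0 := R.eps_nonneg
  have h := hR.orth.l2_hermiteData_sub_le (fun j hj => (hR.H_pos j hj).ne') R.start
    (f := fun j => confluentMap (chebNode k) (R.Q j) -
      ∑ l ∈ Finset.range (j + 2), R.H l j • R.Q l)
    (fun j _ => by simp) hj (δ := 100 * ((j : ℝ) + 1) ^ 2 * R.ε) (by positivity) ?_
  · refine h.trans (le_of_eq (by ring))
  · intro l hl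
    refine (hR.l2_residual_le (by omega)).trans ?_
    have : (l : ℝ) ≤ j := by exact_mod_cast hl.le
    gcongr

theorem Good.sum_abs_w_le (hR : Good R) :
    ∑ j ∈ Finset.range (2 * k + 2), |R.w j| ≤ 4 * √(2 * k + 2) := by
  have h := sq_sum_le_card_mul_sum_sq (s := Finset.range (2 * k + 2)) (f := fun j => |R.w j|)
  simp only [sq_abs, Finset.card_range] at h
  refine abs_le_of_sq_le_sq' ?_ (by positivity) |>.2
  rw [mul_pow, Real.sq_sqrt (by positivity)]
  push_cast at h
  refine h.trans ?_
  have := mul_le_mul_of_nonneg_left hR.w_le (by positivity : (0 : ℝ) ≤ 2 * k + 2)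
  linarith

variable {Y : Fin (k + 1) ⊕ Fin (k + 1) → ℝ} {K : ℝ} {α A : ℕ → ℝ}

/-- The computed coefficients are close to the coefficients of the exact interpolant. -/
theorem Good.abs_coeff_sub_le (hR : Good R) (hK : 0 ≤ K) (hY : ∀ i, |Y i| ≤ K)
    (hYα : ∀ i, Y i = ∑ j ∈ Finset.range (2 * k + 2),
      α j * hermiteData (chebNode k) (hessPoly R.c R.H j) i)
    (hα : ∀ j < 2 * k + 2, |α j| ≤ 2 * √(2 * k + 2) * K * (1 / ((j : ℝ) + 1) ^ 11))
    {j : ℕ} (hj : j < 2 * k + 2) {a : ℝ} (ha : FlDot R.ε (augIndex (k + 1)) (R.Q j) Y a) :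
    |a - α j| ≤ 800000 * √(2 * k + 2) ^ 2 * K * R.ε ∧ |a| ≤ 3 * √(2 * k + 2) * K := by
  have hε0 := R.eps_nonneg
  have hu0 := R.dotError_nonneg
  have hu := hR.dotError_le
  have huσ := R.dotError_le_mul_eps
  have hσ0 : 0 ≤ √(2 * (k : ℝ) + 2) := Real.sqrt_nonneg _
  have hYn : l2 Y ≤ √(2 * k + 2) * K := by
    refine (l2_le_sqrt_card_mul hY hK).trans (le_of_eq ?_)
    congr 2
    simp only [Fintype.card_sum, Fintype.card_fin]
    push_cast
    ring
  have hQ := hR.Q_le j (by omega)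
  set σ := √(2 * (k : ℝ) + 2) with hσ
  set n := 2 * k + 2 with hn
  set W : ℕ → Fin (k + 1) ⊕ Fin (k + 1) → ℝ :=
    fun j => hermiteData (chebNode k) (hessPoly R.c R.H j) with hW
  have d1 : |a - ∑ i, R.Q j i * Y i| ≤ 4 * R.dotError * σ * K := by
    refine (hR.abs_flDot_sub_le ha).trans ?_
    calc _ ≤ 2 * R.dotError * (2 * (σ * K)) := by
          gcongr
          exact l2_nonneg _
      _ = _ := by ring
  have d2 : |∑ l ∈ Finset.range n, α l *
      (∑ i, R.Q j i * R.Q l i - if j = l then 1 else 0)| ≤ 400 * R.dotError * σ * K := by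
    refine (Finset.abs_sum_le_sum_abs _ _).trans ?_
    calc _ ≤ ∑ l ∈ Finset.range n, (200 * R.dotError * σ * K) * (1 / ((l : ℝ) + 1) ^ 11) := by
          refine Finset.sum_le_sum fun l hl => ?_
          have hl' := Finset.mem_range.1 hl
          rw [abs_mul]
          calc _ ≤ 2 * σ * K * (1 / ((l : ℝ) + 1) ^ 11) * (100 * R.dotError) :=
                mul_le_mul (hα l hl') (hR.abs_gram_sub_le hj hl') (abs_nonneg _) (by positivity)
            _ = _ := by ring
      _ ≤ (200 * R.dotError * σ * K) * 2 := by
          rw [← Finset.mul_sum]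
          exact mul_le_mul_of_nonneg_left (sum_inv_pow_le_two n (by norm_num)) (by positivity)
      _ = _ := by ring
  -- The decay (l + 1)^(-11) meets the growth (l + 1)^9 of the distance between Q_l and the data of
  -- π_l. The exponent 11 is chosen to leave the summable (l + 1)^(-2).
  have d3 : |∑ i, R.Q j i * ∑ l ∈ Finset.range n, α l * (W l i - R.Q l i)| ≤
      768000 * σ ^ 2 * K * R.ε := by
    have h1 : l2 (fun i => ∑ l ∈ Finset.range n, α l * (W l i - R.Q l i)) ≤
        384000 * σ ^ 2 * K * R.ε := by
      refine (l2_sum_le _ _).trans ?_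
      calc _ ≤ ∑ l ∈ Finset.range n, (192000 * σ ^ 2 * K * R.ε) * (1 / ((l : ℝ) + 1) ^ 2) := by
            refine Finset.sum_le_sum fun l hl => ?_
            have hl' := Finset.mem_range.1 hl
            rw [l2_smul]
            calc _ ≤ 2 * σ * K * (1 / ((l : ℝ) + 1) ^ 11) *
                  (96000 * σ * ((l : ℝ) + 1) ^ 9 * R.ε) :=
                  mul_le_mul (hα l hl') (hR.l2_hermiteData_sub_le hl') (l2_nonneg _) (by positivity)
              _ = _ := by field_simp; ring
        _ ≤ (192000 * σ ^ 2 * K * R.ε) * 2 := by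
            rw [← Finset.mul_sum]
            exact mul_le_mul_of_nonneg_left (sum_inv_sq_le_two n) (by positivity)
        _ = _ := by ring
    refine (abs_sum_mul_le _ _).trans ?_
    calc _ ≤ 2 * (384000 * σ ^ 2 * K * R.ε) := mul_le_mul hQ h1 (l2_nonneg _) (by norm_num)
      _ = _ := by ring
  -- Expand Y in the data W_l of the π_l and replace W_l by Q_l: what remains besides α_j is the
  -- defect of the Gram matrix and the distance of W_l from Q_l.
  have id : ∑ i, R.Q j i * Y i = α j + ∑ l ∈ Finset.range n, α l *
      (∑ i, R.Q j i * R.Q l i - if j = l then 1 else 0) +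
      ∑ i, R.Q j i * ∑ l ∈ Finset.range n, α l * (W l i - R.Q l i) := by
    have h1 : ∑ l ∈ Finset.range n, α l * (if j = l then (1 : ℝ) else 0) = α j := by
      simp [hj]
    have h2 : ∑ l ∈ Finset.range n, α l * ∑ i, R.Q j i * R.Q l i =
        ∑ i, R.Q j i * ∑ l ∈ Finset.range n, α l * R.Q l i := by
      simp only [Finset.mul_sum]
      rw [Finset.sum_comm]
      exact Finset.sum_congr rfl fun i _ => Finset.sum_congr rfl fun l _ => by ring
    simp only [mul_sub, Finset.sum_sub_distrib]
    rw [h1, h2]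
    have h3 : ∀ i, R.Q j i * Y i = R.Q j i * ∑ l ∈ Finset.range n, α l * W l i :=
      fun i => by rw [hYα i]
    rw [Finset.sum_congr rfl fun i _ => h3 i]
    ring
  have huσ' : R.dotError * σ * K ≤ 4 * σ ^ 2 * K * R.ε := by
    have := mul_le_mul_of_nonneg_right huσ (mul_nonneg hσ0 hK)
    nlinarith
  have hp : 0 ≤ σ ^ 2 * K * R.ε := by positivity
  constructor
  · rw [id] at d1
    rw [abs_le] at d1 d2 d3 ⊢
    constructor <;> linarith [d1.1, d1.2, d2.1, d2.2, d3.1, d3.2]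
  · have h1 : |∑ i, R.Q j i * Y i| ≤ 2 * (σ * K) :=
      (abs_sum_mul_le _ _).trans (mul_le_mul hQ hYn (l2_nonneg _) (by norm_num))
    have h2 : R.dotError * (σ * K) ≤ 1 / 100 * (σ * K) :=
      mul_le_mul_of_nonneg_right hu (by positivity)
    have h3 : 0 ≤ σ * K := by positivity
    rw [abs_le] at d1 h1 ⊢
    constructor <;> linarith [d1.1, d1.2, h1.1, h1.2]

/-- The computed value of the interpolant of data that polynomials approximate well is close to
the value of the exact Hermite interpolant. -/
theorem Good.exists_interpolant (hR : Good R) (hK : 0 ≤ K)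
    (hY : ∀ j < 2 * k + 2, ∃ g : ℝ[X], g.degree < j ∧
      ∀ i, |Y i - hermiteData (chebNode k) g i| ≤ K / ((j : ℝ) + 1) ^ 11)
    (hA : ∀ j ≤ 2 * k + 1, FlDot R.ε (augIndex (k + 1)) (R.Q j) Y (A j)) {r : ℝ}
    (hr : FlDot R.ε (List.range (2 * k + 2)) R.w A r) :
    ∃ h : ℝ[X], h.natDegree ≤ 2 * k + 1 ∧ hermiteData (chebNode k) h = Y ∧
      |r - h.eval R.s| ≤ 4000000 * √(2 * k + 2) ^ 3 * K * R.ε := by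
  have hε0 := R.eps_nonneg
  have hu0 := R.dotError_nonneg
  have huσ := R.dotError_le_mul_eps
  have hw := hR.sum_abs_w_le
  obtain ⟨Λ, hΛ, hΛd, hΛb⟩ := hR.orth.exists_coordinates
  have hY0 : ∀ i, |Y i| ≤ K := by
    intro i
    obtain ⟨g, hg, hgY⟩ := hY 0 (by omega)
    have : g = 0 := by simpa using hg
    simpa [this] using hgY i
  have hα : ∀ j < 2 * k + 2, |Λ Y j| ≤ 2 * √(2 * k + 2) * K * (1 / ((j : ℝ) + 1) ^ 11) := by
    intro j hj
    obtain ⟨g, hg, hgY⟩ := hY j hj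
    have h0 := coordinate_eq_zero_of_degree_lt hR.orth.const_ne_zero
      (fun j hj => (hR.H_pos j hj).ne') hΛd hj hg
    -- An approximant of degree below j has no j-th coordinate, so the coefficient of Y is that of
    -- the approximation error.
    have h1 : Λ Y j = Λ (Y - hermiteData (chebNode k) g) j := by
      rw [map_sub, Pi.sub_apply, h0, sub_zero]
    rw [h1]
    refine (hΛb _ j hj).trans ?_
    have h2 := l2_le_sqrt_card_mul (v := Y - hermiteData (chebNode k) g) hgY (by positivity)
    calc _ ≤ 2 * (√(2 * k + 2) * (K / ((j : ℝ) + 1) ^ 11)) := by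
          refine mul_le_mul_of_nonneg_left (h2.trans (le_of_eq ?_)) (by norm_num)
          congr 2
          simp only [Fintype.card_sum, Fintype.card_fin]
          push_cast
          ring
      _ = _ := by ring
  have hc : ∀ j < 2 * k + 2, |A j - Λ Y j| ≤ 800000 * √(2 * k + 2) ^ 2 * K * R.ε ∧
      |A j| ≤ 3 * √(2 * k + 2) * K := fun j hj =>
    hR.abs_coeff_sub_le hK hY0 (hΛ Y) hα hj (hA j (by omega))
  -- The exact Hermite interpolant, expanded in the polynomials of the computed Hessenberg matrix.
  refine ⟨∑ j ∈ Finset.range (2 * k + 2), C (Λ Y j) * hessPoly R.c R.H j, ?_, ?_, ?_⟩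
  · refine natDegree_sum_le_of_forall_le _ _ fun j hj => ?_
    have := Finset.mem_range.1 hj
    exact (natDegree_C_mul_le _ _).trans ((natDegree_hessPoly_le _ _ j).trans (by omega))
  · ext i
    rw [map_sum, Finset.sum_apply, hΛ Y i]
    refine Finset.sum_congr rfl fun j _ => ?_
    rw [← smul_eq_C_mul, map_smul]
    rfl
  rw [eval_finsetSum]
  simp only [eval_mul, eval_C]
  have hσ1 : 1 ≤ √(2 * (k : ℝ) + 2) :=
    Real.one_le_sqrt.2 (by linarith [Nat.cast_nonneg (α := ℝ) k])
  set σ := √(2 * (k : ℝ) + 2) with hσ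
  have hσ0 : 0 ≤ σ := by linarith
  set n := 2 * k + 2 with hn
  have d1 : |r - ∑ j ∈ Finset.range n, R.w j * A j| ≤ 24 * R.dotError * σ ^ 2 * K := by
    refine (hr.abs_sub_le_range hε0 (le_two_pow_sumDepth k)
      (hR.dotError_le.trans (by norm_num))).trans ?_
    have h1 : ∑ j ∈ Finset.range n, |R.w j * A j| ≤ 4 * σ * (3 * σ * K) := by
      calc _ ≤ ∑ j ∈ Finset.range n, |R.w j| * (3 * σ * K) := by
            refine Finset.sum_le_sum fun j hj => ?_
            rw [abs_mul]
            exact mul_le_mul_of_nonneg_left (hc j (Finset.mem_range.1 hj)).2 (abs_nonneg _)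
        _ ≤ _ := by
            rw [← Finset.sum_mul]
            exact mul_le_mul_of_nonneg_right hw (by positivity)
    rw [mul_assoc 2]
    calc _ ≤ 2 * R.dotError * (4 * σ * (3 * σ * K)) :=
          mul_le_mul_of_nonneg_left h1 (mul_nonneg (by norm_num) hu0)
      _ = _ := by ring
  have d2 : |∑ j ∈ Finset.range n, R.w j * (A j - Λ Y j)| ≤ 3200000 * σ ^ 3 * K * R.ε := by
    refine (Finset.abs_sum_le_sum_abs _ _).trans ?_
    calc _ ≤ ∑ j ∈ Finset.range n, |R.w j| * (800000 * σ ^ 2 * K * R.ε) := by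
          refine Finset.sum_le_sum fun j hj => ?_
          rw [abs_mul]
          exact mul_le_mul_of_nonneg_left (hc j (Finset.mem_range.1 hj)).1 (abs_nonneg _)
      _ ≤ 4 * σ * (800000 * σ ^ 2 * K * R.ε) := by
          rw [← Finset.sum_mul]
          exact mul_le_mul_of_nonneg_right hw (by positivity)
      _ = _ := by ring
  have d3 : |∑ j ∈ Finset.range n, Λ Y j * (R.w j - (hessPoly R.c R.H j).eval R.s)| ≤
      153600 * σ ^ 2 * K * R.ε := by
    refine (Finset.abs_sum_le_sum_abs _ _).trans ?_
    calc _ ≤ ∑ j ∈ Finset.range n, (76800 * σ ^ 2 * K * R.ε) * (1 / ((j : ℝ) + 1) ^ 4) := by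
          refine Finset.sum_le_sum fun j hj => ?_
          have hj' := Finset.mem_range.1 hj
          rw [abs_mul]
          calc _ ≤ 2 * σ * K * (1 / ((j : ℝ) + 1) ^ 11) *
                (38400 * σ * ((j : ℝ) + 1) ^ 7 * R.ε) :=
                mul_le_mul (hα j hj') (hR.abs_w_sub_eval_le hj') (abs_nonneg _) (by positivity)
            _ = _ := by field_simp; ring
      _ ≤ (76800 * σ ^ 2 * K * R.ε) * 2 := by
          rw [← Finset.mul_sum]
          exact mul_le_mul_of_nonneg_left (sum_inv_pow_le_two n (by norm_num)) (by positivity)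
      _ = _ := by ring
  -- The three errors are those of the final sum, of the coefficients and of the basis values. The
  -- middle one sets the power σ³: a sum of order σ of the |w_j| times coefficient errors of order
  -- σ².
  have id : r - ∑ j ∈ Finset.range n, Λ Y j * (hessPoly R.c R.H j).eval R.s =
      (r - ∑ j ∈ Finset.range n, R.w j * A j) + ∑ j ∈ Finset.range n, R.w j * (A j - Λ Y j) +
      ∑ j ∈ Finset.range n, Λ Y j * (R.w j - (hessPoly R.c R.H j).eval R.s) := by
    simp only [mul_sub, Finset.sum_sub_distrib, mul_comm (R.w _) (Λ Y _)]
    ring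
  rw [id]
  have q1 : R.dotError * (σ ^ 2 * K) ≤ 4 * σ * R.ε * (σ ^ 2 * K) :=
    mul_le_mul_of_nonneg_right huσ (by positivity)
  have q2 : σ ^ 2 * (K * R.ε) ≤ σ ^ 3 * (K * R.ε) :=
    mul_le_mul_of_nonneg_right (pow_le_pow_right₀ hσ1 (by norm_num)) (by positivity)
  have q3 : 0 ≤ σ ^ 3 * K * R.ε := by positivity
  rw [abs_le] at d1 d2 d3 ⊢
  constructor <;> nlinarith [d1.1, d1.2, d2.1, d2.2, d3.1, d3.2]

end FlRun

end GrassmannCVA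

namespace GrassmannCVA

open Polynomial

/-! ### The error bound -/

/-- One constant serves for all degrees up to the smoothness of `f`: if `f` is not very smooth,
then only finitely many degrees are concerned. -/
theorem exists_poly_approx_of_contDiffOn (f : ℝ → ℝ) :
    ∃ K : ℝ, 0 ≤ K ∧ ∀ k : ℕ, ContDiffOn ℝ ((2 * k + 2 : ℕ)) f (Set.Icc (0 : ℝ) 1) →
      ∀ j < 2 * k + 2, ∃ g : ℝ[X], g.degree < j ∧
        ∀ x ∈ Set.Icc (0 : ℝ) 1, |f x - g.eval x| ≤ K / ((j : ℝ) + 1) ^ 11 ∧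
          |derivWithin f (Set.Icc (0 : ℝ) 1) x - g.derivative.eval x| ≤
            K / ((j : ℝ) + 1) ^ 11 := by
  -- The rate (j + 1)^(-11) requires 23 continuous derivatives, because the weak Jackson estimate
  -- gains only half a power per derivative.
  by_cases h : ContDiffOn ℝ ((2 * 11 + 1 : ℕ)) f (Set.Icc (0 : ℝ) 1)
  · obtain ⟨K, hK0, hK⟩ := exists_poly_approx_derivWithin 11 h
    exact ⟨K, hK0, fun k _ j _ => hK j⟩
  by_cases h1 : ContDiffOn ℝ 1 f (Set.Icc (0 : ℝ) 1)
  · obtain ⟨K₁, hK₁0, hK₁⟩ := exists_abs_le_of_continuousOn h1.continuousOn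
    obtain ⟨K₂, hK₂0, hK₂⟩ := exists_abs_le_of_continuousOn
      (h1.continuousOn_derivWithin (uniqueDiffOn_Icc (zero_lt_one' ℝ)) le_rfl)
    -- Here 2k + 2 < 23, so j + 1 < 23 and the zero polynomial is good enough with this constant.
    refine ⟨23 ^ 11 * (K₁ + K₂), by positivity, fun k hk j hj => ⟨0, ?_, fun x hx => ?_⟩⟩
    · rw [degree_zero]
      exact WithBot.bot_lt_coe j
    have hk' : 2 * k + 2 < 2 * 11 + 1 := by
      by_contra hcon
      exact h (hk.of_le (by exact_mod_cast not_lt.1 hcon))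
    have hle : K₁ + K₂ ≤ 23 ^ 11 * (K₁ + K₂) / ((j : ℝ) + 1) ^ 11 := by
      rw [le_div_iff₀ (by positivity), mul_comm]
      refine mul_le_mul_of_nonneg_right ?_ (by positivity)
      have : (j : ℝ) + 1 ≤ 23 := by exact_mod_cast (by omega : j + 1 ≤ 23)
      gcongr
    rw [derivative_zero, eval_zero, sub_zero, sub_zero]
    exact ⟨(hK₁ x hx).trans (by linarith), (hK₂ x hx).trans (by linarith)⟩
  -- A function that is not even C¹ satisfies the smoothness condition for no k.
  · refine ⟨0, le_rfl, fun k hk => absurd (hk.of_le ?_) h1⟩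
    exact_mod_cast (by omega : 1 ≤ 2 * k + 2)

theorem derivSupNorm_nonneg {d p : ℕ} (F : ℝ → Matrix (Fin d) (Fin p) ℝ) (r : ℕ) :
    0 ≤ derivSupNorm F r :=
  Real.iSup_nonneg fun _ => abs_nonneg _

theorem abs_iteratedDerivWithin_le_derivSupNorm {d p : ℕ} {F : ℝ → Matrix (Fin d) (Fin p) ℝ}
    {r : ℕ} (hF : ∀ a b, ContDiffOn ℝ r (fun t => F t a b) (Set.Icc (0 : ℝ) 1)) (a : Fin d)
    (b : Fin p) {x : ℝ} (hx : x ∈ Set.Icc (0 : ℝ) 1) :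
    |iteratedDerivWithin r (fun t => F t a b) (Set.Icc (0 : ℝ) 1) x| ≤ derivSupNorm F r := by
  have h : ∀ a b, ∃ K : ℝ, 0 ≤ K ∧ ∀ x ∈ Set.Icc (0 : ℝ) 1,
      |iteratedDerivWithin r (fun t => F t a b) (Set.Icc (0 : ℝ) 1) x| ≤ K := fun a b =>
    exists_abs_le_of_continuousOn ((hF a b).continuousOn_iteratedDerivWithin le_rfl
      (uniqueDiffOn_Icc (zero_lt_one' ℝ)))
  choose K hK0 hK using h
  refine le_ciSup (f := fun x : Set.Icc (0 : ℝ) 1 × Fin d × Fin p =>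
    |iteratedDerivWithin r (fun t => F t x.2.1 x.2.2) (Set.Icc (0 : ℝ) 1) x.1|)
    ⟨∑ a, ∑ b, K a b, ?_⟩ (⟨x, hx⟩, a, b)
  rintro _ ⟨⟨y, a, b⟩, rfl⟩
  refine (hK a b y y.2).trans ?_
  calc K a b ≤ ∑ b, K a b := Finset.single_le_sum (fun b _ => hK0 a b) (Finset.mem_univ b)
    _ ≤ _ := Finset.single_le_sum (f := fun a => ∑ b, K a b)
      (fun a _ => Finset.sum_nonneg fun b _ => hK0 a b) (Finset.mem_univ a)

theorem sqrt_pow_three_le {k : ℕ} (hk : 1 ≤ k) :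
    √(2 * (k : ℝ) + 2) ^ 3 ≤ 8 * (k : ℝ) ^ (3 / 2 : ℝ) := by
  have hk' : (1 : ℝ) ≤ k := by exact_mod_cast hk
  have h1 : √(2 * (k : ℝ) + 2) ≤ 2 * √k := by
    rw [Real.sqrt_le_left (by positivity), mul_pow, Real.sq_sqrt (by positivity)]
    linarith
  have h2 : √(k : ℝ) ^ 3 = (k : ℝ) ^ (3 / 2 : ℝ) := by
    rw [Real.sqrt_eq_rpow, ← Real.rpow_natCast, ← Real.rpow_mul (by positivity)]
    norm_num
  calc _ ≤ (2 * √(k : ℝ)) ^ 3 := pow_le_pow_left₀ (Real.sqrt_nonneg _) h1 3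
    _ = _ := by rw [mul_pow, h2]; norm_num

/-- The error of one entry of the computed coordinates. -/
theorem abs_computed_sub_le {k : ℕ} (hk : 1 ≤ k) {ε₀ : ℝ}
    (hε₀ : ∀ R : FlRun k, R.ε ≤ ε₀ → R.Good) {f : ℝ → ℝ}
    (hf : ContDiffOn ℝ ((2 * k + 2 : ℕ)) f (Set.Icc (0 : ℝ) 1)) {K M : ℝ} (hK : 0 ≤ K)
    (hg : ∀ j < 2 * k + 2, ∃ g : ℝ[X], g.degree < j ∧
      ∀ x ∈ Set.Icc (0 : ℝ) 1, |f x - g.eval x| ≤ K / ((j : ℝ) + 1) ^ 11 ∧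
        |derivWithin f (Set.Icc (0 : ℝ) 1) x - g.derivative.eval x| ≤ K / ((j : ℝ) + 1) ^ 11)
    (hM : ∀ ξ ∈ Set.Icc (0 : ℝ) 1,
      |iteratedDerivWithin (2 * k + 2) f (Set.Icc (0 : ℝ) 1) ξ| ≤ M)
    {ε c t r : ℝ} (hε0 : 0 ≤ ε) (hε : ε ≤ ε₀) (ht : t ∈ Set.Icc (0 : ℝ) 1)
    {Q : ℕ → Fin (k + 1) ⊕ Fin (k + 1) → ℝ} {H : ℕ → ℕ → ℝ} {w A : ℕ → ℝ}
    (hc : FlStart ε (k + 1) c) (hQ : FlArnoldi ε (chebNode k) (2 * k + 1) c Q H)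
    (hA : ∀ j ≤ 2 * k + 1, FlDot ε (augIndex (k + 1)) (Q j)
      (Sum.elim (fun i => f (chebNode k i))
        fun i => derivWithin f (Set.Icc (0 : ℝ) 1) (chebNode k i)) (A j))
    (hw : FlEval ε (2 * k + 1) c H t w) (hr : FlDot ε (List.range (2 * k + 2)) w A r) :
    |r - f t| ≤ 1 / (2 ^ (4 * k + 2) * ((2 * k + 2).factorial : ℝ)) * M +
      32000000 * K * (k : ℝ) ^ (3 / 2 : ℝ) * ε := by
  obtain ⟨R, rfl, rfl, rfl, rfl, rfl, rfl⟩ := exists_flRun hε0 ht hc hQ hw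
  have hM0 : 0 ≤ M := (abs_nonneg _).trans (hM _ ht)
  obtain ⟨h, hdeg, hdata, herr⟩ := (hε₀ R hε).exists_interpolant hK (fun j hj => by
    obtain ⟨g, hgd, hgx⟩ := hg j hj
    refine ⟨g, hgd, ?_⟩
    rintro (i | i)
    · exact (hgx _ (chebNode_mem_Icc k i)).1
    · exact (hgx _ (chebNode_mem_Icc k i)).2) hA hr
  have h1 := abs_sub_hermite_le (chebNode_injective k) (chebNode_mem_Icc k) hf hdeg
    (fun i => congrFun hdata (Sum.inl i)) (fun i => congrFun hdata (Sum.inr i)) hM ht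
  have h2 : M / (2 * k + 2).factorial * ∏ i, (R.s - chebNode k i) ^ 2 ≤
      1 / (2 ^ (4 * k + 2) * ((2 * k + 2).factorial : ℝ)) * M := by
    calc _ ≤ M / (2 * k + 2).factorial * (1 / 2 ^ (4 * k + 2)) :=
          mul_le_mul_of_nonneg_left (prod_sub_chebNode_sq_le k ht) (by positivity)
      _ = _ := by field_simp
  have h3 : 4000000 * √(2 * (k : ℝ) + 2) ^ 3 * K * R.ε ≤
      32000000 * K * (k : ℝ) ^ (3 / 2 : ℝ) * R.ε := by
    have := mul_le_mul_of_nonneg_right (sqrt_pow_three_le hk) (mul_nonneg hK hε0)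
    linarith
  have e : r - f R.s = (r - h.eval R.s) - (f R.s - h.eval R.s) := by ring
  rw [e]
  refine (abs_sub _ _).trans ?_
  linarith

end GrassmannCVA

/-! ### The main theorem. -/

theorem theorem4 (n p : ℕ) (hp : p ≤ n) :
    ∃ C : ℝ, 0 < C ∧ ∃ ε₀ : ℕ → ℝ, (∀ k, 0 < ε₀ k) ∧
      ∀ (U : ℝ → Matrix (Fin n) (Fin p) ℝ) (𝒬 : Matrix (Fin n) (Fin p ⊕ Fin (n - p)) ℝ),
        𝒬ᵀ * 𝒬 = 1 → 𝒬 * 𝒬ᵀ = 1 →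
        (∀ t ∈ Set.Icc (0 : ℝ) 1, (U t)ᵀ * U t = 1) →
        (∀ t ∈ Set.Icc (0 : ℝ) 1, IsUnit (upperBlock 𝒬 (U t))) →
        ∃ K : ℝ, 0 ≤ K ∧ ∀ k : ℕ, 1 ≤ k →
          (∀ a b, ContDiffOn ℝ ((2 * k + 2 : ℕ)) (fun t => mvCoord 𝒬 (U t) a b)
            (Set.Icc (0 : ℝ) 1)) →
          ∀ (T : Fin (k + 1) → Matrix (Fin n) (Fin p) ℝ),
            (∀ i, IsHorizontalLift U (chebNode k i) (T i)) →
            ∀ ε : ℝ, 0 ≤ ε → ε ≤ ε₀ k →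
            ∀ t ∈ Set.Icc (0 : ℝ) 1,
            ∀ (Ξhat : Matrix (Fin (n - p)) (Fin p) ℝ) (Uhat : Matrix (Fin n) (Fin p) ℝ),
              FlCVAHermite ε k (fun i => mvCoord 𝒬 (U (chebNode k i)))
                (fun i => mvVelocity 𝒬 (U (chebNode k i)) (T i)) t Ξhat →
              IsReconstruction 𝒬 Ξhat Uhat →
              frobNorm (Uhat * Uhatᵀ - U t * (U t)ᵀ) ≤
                C * (1 / (2 ^ (4 * k + 2) * ((2 * k + 2).factorial : ℝ)) *
                    derivSupNorm (fun τ => mvCoord 𝒬 (U τ)) (2 * k + 2) +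
                  K * (k : ℝ) ^ (3 / 2 : ℝ) * ε) := by
  choose ε₀ hε₀pos hε₀ using FlRun.exists_eps_good
  set L : ℝ := 2 * ((√n + √p * √p) * (√n * (√(n * p) * √p) * √p)) with hL
  have hL0 : 0 ≤ L := by positivity
  -- L may vanish, for instance when p = 0; adding 1 keeps the constant positive.
  refine ⟨L + 1, by positivity, ε₀, hε₀pos, fun U 𝒬 h𝒬 h𝒬' hU hunit => ?_⟩
  -- The constants are attached to the entries of Ξ before k is introduced; their sum serves all
  -- entries at once.
  choose K hK0 hK using fun a b =>
    exists_poly_approx_of_contDiffOn fun t => mvCoord 𝒬 (U t) a b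
  have hKsum : ∀ a b, K a b ≤ ∑ a, ∑ b, K a b := fun a b =>
    calc K a b ≤ ∑ b, K a b := Finset.single_le_sum (fun b _ => hK0 a b) (Finset.mem_univ b)
      _ ≤ _ := Finset.single_le_sum (f := fun a => ∑ b, K a b)
        (fun a _ => Finset.sum_nonneg fun b _ => hK0 a b) (Finset.mem_univ a)
  have hKnonneg : 0 ≤ ∑ a, ∑ b, K a b :=
    Finset.sum_nonneg fun a _ => Finset.sum_nonneg fun b _ => hK0 a b
  refine ⟨32000000 * ∑ a, ∑ b, K a b, by positivity, ?_⟩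
  intro k hk hsmooth T hT ε hε0 hε t ht Ξhat Uhat hΞ hUhat
  obtain ⟨c, Q, H, w, A, hc, hQ, hA, hw, hΞhat⟩ := hΞ
  obtain ⟨S, hS, hV, hVV⟩ := hUhat.exists_graph h𝒬
  have hnode : ∀ i, Set.Icc (0 : ℝ) 1 ∈ nhds (chebNode k i) := fun i =>
    Icc_mem_nhds (chebNode_mem_Ioo k i).1 (chebNode_mem_Ioo k i).2
  -- The Chebyshev nodes are interior points of [0, 1], so the two-sided derivative given by the
  -- lift agrees with the derivative within the interval.
  have hvel : ∀ i a b, mvVelocity 𝒬 (U (chebNode k i)) (T i) a b =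
      derivWithin (fun τ => mvCoord 𝒬 (U τ) a b) (Set.Icc (0 : ℝ) 1) (chebNode k i) := by
    intro i a b
    have hd : ∀ a b, DifferentiableAt ℝ (fun τ => mvCoord 𝒬 (U τ) a b) (chebNode k i) :=
      fun a b => ((hsmooth a b).contDiffAt (hnode i)).differentiableAt
        (by exact_mod_cast (by omega : 2 * k + 2 ≠ 0))
    have h := (hT i).hasDerivAt_mvCoord (𝒬 := 𝒬)
      (Filter.mem_of_superset (hnode i) fun τ hτ => hunit τ hτ) hd a b
    exact (h.hasDerivWithinAt.derivWithin
      (uniqueDiffOn_Icc (zero_lt_one' ℝ) _ (chebNode_mem_Icc k i))).symm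
  have hM0 := derivSupNorm_nonneg (fun τ => mvCoord 𝒬 (U τ)) (2 * k + 2)
  set B := 1 / (2 ^ (4 * k + 2) * ((2 * k + 2).factorial : ℝ)) *
    derivSupNorm (fun τ => mvCoord 𝒬 (U τ)) (2 * k + 2) +
    32000000 * (∑ a, ∑ b, K a b) * (k : ℝ) ^ (3 / 2 : ℝ) * ε with hB
  have hB0 : 0 ≤ B := by positivity
  have hX : ∀ a b, |Ξhat a b - mvCoord 𝒬 (U t) a b| ≤ B := by
    intro a b
    refine (abs_computed_sub_le hk (hε₀ k) (hsmooth a b) (hK0 a b)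
      (hK a b k (hsmooth a b))
      (fun ξ hξ => abs_iteratedDerivWithin_le_derivSupNorm hsmooth a b hξ) hε0 hε ht hc hQ
      (fun j hj => ?_) hw (hΞhat a b)).trans ?_
    · simpa only [hvel] using hA j hj a b
    · rw [hB]
      have := hKsum a b
      gcongr
  refine (norm_projector_sub_le hp h𝒬 hV (eq_graph_mvCoord h𝒬' (hunit t ht)) hS (hunit t ht) hVV
    (hU t ht) hB0 hX).trans ?_
  calc _ = L * B := by rw [hL]; ring
    _ ≤ (L + 1) * B := by nlinarith
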